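/- **Setting.** For $\alpha\in\{0,1\}^3$ a real function $f$ on $\mathbb R^3$ has symmetry $Tf=\alpha$ if it has the same reflection symmetries as the monomial $x^\alpha$, i.e. $f((-1)^{\beta_1}x_1,(-1)^{\beta_2}x_2,(-1)^{\beta_3}x_3)=(-1)^{\alpha\cdot\beta}f(x)$ for all $\beta\in\{0,1\}^3$ and a.e. $x$ (the zero function has every symmetry). A real vector field $v=(v_1,v_2,v_3)$ has symmetry type $T(v)=(\alpha_1,\alpha_2,\alpha_3)$ if $Tv_l=\alpha_l$ for $l=1,2,3$. Let $e_1,e_2,e_3$ be the standard unit vectors. Write $\mathbb P\nabla(u\otimes v)=\sum_j\partial_j(u_jv)+(-\Delta)^{-1}\nabla\sum_{j,k}\partial_j\partial_k(u_jv_k)$ and $B(u,v)(t)=\int_0^t e^{(t-s)\Delta}\mathbb P\nabla(u\otimes v)(s)\,ds$. Let $u_0$ be a real divergence-free vector field on $\mathbb R^3$ with $\int|u_0|^2(1+|x|)^{-4}dx<\infty$. A (global) real mild solution of the Navier–Stokes equations with initial datum $u_0$ is a real field $u(t,x)$ with $u(0)=u_0$ and $\operatorname{div}u(t)=0$ for all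 $t\ge 0$, which satisfies $u(t)=e^{t\Delta}u_0-B(u,u)(t)$ for $t>0$ and is the limit, in the sense of tempered distributions at each time $t>0$, of the iterates $u^{0}=e^{t\Delta}u_0$, $u^{\tau+1}=u^0-B(u^\tau,u^\tau)$. Here $v=u$ and all iterates $v=u^\tau$ are required to be measurable on $(0,\infty)\times\mathbb R^3$, to satisfy $\int|v(t,x)|^2(1+|x|)^{-4}dx<\infty$ for each $t>0$ and $\int_0^T\!\int|v|^2(1+|x|)^{-4}dx\,dt<\infty$ for each $T>0$, and to be such that, for each $t>0$ and a.e. $x$, the integrals over $(0,t)\times\mathbb R^3$ defining $B(v,v)(t,x)$ through the kernel of $e^{(t-s)\Delta}\mathbb P\nabla$ converge absolutely. **Theorem.** Let $u$ be a real mild solution with initial datum $u_0$, where $u_0$ has some symmetry type. Assume that $u$ is not two-and-a-half dimensional, in the following sense: for every $t\ge0$ and $l\in\{1,2,3\}$, if $u_l(t,\cdot)$ is not identically zero, then every component of $u(t,\cdot)$ that does not depend on the variable $x_l$ is constant. (This holds, for instance, if each $u(t,\cdot)$ is the sum of a constant vector and a field in $L^p(\mathbb R^3)$ with $p<\infty$.)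 Then $u$ has the same symmetry type for all $t\ge0$, that is, there are $\alpha_1,\alpha_2,\alpha_3\in\{0,1\}^3$ with $T(u(t,\cdot))=(\alpha_1,\alpha_2,\alpha_3)$ for all $t\ge0$, if and only if one of the following holds: (i) $T(u_0)=(e_1,e_2,e_3)$; (ii) $\operatorname{div}u_0=0$ and $\mathbb P\nabla(e^{t\Delta}u_0\otimes e^{t\Delta}u_0)=0$ in the sense of tempered distributions for all $t>0$. -/

import Mathlib

open MeasureTheory Filter Topology
open scoped SchwartzMap

noncomputable section

namespace NavierStokes

/-- Euclidean three-space. -/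
abbrev E3 : Type := EuclideanSpace ℝ (Fin 3)

/-! ### Reflection symmetries -/

/-- The reflection `x ↦ ((-1)^β₁ x₁, (-1)^β₂ x₂, (-1)^β₃ x₃)`. -/
def reflect (β : Fin 3 → ZMod 2) (x : E3) : E3 :=
  WithLp.toLp 2 (fun i => (-1 : ℝ) ^ (β i).val * x i)

/-- The factor picked up by the monomial `x^α` under `reflect β`. -/
def reflectSign (α β : Fin 3 → ZMod 2) : ℝ :=
  ∏ i, (-1 : ℝ) ^ ((α i).val * (β i).val)

/-- `T f = α`: the real function `f` has the same reflection symmetry as the monomial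
`x^α = x₁^α₁ x₂^α₂ x₃^α₃`. Functions are identified when they agree almost everywhere; the zero
function has every symmetry. -/
def HasSymmetry (f : E3 → ℝ) (α : Fin 3 → ZMod 2) : Prop :=
  ∀ β : Fin 3 → ZMod 2, ∀ᵐ x : E3, f (reflect β x) = reflectSign α β * f x

/-- `T v = (α 0, α 1, α 2)`: componentwise symmetry type of a real vector field. -/
def HasSymmetryType (v : E3 → E3) (α : Fin 3 → Fin 3 → ZMod 2) : Prop :=
  ∀ l, HasSymmetry (fun x => v x l) (α l)

/-- The symmetry type `(e₁, e₂, e₃)`. -/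
def basicType : Fin 3 → Fin 3 → ZMod 2 := fun l => Pi.single l 1

/-! ### Heat semigroup, inverse Laplacian and Leray projection -/

/-- The partial derivative `∂_j f`. -/
def partialDeriv (j : Fin 3) (f : E3 → ℝ) (x : E3) : ℝ :=
  fderiv ℝ f x (EuclideanSpace.single j 1)

/-- The Gauss kernel `(4 π t)^(-3/2) exp(-|x|² / (4 t))`, for `t > 0`. -/
def heatKernel (t : ℝ) (x : E3) : ℝ :=
  (4 * Real.pi * t) ^ (-(3 / 2) : ℝ) * Real.exp (-(‖x‖ ^ 2) / (4 * t))

/-- `e^{tΔ} f`, for a scalar function `f` and `t > 0`. -/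
def heat (t : ℝ) (f : E3 → ℝ) (x : E3) : ℝ :=
  ∫ y, heatKernel t (x - y) * f y

/-- `e^{tΔ} v`, for a vector field `v` and `t > 0`. -/
def heatVec (t : ℝ) (v : E3 → E3) (x : E3) : E3 :=
  WithLp.toLp 2 (fun l => heat t (fun y => v y l) x)

/-- `(-Δ)⁻¹ f`, the Newtonian potential of `f` on three-space. -/
def invNegLaplacian (f : E3 → ℝ) (x : E3) : ℝ :=
  ∫ y, (1 / (4 * Real.pi * ‖x - y‖)) * f y

/-- For a smooth rapidly decreasing `φ`, the function
`δ_{kl} ∂_j φ + (-Δ)⁻¹ ∂_j ∂_k ∂_l φ`. It is the symbol of the bilinear term: the `l`-th component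
of `ℙ∇(u ⊗ v) = ∑_j ∂_j (u_j v) + (-Δ)⁻¹ ∇ ∑_{j,k} ∂_j ∂_k (u_j v_k)` is
`∑_{j,k} (δ_{kl} ∂_j + (-Δ)⁻¹ ∂_j ∂_k ∂_l) (u_j v_k)`. -/
def lerayDeriv (j k l : Fin 3) (φ : E3 → ℝ) (x : E3) : ℝ :=
  (if k = l then partialDeriv j φ x else 0) +
    invNegLaplacian (partialDeriv j (partialDeriv k (partialDeriv l φ))) x

/-- The tempered distribution `ℙ∇(u ⊗ v)`, `l`-th component, paired with a test function `φ`. The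
operator `δ_{kl} ∂_j + (-Δ)⁻¹ ∂_j ∂_k ∂_l` is skew-adjoint, whence the minus sign. The integrals
converge absolutely when `u` and `v` are square integrable against the weight `(1 + |x|)⁻⁴`. -/
def lerayBilinear (u v : E3 → E3) (l : Fin 3) (φ : 𝓢(E3, ℝ)) : ℝ :=
  -∑ j, ∑ k, ∫ x, u x j * v x k * lerayDeriv j k l (fun y => φ y) x

/-- The kernel of `e^{tΔ} (δ_{kl} ∂_j + (-Δ)⁻¹ ∂_j ∂_k ∂_l)`, for `t > 0`. -/
def oseenKernel (j k l : Fin 3) (t : ℝ) : E3 → ℝ :=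
  lerayDeriv j k l (heatKernel t)

/-- `B(u, v)(t, x) = ∫₀ᵗ e^{(t-s)Δ} ℙ∇(u ⊗ v)(s, x) ds`. -/
def duhamel (u v : ℝ → E3 → E3) (t : ℝ) (x : E3) : E3 :=
  WithLp.toLp 2 (fun l => ∑ j, ∑ k, ∫ s in Set.Ioo 0 t, ∫ y,
    oseenKernel j k l (t - s) (x - y) * (u s y j * v s y k))

/-! ### Mild solutions -/

/-- The iterates `u⁰ = e^{tΔ} u₀`, `u^{τ+1} = u⁰ - B(u^τ, u^τ)`. -/
def picard (u₀ : E3 → E3) : ℕ → ℝ → E3 → E3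
  | 0 => fun t => heatVec t u₀
  | n + 1 => fun t x => heatVec t u₀ x - duhamel (picard u₀ n) (picard u₀ n) t x

/-- `div v = 0` in the sense of tempered distributions. -/
def IsSolenoidal (v : E3 → E3) : Prop :=
  ∀ φ : 𝓢(E3, ℝ), ∫ x, ∑ l, v x l * partialDeriv l (fun y => φ y) x = 0

/-- Vector fields that are square integrable against the weight `(1 + |x|)⁻⁴`. This contains
the fields in `L^p` for `2 ≤ p ≤ ∞`, in particular `Ḣ^{1/2}`. -/
structure WeightedL2 (v : E3 → E3) : Prop where
  aestronglyMeasurable : AEStronglyMeasurable v volume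
  integrable : Integrable (fun x => ‖v x‖ ^ 2 / (1 + ‖x‖) ^ 4)

/-- The time dependent vector fields `v` for which `B(v, v)` makes sense as an absolutely
convergent integral. -/
structure InPathSpace (v : ℝ → E3 → E3) : Prop where
  aestronglyMeasurable : AEStronglyMeasurable (fun p : ℝ × E3 => v p.1 p.2)
    ((volume.restrict (Set.Ioi 0)).prod volume)
  weightedL2 : ∀ t, 0 < t → WeightedL2 (v t)
  integrable : ∀ t, 0 < t → Integrable (fun p : ℝ × E3 => ‖v p.1 p.2‖ ^ 2 / (1 + ‖p.2‖) ^ 4)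
    ((volume.restrict (Set.Ioo 0 t)).prod volume)
  duhamel_integrable : ∀ t, 0 < t → ∀ᵐ x : E3, ∀ j k l : Fin 3,
    Integrable (fun p : ℝ × E3 =>
      oseenKernel j k l (t - p.1) (x - p.2) * (v p.1 p.2 j * v p.1 p.2 k))
      ((volume.restrict (Set.Ioo 0 t)).prod volume)

/-- `u` is a (global, real valued) mild solution of the Navier-Stokes equations on three-space with
initial datum `u₀`: a divergence free solution of `u = e^{tΔ} u₀ - B(u, u)` which is the limit of
the iterates `picard u₀ τ`. Only the weakest mode of convergence is asked for, that of tempered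
distributions at each time. -/
structure IsMildSolution (u₀ : E3 → E3) (u : ℝ → E3 → E3) : Prop where
  data_weightedL2 : WeightedL2 u₀
  data_solenoidal : IsSolenoidal u₀
  initial : u 0 =ᵐ[volume] u₀
  inPathSpace : InPathSpace u
  solenoidal : ∀ t, 0 < t → IsSolenoidal (u t)
  integral_equation : ∀ t, 0 < t →
    u t =ᵐ[volume] fun x => heatVec t u₀ x - duhamel u u t x
  picard_inPathSpace : ∀ n, InPathSpace (picard u₀ n)
  picard_tendsto : ∀ t, 0 < t → ∀ (l : Fin 3) (φ : 𝓢(E3, ℝ)),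
    Tendsto (fun n => ∫ x, picard u₀ n t x l * φ x) atTop (𝓝 (∫ x, u t x l * φ x))

/-- `u₀` is of Beltrami type: `div u₀ = 0` and `ℙ∇(e^{tΔ} u₀ ⊗ e^{tΔ} u₀) = 0` for all `t > 0`, as
tempered distributions. -/
def IsBeltramiType (u₀ : E3 → E3) : Prop :=
  IsSolenoidal u₀ ∧ ∀ t, 0 < t → ∀ (l : Fin 3) (φ : 𝓢(E3, ℝ)),
    lerayBilinear (heatVec t u₀) (heatVec t u₀) l φ = 0

/-! ### Flows that degenerate to two dimensions -/

/-- `f` does not depend on the variable `x_l`. -/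
def IndependentOf (f : E3 → ℝ) (l : Fin 3) : Prop :=
  ∀ h : ℝ, ∀ᵐ x : E3, f (x + EuclideanSpace.single l h) = f x

/-- `f` is a constant function. -/
def IsConstant (f : E3 → ℝ) : Prop :=
  ∃ c : ℝ, ∀ᵐ x : E3, f x = c

/-- Whenever the component `v_l` does not vanish identically, every component of `v` that does not
depend on `x_l` is constant. This excludes the two-and-a-half dimensional fields
`v(x) = (v₁(x₁, x₂), v₂(x₁, x₂), v₃(x₁, x₂))` with `v₃ ≠ 0`. It holds if `v` is the sum of a constant
vector and a field in `L^p`, `p < ∞`, or a planar field with `v₃ = 0` whose components `v₁, v₂`,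
unless constant, depend on both `x₁` and `x₂`. -/
def NotTwoAndHalfDimensional (v : E3 → E3) : Prop :=
  ∀ l : Fin 3, (¬ ∀ᵐ x : E3, v x l = 0) →
    ∀ k : Fin 3, IndependentOf (fun x => v x k) l → IsConstant (fun x => v x k)

end NavierStokes

end

noncomputable section

namespace NavierStokes

/-! ### Gauss kernels -/

/-! Write γ_l = α_l + e_l in (ℤ/2)³. The kernel with indices j, k, l of e^{tΔ}ℙ∇ has the parity of
x_j x_k x_l, so u_j u_k contributes to B(u,u)_l a term of symmetry e_l + γ_j + γ_k
(`hasSymmetry_duhamelTerm`). For the type (e₁,e₂,e₃) all γ_l vanish, the iterates keep the type, and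
it passes to their limit (`hasSymmetryType_picard`, `HasSymmetry.of_tendsto`). For Beltrami data
every iterate is the heat flow of u₀, hence so is u (`IsMildSolution.ae_eq_heatVec`), and the heat
flow keeps any symmetry type.

Conversely, let u keep the type α. Since B(u,u)_l = e^{tΔ}u₀_l - u_l has symmetry α_l, orthogonality
of characters makes the terms with γ_j + γ_k = δ cancel among themselves whenever δ ≠ γ_l
(`IsMildSolution.ae_sum_group_eq_zero`). The divergence splits in the same way: ∂_l u_l has symmetry
γ_l, so if γ_r differs from the other two, then ∂_r u_r = 0, and the dimension hypothesis makes u_r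
constant in space. There remain three cases (`trichotomy`). If all γ_l equal g, then either g = 0
and α is the basic type, or all terms lie in the group δ = 0 ≠ g and B(u,u) = 0. If all γ_l are
distinct, u₀ is constant. If only γ_r is exceptional, u_r is a constant c(t), and the terms form the
group δ = 0 and a mixed group in which exactly one of j, k is r. In the delicate subcase the other
γ_l are 0: the mixed group then reduces to c ∂_r u_l, so where c ≠ 0 the whole field is constant.
This forces B(u,u) = 0, unless c(0) = 0, where u₀ is of basic type. In the other subcases the
cancellations give B(u,u) = 0 directly.

It remains to deduce the Beltrami property from B(u,u) = 0 (`IsMildSolution.isBeltramiType`), using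
only weighted integrability. Applying e^{(T-t)Δ} to the Duhamel integral over (0,t) replaces the
kernel at time t-s by the one at T-s, so the integrand no longer depends on t. Differentiation in t
makes it vanish for a.e. s (`ae_kernel_eq_zero_of_duhamel`). Letting T decrease to s through
rationals gives ℙ∇(u⊗u)(s) = 0 for a.e. s; here u(s) is the heat flow, and continuity in s gives
every s.

The kernel estimates rest on (-Δ)⁻¹ = ∫₀^∞ e^{σΔ} dσ, which turns the Oseen kernel into a time
integral of derivatives of Gauss kernels (`oseenKernel_eq`). This yields oddness, parity and the
bound by (t + |x|²)⁻², the decay matching the weight of the function class. -/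

/-- The unit vector in direction `j`. -/
abbrev basisVec (j : Fin 3) : E3 := EuclideanSpace.single j 1

/-- The weight `(1 + |x|²)⁻²`. -/
def wt (x : E3) : ℝ := ((1 + ‖x‖ ^ 2) ^ 2)⁻¹

lemma wt_pos (x : E3) : 0 < wt x := by unfold wt; positivity

lemma wt_nonneg (x : E3) : 0 ≤ wt x := (wt_pos x).le

lemma wt_le_one (x : E3) : wt x ≤ 1 := by
  unfold wt
  apply inv_le_one_of_one_le₀
  apply one_le_pow₀
  nlinarith [sq_nonneg ‖x‖]

lemma continuous_wt : Continuous wt := by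
  unfold wt
  refine Continuous.inv₀ (by fun_prop) (fun x => ?_)
  positivity

lemma wt_neg (x : E3) : wt (-x) = wt x := by simp [wt]

lemma integrable_wt : Integrable wt := by
  have h := integrable_rpow_neg_one_add_norm_sq (E := E3) (μ := volume) (r := 4)
    (by simp; norm_num)
  refine h.congr (Eventually.of_forall fun x => ?_)
  have : (0 : ℝ) ≤ 1 + ‖x‖ ^ 2 := by positivity
  simp only [wt]
  rw [show (-4 / 2 : ℝ) = -((2 : ℕ) : ℝ) by norm_num, Real.rpow_neg this, Real.rpow_natCast]

/-- Peetre's inequality for the weight. -/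
lemma wt_sub_le (x y : E3) : wt (x - y) ≤ 4 * (1 + ‖y‖ ^ 2) ^ 2 * wt x := by
  have h1 : ‖x‖ ≤ ‖x - y‖ + ‖y‖ := by simpa using norm_add_le (x - y) y
  have h2 : 1 + ‖x‖ ^ 2 ≤ 2 * (1 + ‖y‖ ^ 2) * (1 + ‖x - y‖ ^ 2) := by
    have : ‖x‖ ^ 2 ≤ (‖x - y‖ + ‖y‖) ^ 2 := by gcongr
    nlinarith [sq_nonneg (‖x - y‖ - ‖y‖), mul_nonneg (sq_nonneg ‖x - y‖) (sq_nonneg ‖y‖)]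
  have h3 : (1 + ‖x‖ ^ 2) ^ 2 ≤ (2 * (1 + ‖y‖ ^ 2) * (1 + ‖x - y‖ ^ 2)) ^ 2 := by gcongr
  unfold wt
  rw [inv_le_iff_one_le_mul₀ (by positivity)]
  rw [mul_assoc, mul_comm, mul_assoc, inv_mul_eq_div, one_le_div (by positivity)]
  nlinarith [h3]

/-- Passes from the weight in `WeightedL2` to the smooth weight `wt`; the 4 is the square of the
constant in (1 + r)² ≤ 2(1 + r²). -/
lemma norm_sq_le_of_weighted (a x : E3) : ‖a‖ ^ 2 * wt x ≤ 4 * (‖a‖ ^ 2 / (1 + ‖x‖) ^ 4) := by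
  have : (1 + ‖x‖) ^ 4 ≤ 4 * (1 + ‖x‖ ^ 2) ^ 2 := by
    have : (1 + ‖x‖) ^ 2 ≤ 2 * (1 + ‖x‖ ^ 2) := by nlinarith [sq_nonneg (1 - ‖x‖)]
    calc (1 + ‖x‖) ^ 4 = ((1 + ‖x‖) ^ 2) ^ 2 := by ring
      _ ≤ (2 * (1 + ‖x‖ ^ 2)) ^ 2 := by gcongr
      _ = _ := by ring
  unfold wt
  rw [← div_eq_mul_inv, ← mul_div_assoc, div_le_div_iff₀ (by positivity) (by positivity)]
  nlinarith [mul_le_mul_of_nonneg_left this (sq_nonneg ‖a‖)]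

lemma heatKernel_pos {t : ℝ} (ht : 0 < t) (x : E3) : 0 < heatKernel t x := by
  unfold heatKernel; positivity

lemma heatKernel_neg (t : ℝ) (x : E3) : heatKernel t (-x) = heatKernel t x := by
  simp [heatKernel]

lemma measurable_heatKernel : Measurable (fun p : ℝ × E3 => heatKernel p.1 p.2) := by
  unfold heatKernel; fun_prop

lemma heatKernel_eq (t : ℝ) :
    heatKernel t = fun x => (4 * Real.pi * t) ^ (-(3 / 2) : ℝ) *
      Real.exp (-(1 / (4 * t)) * ‖x‖ ^ 2) := by
  funext x
  unfold heatKernel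
  congr 2
  ring

lemma integrable_heatKernel {t : ℝ} (ht : 0 < t) : Integrable (heatKernel t) := by
  have h := (GaussianFourier.integrable_cexp_neg_mul_sq_norm_add (V := E3)
    (b := ((1 / (4 * t) : ℝ) : ℂ)) (by rw [Complex.ofReal_re]; positivity) 0 0).re
  rw [heatKernel_eq]
  refine Integrable.const_mul ?_ _
  refine h.congr (Eventually.of_forall fun x => ?_)
  simp only [zero_mul, add_zero, RCLike.re_to_complex]
  rw [← Complex.ofReal_pow, ← Complex.ofReal_neg, ← Complex.ofReal_mul, Complex.exp_ofReal_re]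

lemma integral_exp_neg_mul_sq_norm {b : ℝ} (hb : 0 < b) :
    ∫ v : E3, Real.exp (-b * ‖v‖ ^ 2) = (Real.pi / b) ^ (3 / 2 : ℝ) := by
  rw [GaussianFourier.integral_rexp_neg_mul_sq_norm hb]
  simp

lemma integral_heatKernel {t : ℝ} (ht : 0 < t) : ∫ x, heatKernel t x = 1 := by
  rw [heatKernel_eq, integral_const_mul, integral_exp_neg_mul_sq_norm (by positivity),
    Real.rpow_neg (by positivity)]
  have : Real.pi / (1 / (4 * t)) = 4 * Real.pi * t := by field_simp
  rw [this]
  exact inv_mul_cancel₀ (by positivity)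

/-- The Gauss kernels form a convolution semigroup. -/
lemma heatKernel_semigroup {s t : ℝ} (hs : 0 < s) (ht : 0 < t) (x : E3) :
    ∫ y, heatKernel s (x - y) * heatKernel t y = heatKernel (s + t) x := by
  have hst : 0 < s + t := by positivity
  have key : ∀ y : E3, heatKernel s (x - y) * heatKernel t y =
      ((4 * Real.pi * s) ^ (-(3 / 2) : ℝ) * (4 * Real.pi * t) ^ (-(3 / 2) : ℝ) *
        Real.exp (-(‖x‖ ^ 2) / (4 * (s + t)))) *
        Real.exp (-((s + t) / (4 * s * t)) * ‖y - (t / (s + t)) • x‖ ^ 2) := by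
    intro y
    unfold heatKernel
    have : Real.exp (-(‖x‖ ^ 2) / (4 * (s + t))) *
        Real.exp (-((s + t) / (4 * s * t)) * ‖y - (t / (s + t)) • x‖ ^ 2) =
        Real.exp (-(‖x - y‖ ^ 2) / (4 * s)) * Real.exp (-(‖y‖ ^ 2) / (4 * t)) := by
      rw [← Real.exp_add, ← Real.exp_add]
      congr 1
      rw [norm_sub_sq_real, norm_sub_sq_real, inner_smul_right, norm_smul, mul_pow,
        Real.norm_eq_abs, sq_abs, real_inner_comm]
      field_simp
      ring
    linear_combination -((4 * Real.pi * s) ^ (-(3 / 2) : ℝ) *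
      (4 * Real.pi * t) ^ (-(3 / 2) : ℝ)) * this
  simp_rw [key]
  rw [integral_const_mul, integral_sub_right_eq_self (fun y : E3 =>
    Real.exp (-((s + t) / (4 * s * t)) * ‖y‖ ^ 2)), integral_exp_neg_mul_sq_norm (by positivity)]
  unfold heatKernel
  have h1 : (4 * Real.pi * s) ^ (-(3 / 2) : ℝ) * (4 * Real.pi * t) ^ (-(3 / 2) : ℝ) *
      (Real.pi / ((s + t) / (4 * s * t))) ^ (3 / 2 : ℝ) =
      (4 * Real.pi * (s + t)) ^ (-(3 / 2) : ℝ) := by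
    rw [Real.rpow_neg (by positivity), Real.rpow_neg (by positivity),
      Real.rpow_neg (by positivity), ← Real.inv_rpow (by positivity),
      ← Real.inv_rpow (by positivity), ← Real.inv_rpow (by positivity),
      ← Real.mul_rpow (by positivity) (by positivity),
      ← Real.mul_rpow (by positivity) (by positivity)]
    congr 1
    field_simp
  rw [← h1]
  ring

lemma hasFDerivAt_heatKernel (t : ℝ) (x : E3) :
    HasFDerivAt (heatKernel t) (-(heatKernel t x / (2 * t)) • innerSL ℝ x) x := by
  have h : HasFDerivAt (heatKernel t) _ x :=
    (((((hasStrictFDerivAt_norm_sq x).hasFDerivAt).neg).mul_const ((4 * t)⁻¹)).exp).const_mul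
      ((4 * Real.pi * t) ^ (-(3 / 2) : ℝ))
  refine h.congr_fderiv ?_
  ext y
  simp only [heatKernel, smul_apply, neg_apply,
    smul_eq_mul, innerSL_apply_apply, nsmul_eq_mul, Pi.neg_apply, div_eq_mul_inv, mul_inv]
  simp
  ring

/-- Since r² ≥ r - 1, the Gaussian is dominated by an exponential in 1 + r, against which s^m e^{-s}
≤ m! suffices. -/
lemma exists_gaussian_decay {b : ℝ} (hb : 0 < b) (m : ℕ) :
    ∃ C, ∀ r : ℝ, 0 ≤ r → (1 + r) ^ m * Real.exp (-(b * r ^ 2)) ≤ C := by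
  have hpos : ∀ r : ℝ, 0 ≤ r → (1 + r) ^ m * Real.exp (-(b * r ^ 2)) ≤
      Real.exp b * ((1 + r) ^ m * Real.exp (-(b * (1 + r)))) * Real.exp b := by
    intro r hr
    rw [mul_comm (Real.exp b), mul_assoc, mul_assoc, ← Real.exp_add, ← Real.exp_add]
    gcongr
    nlinarith [sq_nonneg (r - 1)]
  have htend := Real.tendsto_pow_mul_exp_neg_atTop_nhds_zero m
  obtain ⟨C, hC⟩ : ∃ C, ∀ s : ℝ, 0 ≤ s → s ^ m * Real.exp (-s) ≤ C := by
    refine ⟨m.factorial, fun s hs => ?_⟩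
    rw [Real.exp_neg, ← div_eq_mul_inv, div_le_iff₀ (Real.exp_pos _)]
    have := Real.pow_div_factorial_le_exp s hs m
    rw [div_le_iff₀ (by positivity)] at this
    linarith
  refine ⟨Real.exp b * (C / b ^ m) * Real.exp b, fun r hr => (hpos r hr).trans ?_⟩
  gcongr
  rw [le_div_iff₀ (by positivity)]
  have := hC (b * (1 + r)) (by positivity)
  rw [mul_pow] at this
  linarith

/-- The Gauss kernel as a Schwartz function. -/
lemma exists_schwartz_heatKernel {t : ℝ} (ht : 0 < t) :
    ∃ φ : 𝓢(E3, ℝ), (φ : E3 → ℝ) = heatKernel t := by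
  let g : E3 → ℝ := fun x => -(‖x‖ ^ 2) / (4 * t)
  have hg : g.HasTemperateGrowth := by
    have : g = fun x => (-(4 * t)⁻¹) * ‖x‖ ^ 2 := by
      funext x; simp only [g]; field_simp
    rw [this]
    fun_prop
  have hexp : ∀ (i : ℕ) (s : ℝ), ‖iteratedFDeriv ℝ i Real.exp s‖ = Real.exp s := by
    intro i s
    rw [norm_iteratedFDeriv_eq_norm_iteratedDeriv, iteratedDeriv_eq_iterate,
      Real.iter_deriv_exp, Real.norm_eq_abs, abs_of_pos (Real.exp_pos _)]
  have hsm : ContDiff ℝ (⊤ : ℕ∞) (Real.exp ∘ g) := Real.contDiff_exp.comp hg.1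
  have hdecay : ∀ k n : ℕ, ∃ C, ∀ x, ‖x‖ ^ k * ‖iteratedFDeriv ℝ n (Real.exp ∘ g) x‖ ≤ C := by
    intro k n
    obtain ⟨l, C, hC, hgrowth⟩ := hg.norm_iteratedFDeriv_le_uniform n
    obtain ⟨C', hC'⟩ := exists_gaussian_decay (b := (4 * t)⁻¹) (by positivity) (k + l * n)
    refine ⟨n.factorial * (C + 1) ^ n * C', fun x => ?_⟩
    -- The Faà di Bruno bound wants the N-th derivative of the inner function below an N-th power.
    -- All derivatives of exp equal exp, so the Gaussian factor survives and beats the polynomial.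
    have hgrowth' : ∀ N : ℕ, 1 ≤ N → N ≤ n →
        ‖iteratedFDeriv ℝ N g x‖ ≤ ((C + 1) * (1 + ‖x‖) ^ l) ^ N := by
      intro N hN₁ hN₂
      refine (hgrowth N hN₂ x).trans ?_
      rw [mul_pow]
      have hN₁' := (lt_of_lt_of_le zero_lt_one hN₁).ne'
      gcongr
      · exact le_trans (by simp) (le_self_pow₀ (by simp [hC]) hN₁')
      · refine le_self_pow₀ (one_le_pow₀ ?_) hN₁'
        simp only [le_add_iff_nonneg_right, norm_nonneg]
    have h1 := norm_iteratedFDeriv_comp_le (n := n) (N := (⊤ : ℕ∞)) Real.contDiff_exp hg.1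
      (mod_cast le_top) x (C := Real.exp (g x)) (fun i _ => (hexp i _).le) hgrowth'
    calc ‖x‖ ^ k * ‖iteratedFDeriv ℝ n (Real.exp ∘ g) x‖
        ≤ (1 + ‖x‖) ^ k * (n.factorial * Real.exp (g x) * ((C + 1) * (1 + ‖x‖) ^ l) ^ n) := by
          gcongr
          linarith
      _ = n.factorial * (C + 1) ^ n * ((1 + ‖x‖) ^ (k + l * n) * Real.exp (g x)) := by
          rw [mul_pow, pow_add, ← pow_mul]; ring
      _ ≤ n.factorial * (C + 1) ^ n * C' := by
          have := hC' ‖x‖ (norm_nonneg x)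
          have hgx : g x = -((4 * t)⁻¹ * ‖x‖ ^ 2) := by simp only [g]; field_simp
          rw [hgx]
          gcongr
  let φ : 𝓢(E3, ℝ) := ⟨Real.exp ∘ g, hsm, hdecay⟩
  refine ⟨(4 * Real.pi * t) ^ (-(3 / 2) : ℝ) • φ, ?_⟩
  funext x
  rfl

/-- The Gauss kernel as a Schwartz function, for `t > 0`. -/
def gauss (t : ℝ) : 𝓢(E3, ℝ) :=
  if ht : 0 < t then (exists_schwartz_heatKernel ht).choose else 0

lemma coe_gauss {t : ℝ} (ht : 0 < t) : (gauss t : E3 → ℝ) = heatKernel t := by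
  unfold gauss
  rw [dif_pos ht]
  exact (exists_schwartz_heatKernel ht).choose_spec

lemma continuous_heatKernel {t : ℝ} (ht : 0 < t) : Continuous (heatKernel t) := by
  rw [← coe_gauss ht]; exact (gauss t).continuous

/-! ### Derivatives and convolutions of Schwartz functions -/

/-- The partial derivative of a Schwartz function. -/
def pd (j : Fin 3) (φ : 𝓢(E3, ℝ)) : 𝓢(E3, ℝ) := LineDeriv.lineDerivOp (basisVec j) φ

lemma coe_pd (j : Fin 3) (φ : 𝓢(E3, ℝ)) : (pd j φ : E3 → ℝ) = partialDeriv j φ := by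
  funext x
  exact SchwartzMap.lineDerivOp_apply_eq_fderiv _ _ _

/-- The Schwartz function `y ↦ φ (x - y)`. -/
def reflTrans (x : E3) (φ : 𝓢(E3, ℝ)) : 𝓢(E3, ℝ) :=
  SchwartzMap.compCLMOfAntilipschitz (g := fun y => x - y) (K := 1) ℝ (by fun_prop)
    (fun _ _ => by simp [edist_dist, dist_eq_norm, norm_sub_rev]) φ

lemma partialDeriv_comp_sub (j : Fin 3) (f : E3 → ℝ) (x y : E3) :
    partialDeriv j (fun z => f (x - z)) y = -partialDeriv j f (x - y) := by
  unfold partialDeriv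
  have h : fderiv ℝ (fun z => f (x - z)) y =
      (fderiv ℝ f (x - y)).comp (-ContinuousLinearMap.id ℝ E3) := by
    have h1 : (fun z => f (x - z)) = (fun w => f (x + w)) ∘ (ContinuousLinearEquiv.neg ℝ (M := E3)) := by
      funext z; simp [sub_eq_add_neg]
    rw [h1, ContinuousLinearEquiv.comp_right_fderiv, fderiv_comp_add_left]
    simp only [ContinuousLinearEquiv.neg_apply, ← sub_eq_add_neg]
    rfl
  rw [h]
  simp

/-- The convolution of two Schwartz functions. -/
def cv (φ ψ : 𝓢(E3, ℝ)) (x : E3) : ℝ := ∫ y, φ (x - y) * ψ y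

lemma cv_comm (φ ψ : 𝓢(E3, ℝ)) (x : E3) : cv φ ψ x = cv ψ φ x := by
  unfold cv
  rw [← integral_sub_left_eq_self _ volume x]
  simp [mul_comm]

lemma partialDeriv_cv (j : Fin 3) (φ ψ : 𝓢(E3, ℝ)) : partialDeriv j (cv φ ψ) = cv (pd j φ) ψ := by
  funext x
  obtain ⟨C, hC⟩ : ∃ C, ∀ y, ‖fderiv ℝ φ y‖ ≤ C := by
    obtain ⟨C, hC⟩ := (SchwartzMap.fderivCLM ℝ E3 ℝ φ).decay 0 0
    exact ⟨C, fun y => by simpa using hC.2 y⟩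
  obtain ⟨C', hC'⟩ := φ.decay 0 0
  have hint : ∀ x, Integrable (fun y => φ (x - y) * ψ y) := by
    intro x
    refine (ψ.integrable (μ := volume)).bdd_mul (c := C')
      (φ.continuous.comp (by fun_prop)).aestronglyMeasurable
      (Eventually.of_forall fun y => by simpa using hC'.2 (x - y))
  have hfd : Continuous (fderiv ℝ φ) := (SchwartzMap.fderivCLM ℝ E3 ℝ φ).continuous
  have h := hasFDerivAt_integral_of_dominated_of_fderiv_le (μ := volume) (s := Set.univ) (x₀ := x)
    (F := fun x y => φ (x - y) * ψ y) (F' := fun x y => ψ y • fderiv ℝ φ (x - y))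
    (bound := fun y => C * ‖ψ y‖) univ_mem
    (Eventually.of_forall fun x => (hint x).1) (hint x)
    (by
      apply Continuous.aestronglyMeasurable
      exact ψ.continuous.smul (hfd.comp (by fun_prop)))
    (Eventually.of_forall fun y x _ => by
      rw [norm_smul, mul_comm]; gcongr; exact hC _)
    (ψ.integrable.norm.const_mul _)
    (Eventually.of_forall fun y x _ => by
      have h1 : HasFDerivAt (fun x => φ (x - y)) (fderiv ℝ φ (x - y)) x := by
        have := (φ.hasFDerivAt (x - y)).comp x ((hasFDerivAt_id x).sub_const y)
        rwa [ContinuousLinearMap.comp_id] at this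
      exact h1.mul_const (ψ y))
  have h' : HasFDerivAt (cv φ ψ) (∫ y, ψ y • fderiv ℝ φ (x - y)) x := h
  have hi : Integrable (fun y => ψ y • fderiv ℝ φ (x - y)) := by
    refine (ψ.integrable.norm.const_mul C).mono' ?_ (Eventually.of_forall fun y => ?_)
    · exact (ψ.continuous.smul (hfd.comp (by fun_prop))).aestronglyMeasurable
    · rw [norm_smul, mul_comm]; gcongr; exact hC _
  unfold partialDeriv
  rw [h'.fderiv, ContinuousLinearMap.integral_apply hi]
  unfold cv
  congr 1
  funext y
  rw [coe_pd]
  simp [partialDeriv, mul_comm]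

lemma cv_gauss {s t : ℝ} (hs : 0 < s) (ht : 0 < t) : cv (gauss s) (gauss t) = gauss (s + t) := by
  funext x
  unfold cv
  rw [coe_gauss hs, coe_gauss ht, coe_gauss (by positivity)]
  exact heatKernel_semigroup hs ht x

/-- The third partial derivative `∂_j ∂_k ∂_l φ`. -/
def pd3 (j k l : Fin 3) (φ : 𝓢(E3, ℝ)) : 𝓢(E3, ℝ) := pd j (pd k (pd l φ))

lemma cv_pd3_gauss (j k l : Fin 3) {s t : ℝ} (hs : 0 < s) (ht : 0 < t) (x : E3) :
    cv (gauss s) (pd3 j k l (gauss t)) x = pd3 j k l (gauss (s + t)) x := by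
  rw [cv_comm]
  unfold pd3
  rw [← partialDeriv_cv, ← partialDeriv_cv, ← partialDeriv_cv, coe_pd, coe_pd, coe_pd,
    add_comm, cv_gauss ht hs]

/-! ### Explicit derivatives of the Gauss kernel -/

lemma inner_basisVec (x : E3) (j : Fin 3) : inner ℝ x (basisVec j) = x j := by
  simp [basisVec, EuclideanSpace.inner_single_right]

lemma partialDeriv_heatKernel (j : Fin 3) (t : ℝ) (x : E3) :
    partialDeriv j (heatKernel t) x = -(x j / (2 * t)) * heatKernel t x := by
  unfold partialDeriv
  rw [(hasFDerivAt_heatKernel t x).fderiv]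
  simp only [smul_apply, smul_eq_mul, innerSL_apply_apply]
  rw [inner_basisVec]
  ring

lemma partialDeriv_mul_heatKernel (j : Fin 3) (t : ℝ) {p : E3 → ℝ} {p' : ℝ} {x : E3}
    (hp : DifferentiableAt ℝ p x) (hp' : partialDeriv j p x = p') :
    partialDeriv j (fun x => p x * heatKernel t x) x =
      (p' - p x * (x j / (2 * t))) * heatKernel t x := by
  have h := hp.hasFDerivAt.mul (hasFDerivAt_heatKernel t x)
  have h2 := partialDeriv_heatKernel j t x
  unfold partialDeriv at hp' h2 ⊢
  rw [(hasFDerivAt_heatKernel t x).fderiv] at h2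
  have h3 : fderiv ℝ (fun x => p x * heatKernel t x) x = _ := h.fderiv
  rw [h3]
  simp only [add_apply, smul_apply, smul_eq_mul] at h2 ⊢
  rw [h2, hp']
  ring

lemma hasFDerivAt_coord (k : Fin 3) (x : E3) :
    HasFDerivAt (fun x : E3 => x k) (EuclideanSpace.proj k : E3 →L[ℝ] ℝ) x :=
  (EuclideanSpace.proj k : E3 →L[ℝ] ℝ).hasFDerivAt

/-- The Kronecker symbol. -/
def kron (j k : Fin 3) : ℝ := if j = k then 1 else 0

lemma proj_basisVec (j k : Fin 3) : (EuclideanSpace.proj k : E3 →L[ℝ] ℝ) (basisVec j) = kron j k := by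
  simp [basisVec, kron, eq_comm]

lemma abs_kron_le (j k : Fin 3) : |kron j k| ≤ 1 := by unfold kron; split_ifs <;> simp

/-- The explicit form of `∂_j ∂_k ∂_l` of the Gauss kernel. -/
def gaussD3 (j k l : Fin 3) (t : ℝ) (x : E3) : ℝ :=
  ((kron j k * x l + kron j l * x k + kron k l * x j) / (4 * t ^ 2) -
    x j * x k * x l / (8 * t ^ 3)) * heatKernel t x

lemma measurable_gaussD3 (j k l : Fin 3) :
    Measurable (fun p : ℝ × E3 => gaussD3 j k l p.1 p.2) := by
  unfold gaussD3
  refine Measurable.mul ?_ measurable_heatKernel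
  fun_prop

lemma gaussD3_neg (j k l : Fin 3) (t : ℝ) (x : E3) :
    gaussD3 j k l t (-x) = -gaussD3 j k l t x := by
  unfold gaussD3
  rw [heatKernel_neg]
  simp only [PiLp.neg_apply]
  ring

lemma gaussD3_swap (j k l : Fin 3) (t : ℝ) (x : E3) : gaussD3 j k l t x = gaussD3 k j l t x := by
  have : kron j k = kron k j := by simp [kron, eq_comm]
  unfold gaussD3
  rw [this]
  ring

lemma pd3_gauss (j k l : Fin 3) {t : ℝ} (ht : 0 < t) (x : E3) :
    pd3 j k l (gauss t) x = gaussD3 j k l t x := by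
  unfold pd3
  rw [coe_pd, coe_pd, coe_pd, coe_gauss ht]
  have h1 : partialDeriv l (heatKernel t) = fun x => (-(x l / (2 * t))) * heatKernel t x := by
    funext x; exact partialDeriv_heatKernel l t x
  have h2 : partialDeriv k (partialDeriv l (heatKernel t)) =
      fun x => (x k * x l / (4 * t ^ 2) - kron k l / (2 * t)) * heatKernel t x := by
    rw [h1]
    funext x
    have hd : HasFDerivAt (fun x : E3 => -(x l / (2 * t))) _ x :=
      ((hasFDerivAt_coord l x).mul_const ((2 * t)⁻¹)).neg
    rw [partialDeriv_mul_heatKernel k t hd.differentiableAt (p' := -((2 * t)⁻¹ * kron k l))]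
    · field_simp
      ring
    · unfold partialDeriv
      rw [hd.fderiv]
      simp only [neg_apply, smul_apply, smul_eq_mul]
      rw [proj_basisVec]
  rw [h2]
  have hd : HasFDerivAt (fun x : E3 => x k * x l / (4 * t ^ 2) - kron k l / (2 * t)) _ x :=
    (((hasFDerivAt_coord k x).mul (hasFDerivAt_coord l x)).mul_const ((4 * t ^ 2)⁻¹)).sub_const
      (kron k l / (2 * t))
  rw [partialDeriv_mul_heatKernel j t hd.differentiableAt
    (p' := (4 * t ^ 2)⁻¹ * (x k * kron j l + x l * kron j k))]
  · unfold gaussD3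
    field_simp
    ring
  · unfold partialDeriv
    rw [hd.fderiv]
    simp only [add_apply, smul_apply, smul_eq_mul]
    rw [proj_basisVec, proj_basisVec]

lemma abs_coord_le (x : E3) (j : Fin 3) : |x j| ≤ ‖x‖ := by
  simpa using PiLp.norm_apply_le x j

/-- Writing the time as s² removes fractional powers from later estimates; the constant comes from π
≥ 1 and (4s²)^{3/2} = 8s³. -/
lemma heatKernel_sq_le {s : ℝ} (hs : 0 < s) (x : E3) :
    heatKernel (s ^ 2) x ≤ (8 * s ^ 3)⁻¹ * Real.exp (-(‖x‖ ^ 2 / (4 * s ^ 2))) := by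
  unfold heatKernel
  rw [neg_div]
  gcongr
  rw [Real.rpow_neg (by positivity)]
  gcongr
  have h1 : (4 * s ^ 2) ^ (3 / 2 : ℝ) = 8 * s ^ 3 := by
    rw [show 4 * s ^ 2 = (2 * s) ^ (2 : ℝ) by rw [Real.rpow_two]; ring,
      ← Real.rpow_mul (by positivity)]
    norm_num
    ring
  rw [← h1]
  gcongr
  nlinarith [Real.pi_gt_three, sq_nonneg s]

lemma heatKernel_le {t : ℝ} (ht : 0 < t) (x : E3) :
    heatKernel t x ≤ (8 * (√t) ^ 3)⁻¹ * Real.exp (-(‖x‖ ^ 2 / (4 * t))) := by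
  simpa [Real.sq_sqrt ht.le] using heatKernel_sq_le (Real.sqrt_pos.2 ht) x

lemma one_add_add_sq_le_exp {y : ℝ} (hy : 0 ≤ y) : 1 + y + y ^ 2 / 2 ≤ Real.exp y :=
  Real.quadratic_le_exp_of_nonneg hy

lemma abs_partialDeriv_heatKernel_le (j : Fin 3) {t : ℝ} (ht : 0 < t) (x : E3) :
    |partialDeriv j (heatKernel t) x| ≤ (t ^ 2)⁻¹ * Real.exp (-(‖x‖ ^ 2 / (8 * t))) := by
  obtain ⟨s, hs, rfl⟩ : ∃ s : ℝ, 0 < s ∧ t = s ^ 2 :=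
    ⟨√t, Real.sqrt_pos.2 ht, (Real.sq_sqrt ht.le).symm⟩
  set r := ‖x‖ with hr
  have hr0 : 0 ≤ r := norm_nonneg x
  rw [partialDeriv_heatKernel, abs_mul, abs_of_pos (heatKernel_pos ht x), abs_neg, abs_div,
    abs_of_pos (by positivity : 0 < 2 * s ^ 2)]
  have h1 := heatKernel_sq_le hs x
  have h2 := abs_coord_le x j
  have hexp : Real.exp (-(r ^ 2 / (4 * s ^ 2))) =
      Real.exp (-(r ^ 2 / (8 * s ^ 2))) * Real.exp (-(r ^ 2 / (8 * s ^ 2))) := by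
    rw [← Real.exp_add]; congr 1; field_simp; ring
  -- One half of the Gaussian exponent absorbs the factor r/s, and the other half is kept; 16
  -- cancels the prefactor.
  have hq : (r / s) * Real.exp (-(r ^ 2 / (8 * s ^ 2))) ≤ 16 := by
    rw [Real.exp_neg, ← div_eq_mul_inv, div_le_iff₀ (Real.exp_pos _)]
    have h := one_add_add_sq_le_exp (y := r ^ 2 / (8 * s ^ 2)) (by positivity)
    have e : r ^ 2 / (8 * s ^ 2) = (r / s) ^ 2 / 8 := by field_simp
    rw [e] at h ⊢
    nlinarith [sq_nonneg (r / s - 1), sq_nonneg ((r / s) ^ 2 / 8)]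
  calc |x j| / (2 * s ^ 2) * heatKernel (s ^ 2) x
      ≤ r / (2 * s ^ 2) * ((8 * s ^ 3)⁻¹ * Real.exp (-(r ^ 2 / (4 * s ^ 2)))) := by
        gcongr
        exact (heatKernel_pos ht x).le
    _ = (16 * s ^ 4)⁻¹ * ((r / s) * Real.exp (-(r ^ 2 / (8 * s ^ 2)))) *
          Real.exp (-(r ^ 2 / (8 * s ^ 2))) := by rw [hexp]; field_simp; ring
    _ ≤ (16 * s ^ 4)⁻¹ * 16 * Real.exp (-(r ^ 2 / (8 * s ^ 2))) := by gcongr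
    _ = ((s ^ 2) ^ 2)⁻¹ * Real.exp (-(r ^ 2 / (8 * s ^ 2))) := by field_simp

lemma abs_gaussD3_le (j k l : Fin 3) {t : ℝ} (ht : 0 < t) (x : E3) :
    |gaussD3 j k l t x| ≤ 11 * ((t ^ 3)⁻¹ * Real.exp (-(‖x‖ ^ 2 / (8 * t)))) := by
  obtain ⟨s, hs, rfl⟩ : ∃ s : ℝ, 0 < s ∧ t = s ^ 2 :=
    ⟨√t, Real.sqrt_pos.2 ht, (Real.sq_sqrt ht.le).symm⟩
  set r := ‖x‖ with hr
  have hr0 : 0 ≤ r := norm_nonneg x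
  have h1 := heatKernel_sq_le hs x
  have hexp : Real.exp (-(r ^ 2 / (4 * s ^ 2))) =
      Real.exp (-(r ^ 2 / (8 * s ^ 2))) * Real.exp (-(r ^ 2 / (8 * s ^ 2))) := by
    rw [← Real.exp_add]; congr 1; field_simp; ring
  -- Again half of the exponent absorbs the cubic polynomial in r/s; 88 = 8 · 11 leaves the constant
  -- 11.
  have hq : ((r / s) ^ 3 / 8 + 3 * (r / s) / 4) * Real.exp (-(r ^ 2 / (8 * s ^ 2))) ≤ 88 := by
    rw [Real.exp_neg, ← div_eq_mul_inv, div_le_iff₀ (Real.exp_pos _)]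
    have h := one_add_add_sq_le_exp (y := r ^ 2 / (8 * s ^ 2)) (by positivity)
    have e : r ^ 2 / (8 * s ^ 2) = (r / s) ^ 2 / 8 := by field_simp
    rw [e] at h ⊢
    have hq0 : 0 ≤ r / s := by positivity
    nlinarith [sq_nonneg (r / s - 1), sq_nonneg ((r / s) ^ 2 / 8),
      mul_nonneg hq0 (sq_nonneg (r / s - 1)), sq_nonneg ((r / s) ^ 2 - r / s)]
  have hc : ∀ i, |x i| ≤ r := abs_coord_le x
  have hkr : ∀ a b i, |kron a b * x i| ≤ r := by
    intro a b i
    rw [abs_mul]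
    calc |kron a b| * |x i| ≤ 1 * r := mul_le_mul (abs_kron_le a b) (hc i) (abs_nonneg _) zero_le_one
      _ = r := one_mul r
  have hcoef : |(kron j k * x l + kron j l * x k + kron k l * x j) / (4 * (s ^ 2) ^ 2) -
      x j * x k * x l / (8 * (s ^ 2) ^ 3)| ≤ 3 * r / (4 * (s ^ 2) ^ 2) + r ^ 3 / (8 * (s ^ 2) ^ 3) := by
    refine (abs_sub _ _).trans ?_
    rw [abs_div, abs_div, abs_of_pos (by positivity : 0 < 4 * (s ^ 2) ^ 2),
      abs_of_pos (by positivity : 0 < 8 * (s ^ 2) ^ 3)]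
    gcongr
    · refine (abs_add_three _ _ _).trans ?_
      linarith [hkr j k l, hkr j l k, hkr k l j]
    · rw [abs_mul, abs_mul, pow_three, ← mul_assoc]
      gcongr <;> exact hc _
  unfold gaussD3
  rw [abs_mul, abs_of_pos (heatKernel_pos ht x)]
  calc _ ≤ (3 * r / (4 * (s ^ 2) ^ 2) + r ^ 3 / (8 * (s ^ 2) ^ 3)) *
        ((8 * s ^ 3)⁻¹ * Real.exp (-(r ^ 2 / (4 * s ^ 2)))) := by
        gcongr
        exact (heatKernel_pos ht x).le
    _ = (8 * s ^ 6)⁻¹ * (((r / s) ^ 3 / 8 + 3 * (r / s) / 4) *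
          Real.exp (-(r ^ 2 / (8 * s ^ 2)))) * Real.exp (-(r ^ 2 / (8 * s ^ 2))) := by
        rw [hexp]; field_simp; ring
    _ ≤ (8 * s ^ 6)⁻¹ * 88 * Real.exp (-(r ^ 2 / (8 * s ^ 2))) := by gcongr
    _ = 11 * (((s ^ 2) ^ 3)⁻¹ * Real.exp (-(r ^ 2 / (8 * s ^ 2)))) := by field_simp; norm_num

/-! ### Integrals in the time variable -/

/-- With τ = σ + a, an explicit primitive is e^{-A/τ}(1/(Aτ) + 1/A²); it is positive and tends to
1/A² at infinity. -/
lemma integral_inv_cube_exp {A s a : ℝ} (hA : 0 < A) (hsa : 0 < s + a) :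
    IntegrableOn (fun σ => ((σ + a) ^ 3)⁻¹ * Real.exp (-(A / (σ + a)))) (Set.Ioi s) ∧
    ∫ σ in Set.Ioi s, ((σ + a) ^ 3)⁻¹ * Real.exp (-(A / (σ + a))) ≤ (A ^ 2)⁻¹ := by
  have hd : ∀ σ ∈ Set.Ici s, HasDerivAt
      (fun σ => Real.exp (-(A / (σ + a))) * ((A * (σ + a))⁻¹ + (A ^ 2)⁻¹))
      (((σ + a) ^ 3)⁻¹ * Real.exp (-(A / (σ + a)))) σ := by
    intro σ hσ
    have hσ' : 0 < σ + a := by have : s ≤ σ := hσ; linarith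
    have h1 : HasDerivAt (fun σ : ℝ => σ + a) 1 σ := (hasDerivAt_id σ).add_const a
    have h2 : HasDerivAt (fun σ : ℝ => (σ + a)⁻¹) (-1 / (σ + a) ^ 2) σ := h1.inv hσ'.ne'
    have h3 := (((h2.const_mul A).neg).exp).mul ((h2.const_mul A⁻¹).add_const ((A ^ 2)⁻¹))
    have h4 : HasDerivAt (fun σ => Real.exp (-(A / (σ + a))) * ((A * (σ + a))⁻¹ + (A ^ 2)⁻¹)) _ σ :=
      h3.congr_of_eventuallyEq (Eventually.of_forall fun σ => by
        simp [div_eq_mul_inv, mul_comm])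
    refine h4.congr_deriv ?_
    simp only [Pi.neg_apply, ← div_eq_mul_inv]
    field_simp
    ring
  have hpos : ∀ σ ∈ Set.Ioi s, 0 ≤ ((σ + a) ^ 3)⁻¹ * Real.exp (-(A / (σ + a))) := by
    intro σ hσ
    have : 0 < σ + a := by have : s < σ := hσ; linarith
    positivity
  have hlim : Tendsto (fun σ : ℝ => Real.exp (-(A / (σ + a))) * ((A * (σ + a))⁻¹ + (A ^ 2)⁻¹))
      atTop (𝓝 (1 * (0 + (A ^ 2)⁻¹))) := by
    have h0 : Tendsto (fun σ : ℝ => σ + a) atTop atTop := tendsto_atTop_add_const_right _ _ tendsto_id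
    refine Tendsto.mul ?_ (Tendsto.add_const _ ?_)
    · have := (tendsto_const_nhds (x := A)).div_atTop h0
      have h2 := (Real.continuous_exp.tendsto _).comp this.neg
      simpa [Function.comp_def] using h2
    · exact (h0.const_mul_atTop hA).inv_tendsto_atTop
  refine ⟨integrableOn_Ioi_deriv_of_nonneg' hd hpos hlim, ?_⟩
  rw [integral_Ioi_of_hasDerivAt_of_nonneg' hd hpos hlim]
  have : 0 ≤ Real.exp (-(A / (s + a))) * ((A * (s + a))⁻¹ + (A ^ 2)⁻¹) := by positivity
  linarith

lemma integral_inv_cube_exp_tail {s a r : ℝ} (hsa : 0 < s + a) :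
    IntegrableOn (fun σ => ((σ + a) ^ 3)⁻¹ * Real.exp (-(r ^ 2 / (8 * (σ + a))))) (Set.Ioi s) ∧
    ∫ σ in Set.Ioi s, ((σ + a) ^ 3)⁻¹ * Real.exp (-(r ^ 2 / (8 * (σ + a)))) ≤
      192 * ((s + a + r ^ 2) ^ 2)⁻¹ := by
  -- Adding (s + a)/8 to r²/8 changes the exponent by at most 1 on σ > s, a factor e < 3, and makes
  -- the bound finite at r = 0. Hence 192 = 3 · 8².
  set A := (s + a + r ^ 2) / 8 with hA
  have hA0 : 0 < A := by positivity
  obtain ⟨h1, h2⟩ := integral_inv_cube_exp hA0 hsa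
  have hle : ∀ σ ∈ Set.Ioi s, ((σ + a) ^ 3)⁻¹ * Real.exp (-(r ^ 2 / (8 * (σ + a)))) ≤
      3 * (((σ + a) ^ 3)⁻¹ * Real.exp (-(A / (σ + a)))) := by
    intro σ hσ
    have hσ1 : s < σ := hσ
    have hσ' : 0 < σ + a := by linarith
    have : Real.exp (-(r ^ 2 / (8 * (σ + a)))) ≤ 3 * Real.exp (-(A / (σ + a))) := by
      calc Real.exp (-(r ^ 2 / (8 * (σ + a)))) ≤ Real.exp (1 + -(A / (σ + a))) := by
            apply Real.exp_le_exp.2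
            have : A / (σ + a) = (s + a) / (8 * (σ + a)) + r ^ 2 / (8 * (σ + a)) := by
              rw [hA]; field_simp
            have h3 : (s + a) / (8 * (σ + a)) ≤ 1 := by
              rw [div_le_one (by positivity)]; linarith
            linarith
        _ = Real.exp 1 * Real.exp (-(A / (σ + a))) := Real.exp_add _ _
        _ ≤ _ := by gcongr; exact Real.exp_one_lt_three.le
    calc _ ≤ ((σ + a) ^ 3)⁻¹ * (3 * Real.exp (-(A / (σ + a)))) := by gcongr
      _ = _ := by ring
  have hint : IntegrableOn (fun σ => ((σ + a) ^ 3)⁻¹ * Real.exp (-(r ^ 2 / (8 * (σ + a)))))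
      (Set.Ioi s) := by
    refine (h1.const_mul 3).mono' ?_ ?_
    · exact (by fun_prop : Measurable fun σ =>
        ((σ + a) ^ 3)⁻¹ * Real.exp (-(r ^ 2 / (8 * (σ + a))))).aestronglyMeasurable
    · refine (ae_restrict_mem measurableSet_Ioi).mono fun σ hσ => ?_
      rw [Real.norm_of_nonneg]
      · exact hle σ hσ
      · have hσ1 : s < σ := hσ
        have hσ' : 0 < σ + a := by linarith
        positivity
  refine ⟨hint, (setIntegral_mono_on hint (h1.const_mul 3) measurableSet_Ioi hle).trans ?_⟩
  rw [integral_const_mul]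
  have : (A ^ 2)⁻¹ = 64 * ((s + a + r ^ 2) ^ 2)⁻¹ := by rw [hA, div_pow]; field_simp; norm_num
  linarith

lemma integrableOn_gaussD3 (j k l : Fin 3) {s a : ℝ} (hsa : 0 < s + a) (x : E3) :
    IntegrableOn (fun σ => gaussD3 j k l (σ + a) x) (Set.Ioi s) ∧
    ∫ σ in Set.Ioi s, |gaussD3 j k l (σ + a) x| ≤ 2112 * ((s + a + ‖x‖ ^ 2) ^ 2)⁻¹ := by
  obtain ⟨h1, h2⟩ := integral_inv_cube_exp_tail (r := ‖x‖) hsa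
  have hle : ∀ σ ∈ Set.Ioi s, |gaussD3 j k l (σ + a) x| ≤
      11 * (((σ + a) ^ 3)⁻¹ * Real.exp (-(‖x‖ ^ 2 / (8 * (σ + a))))) := by
    intro σ hσ
    have hσ1 : s < σ := hσ
    exact abs_gaussD3_le j k l (by linarith) x
  have hint : IntegrableOn (fun σ => gaussD3 j k l (σ + a) x) (Set.Ioi s) := by
    refine (h1.const_mul 11).mono' ?_ ((ae_restrict_mem measurableSet_Ioi).mono hle)
    exact ((measurable_gaussD3 j k l).comp
      (by fun_prop : Measurable fun σ : ℝ => (σ + a, x))).aestronglyMeasurable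
  refine ⟨hint, (setIntegral_mono_on hint.abs (h1.const_mul 11) measurableSet_Ioi hle).trans ?_⟩
  rw [integral_const_mul]
  linarith

/-! ### The Newtonian potential as a time integral -/

/-- The substitution y = σ^{-1/2} turns the time integral into a Gaussian integral over the half
line; this is the kernel form of (-Δ)⁻¹ = ∫₀^∞ e^{σΔ} dσ. -/
lemma integral_heatKernel_time {z : E3} (hz : z ≠ 0) :
    ∫ σ in Set.Ioi (0 : ℝ), heatKernel σ z = 1 / (4 * Real.pi * ‖z‖) := by
  have hr : 0 < ‖z‖ := norm_pos_iff.2 hz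
  have h := integral_comp_rpow_Ioi (fun y : ℝ => Real.exp (-(‖z‖ ^ 2 / 4) * y ^ 2))
    (p := -(1 / 2)) (by norm_num)
  rw [integral_gaussian_Ioi] at h
  have h1 : ∫ σ in Set.Ioi (0 : ℝ), heatKernel σ z = ∫ σ in Set.Ioi (0 : ℝ),
      (2 * (4 * Real.pi) ^ (-(3 / 2) : ℝ)) * ((|(-(1 / 2) : ℝ)| * σ ^ ((-(1 / 2) : ℝ) - 1)) •
        Real.exp (-(‖z‖ ^ 2 / 4) * (σ ^ (-(1 / 2) : ℝ)) ^ 2)) := by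
    refine setIntegral_congr_fun measurableSet_Ioi fun σ hσ => ?_
    have hσ : 0 < σ := hσ
    have e1 : (σ ^ (-(1 / 2) : ℝ)) ^ 2 = σ⁻¹ := by
      rw [← Real.rpow_natCast, ← Real.rpow_mul hσ.le]
      norm_num
      exact Real.rpow_neg_one σ
    have e2 : (-(1 / 2) : ℝ) - 1 = -(3 / 2) := by norm_num
    have e3 : |(-(1 / 2) : ℝ)| = 1 / 2 := by norm_num [abs_of_pos]
    simp only [e1, e2, e3, heatKernel, smul_eq_mul]
    rw [Real.mul_rpow (by positivity) hσ.le]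
    have e4 : -‖z‖ ^ 2 / (4 * σ) = -(‖z‖ ^ 2 / 4) * σ⁻¹ := by field_simp
    rw [e4]
    ring
  rw [h1, integral_const_mul, h]
  have e5 : (4 * Real.pi) ^ (-(3 / 2) : ℝ) = (8 * (√Real.pi) ^ 3)⁻¹ := by
    rw [Real.rpow_neg (by positivity)]
    congr 1
    rw [show 4 * Real.pi = (2 * √Real.pi) ^ (2 : ℝ) by
      rw [Real.rpow_two, mul_pow, Real.sq_sqrt Real.pi_pos.le]; norm_num,
      ← Real.rpow_mul (by positivity)]
    norm_num
    ring
  have e6 : √(Real.pi / (‖z‖ ^ 2 / 4)) = 2 * √Real.pi / ‖z‖ := by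
    rw [show Real.pi / (‖z‖ ^ 2 / 4) = Real.pi * (2 / ‖z‖) ^ 2 by field_simp; norm_num,
      Real.sqrt_mul Real.pi_pos.le, Real.sqrt_sq (by positivity)]
    ring
  rw [e5, e6]
  have hpi : 0 < √Real.pi := Real.sqrt_pos.2 Real.pi_pos
  have : Real.pi = √Real.pi ^ 2 := (Real.sq_sqrt Real.pi_pos.le).symm
  rw [show 4 * Real.pi * ‖z‖ = 4 * √Real.pi ^ 2 * ‖z‖ by rw [← this]]
  field_simp
  norm_num

lemma integrable_heatKernel_sub_mul {t : ℝ} (ht : 0 < t) (φ : 𝓢(E3, ℝ)) (x : E3) :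
    Integrable (fun y => heatKernel t (x - y) * φ y) := by
  obtain ⟨C, hC⟩ := φ.decay 0 0
  exact ((integrable_heatKernel ht).comp_sub_left x).mul_bdd (c := C) φ.continuous.aestronglyMeasurable
    (Eventually.of_forall fun y => by simpa using hC.2 y)

lemma heatKernel_le_const {t : ℝ} (ht : 0 < t) (x : E3) : heatKernel t x ≤ (8 * (√t) ^ 3)⁻¹ := by
  refine (heatKernel_le ht x).trans (mul_le_of_le_one_right (by positivity) ?_)
  rw [Real.exp_le_one_iff]
  have : 0 ≤ ‖x‖ ^ 2 / (4 * t) := by positivity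
  linarith

/-- The sup bound serves small times, the L¹ bound of order t^{-3/2} serves large times; together
they make the heat flow of φ integrable in time. -/
lemma integral_heatKernel_abs_le (φ : 𝓢(E3, ℝ)) {C : ℝ} (hC : ∀ y, |φ y| ≤ C) {t : ℝ} (ht : 0 < t)
    (x : E3) :
    ∫ y, |heatKernel t (x - y) * φ y| ≤ C ∧
    ∫ y, |heatKernel t (x - y) * φ y| ≤ (8 * (√t) ^ 3)⁻¹ * ∫ y, |φ y| := by
  have hi := (integrable_heatKernel_sub_mul ht φ x).abs
  constructor
  · calc ∫ y, |heatKernel t (x - y) * φ y| ≤ ∫ y, heatKernel t (x - y) * C := by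
          refine integral_mono hi (((integrable_heatKernel ht).comp_sub_left x).mul_const C) ?_
          intro y
          simp only [abs_mul, abs_of_pos (heatKernel_pos ht _)]
          exact mul_le_mul_of_nonneg_left (hC y) (heatKernel_pos ht _).le
      _ = C := by
          rw [integral_mul_const, integral_sub_left_eq_self (heatKernel t) volume x,
            integral_heatKernel ht, one_mul]
  · rw [← integral_const_mul]
    refine integral_mono hi (φ.integrable.abs.const_mul _) ?_
    intro y
    simp only [abs_mul, abs_of_pos (heatKernel_pos ht _)]
    exact mul_le_mul_of_nonneg_right (heatKernel_le_const ht _) (abs_nonneg _)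

lemma integrableOn_sqrt_cube_inv {s : ℝ} (hs : 0 < s) :
    IntegrableOn (fun t : ℝ => (8 * (√t) ^ 3)⁻¹) (Set.Ioi s) := by
  have h := (integrableOn_Ioi_rpow_of_lt (a := (-(3 / 2) : ℝ)) (by norm_num) hs).const_mul (8⁻¹)
  refine IntegrableOn.congr_fun h ?_ measurableSet_Ioi
  intro t ht
  have ht : 0 < t := hs.trans ht
  simp only
  rw [mul_inv, Real.sqrt_eq_rpow, ← Real.rpow_natCast, ← Real.rpow_mul ht.le,
    Real.rpow_neg ht.le]
  norm_num

lemma integrable_heat_time (φ : 𝓢(E3, ℝ)) (x : E3) :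
    Integrable (fun p : ℝ × E3 => heatKernel p.1 (x - p.2) * φ p.2)
      ((volume.restrict (Set.Ioi 0)).prod volume) := by
  obtain ⟨C, hC⟩ := φ.decay 0 0
  have hC : ∀ y, |φ y| ≤ C := fun y => by simpa using hC.2 y
  have hmeas : AEStronglyMeasurable (fun p : ℝ × E3 => heatKernel p.1 (x - p.2) * φ p.2)
      ((volume.restrict (Set.Ioi 0)).prod volume) := by
    apply Measurable.aestronglyMeasurable
    exact (measurable_heatKernel.comp (by fun_prop : Measurable fun p : ℝ × E3 =>
      (p.1, x - p.2))).mul (φ.continuous.measurable.comp measurable_snd)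
  rw [integrable_prod_iff hmeas]
  refine ⟨(ae_restrict_mem measurableSet_Ioi).mono fun t ht =>
    integrable_heatKernel_sub_mul ht φ x, ?_⟩
  have hm2 : AEStronglyMeasurable (fun t => ∫ y, ‖heatKernel t (x - y) * φ y‖)
      (volume.restrict (Set.Ioi 0)) := hmeas.norm.integral_prod_right'
  rw [← IntegrableOn, ← Set.Ioc_union_Ioi_eq_Ioi (zero_le_one' ℝ)]
  refine IntegrableOn.union ?_ ?_
  · refine Integrable.of_bound
      (AEStronglyMeasurable.mono_measure hm2 (Measure.restrict_mono Set.Ioc_subset_Ioi_self le_rfl)) C ?_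
    refine (ae_restrict_mem measurableSet_Ioc).mono fun t ht => ?_
    rw [Real.norm_of_nonneg (integral_nonneg fun _ => norm_nonneg _)]
    exact (integral_heatKernel_abs_le φ hC ht.1 x).1
  · refine ((integrableOn_sqrt_cube_inv one_pos).mul_const (∫ y, |φ y|)).mono'
      (AEStronglyMeasurable.mono_measure hm2 (Measure.restrict_mono (Set.Ioi_subset_Ioi zero_le_one) le_rfl)) ?_
    refine (ae_restrict_mem measurableSet_Ioi).mono fun t ht => ?_
    rw [Real.norm_of_nonneg (integral_nonneg fun _ => norm_nonneg _)]
    exact (integral_heatKernel_abs_le φ hC (zero_lt_one.trans ht) x).2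

lemma integrableOn_cv_gauss (φ : 𝓢(E3, ℝ)) (x : E3) :
    IntegrableOn (fun t => cv (gauss t) φ x) (Set.Ioi 0) := by
  refine ((integrable_heat_time φ x).integral_prod_left).congr ?_
  refine (ae_restrict_mem measurableSet_Ioi).mono fun t ht => ?_
  simp only [cv, coe_gauss ht]

lemma invNegLaplacian_eq (φ : 𝓢(E3, ℝ)) (x : E3) :
    invNegLaplacian φ x = ∫ t in Set.Ioi (0 : ℝ), cv (gauss t) φ x := by
  have h := integral_integral_swap (f := fun (t : ℝ) (y : E3) => heatKernel t (x - y) * φ y)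
    (integrable_heat_time φ x)
  have h1 : ∫ t in Set.Ioi (0 : ℝ), cv (gauss t) φ x =
      ∫ t in Set.Ioi (0 : ℝ), ∫ y, heatKernel t (x - y) * φ y := by
    refine setIntegral_congr_fun measurableSet_Ioi fun t ht => ?_
    simp only [cv, coe_gauss ht]
  rw [h1, h]
  unfold invNegLaplacian
  refine integral_congr_ae ?_
  have : ∀ᵐ y : E3, y ≠ x := by simp [ae_iff]
  filter_upwards [this] with y hy
  rw [integral_mul_const, integral_heatKernel_time (sub_ne_zero.2 hy.symm)]

lemma lerayDeriv_eq (j k l : Fin 3) (φ : 𝓢(E3, ℝ)) (x : E3) :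
    lerayDeriv j k l φ x = kron k l * pd j φ x +
      ∫ t in Set.Ioi (0 : ℝ), cv (gauss t) (pd3 j k l φ) x := by
  unfold lerayDeriv
  rw [← invNegLaplacian_eq]
  unfold pd3
  rw [coe_pd, coe_pd, coe_pd, coe_pd]
  unfold kron
  split_ifs <;> simp

/-! ### The Oseen kernel -/

/-- By the semigroup law, e^{σΔ} acting on a derivative of the Gauss kernel at time t only shifts
the time to σ + t. -/
lemma oseenKernel_eq (j k l : Fin 3) {t : ℝ} (ht : 0 < t) (x : E3) :
    oseenKernel j k l t x = kron k l * partialDeriv j (heatKernel t) x +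
      ∫ σ in Set.Ioi (0 : ℝ), gaussD3 j k l (σ + t) x := by
  unfold oseenKernel
  rw [← coe_gauss ht, lerayDeriv_eq, ← coe_pd]
  congr 1
  refine setIntegral_congr_fun measurableSet_Ioi fun σ hσ => ?_
  have hσ : 0 < σ := hσ
  rw [cv_pd3_gauss j k l hσ ht, pd3_gauss j k l (by positivity)]

lemma partialDeriv_heatKernel_neg (j : Fin 3) (t : ℝ) (x : E3) :
    partialDeriv j (heatKernel t) (-x) = -partialDeriv j (heatKernel t) x := by
  rw [partialDeriv_heatKernel, partialDeriv_heatKernel, heatKernel_neg]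
  simp only [PiLp.neg_apply]
  ring

lemma oseenKernel_neg (j k l : Fin 3) {t : ℝ} (ht : 0 < t) (x : E3) :
    oseenKernel j k l t (-x) = -oseenKernel j k l t x := by
  rw [oseenKernel_eq j k l ht, oseenKernel_eq j k l ht, partialDeriv_heatKernel_neg]
  simp_rw [gaussD3_neg]
  rw [integral_neg]
  ring

lemma exp_neg_div_le {t r : ℝ} (ht : 0 < t) :
    (t ^ 2)⁻¹ * Real.exp (-(r ^ 2 / (8 * t))) ≤ 128 * ((t + r ^ 2) ^ 2)⁻¹ := by
  have h := one_add_add_sq_le_exp (y := r ^ 2 / (8 * t)) (by positivity)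
  rw [Real.exp_neg, ← mul_inv, ← div_eq_mul_inv, inv_eq_one_div, div_le_div_iff₀ (by positivity)
    (by positivity)]
  have : (t + r ^ 2) ^ 2 ≤ 128 * (t ^ 2 * (1 + r ^ 2 / (8 * t) + (r ^ 2 / (8 * t)) ^ 2 / 2)) := by
    have e : 128 * (t ^ 2 * (1 + r ^ 2 / (8 * t) + (r ^ 2 / (8 * t)) ^ 2 / 2)) =
      128 * t ^ 2 + 16 * (t * r ^ 2) + r ^ 4 := by field_simp; ring
    rw [e]
    nlinarith [mul_nonneg ht.le (sq_nonneg r), sq_nonneg t]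
  calc 1 * (t + r ^ 2) ^ 2 ≤ 128 * (t ^ 2 * (1 + r ^ 2 / (8 * t) + (r ^ 2 / (8 * t)) ^ 2 / 2)) := by
        linarith
    _ ≤ _ := by gcongr

/-- The two parts of `oseenKernel_eq` obey the same parabolic bound; 2240 = 128 + 2112. -/
lemma abs_oseenKernel_le (j k l : Fin 3) {t : ℝ} (ht : 0 < t) (x : E3) :
    |oseenKernel j k l t x| ≤ 2240 * ((t + ‖x‖ ^ 2) ^ 2)⁻¹ := by
  rw [oseenKernel_eq j k l ht]
  refine (abs_add_le _ _).trans ?_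
  have h1 := (integrableOn_gaussD3 j k l (s := 0) (by linarith) x).2
  have h2 : |∫ σ in Set.Ioi (0 : ℝ), gaussD3 j k l (σ + t) x| ≤
      ∫ σ in Set.Ioi (0 : ℝ), |gaussD3 j k l (σ + t) x| := abs_integral_le_integral_abs
  have h3 : |kron k l * partialDeriv j (heatKernel t) x| ≤ 128 * ((t + ‖x‖ ^ 2) ^ 2)⁻¹ := by
    rw [abs_mul]
    calc _ ≤ 1 * ((t ^ 2)⁻¹ * Real.exp (-(‖x‖ ^ 2 / (8 * t)))) :=
          mul_le_mul (abs_kron_le k l) (abs_partialDeriv_heatKernel_le j ht x) (abs_nonneg _)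
            zero_le_one
      _ ≤ _ := by rw [one_mul]; exact exp_neg_div_le ht
  rw [zero_add] at h1
  linarith

/-- Provides a jointly measurable version for Fubini arguments; agreement is needed only for
positive times. -/
lemma measurable_oseenKernel (j k l : Fin 3) :
    ∃ E : ℝ × E3 → ℝ, Measurable E ∧ ∀ t, 0 < t → ∀ x, oseenKernel j k l t x = E (t, x) := by
  refine ⟨fun p => kron k l * (-(p.2 j / (2 * p.1)) * heatKernel p.1 p.2) +
      ∫ σ in Set.Ioi (0 : ℝ), gaussD3 j k l (σ + p.1) p.2, ?_, fun t ht x => ?_⟩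
  · refine Measurable.add ?_ ?_
    · exact measurable_const.mul (Measurable.mul (by fun_prop) measurable_heatKernel)
    · have : StronglyMeasurable (fun q : (ℝ × E3) × ℝ => gaussD3 j k l (q.2 + q.1.1) q.1.2) :=
        ((measurable_gaussD3 j k l).comp (by fun_prop : Measurable fun q : (ℝ × E3) × ℝ =>
          (q.2 + q.1.1, q.1.2))).stronglyMeasurable
      exact (this.integral_prod_right (ν := volume.restrict (Set.Ioi 0))).measurable
  · rw [oseenKernel_eq j k l ht, partialDeriv_heatKernel]

/-! ### Convolution with the Oseen kernel -/

lemma abs_integral_le_of_abs_le {α : Type*} [MeasurableSpace α] {μ : Measure α} {f g : α → ℝ}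
    (hg : Integrable g μ) (h : ∀ x, |f x| ≤ g x) : |∫ x, f x ∂μ| ≤ ∫ x, g x ∂μ := by
  rw [← Real.norm_eq_abs]
  exact norm_integral_le_of_norm_le hg (Eventually.of_forall h)

lemma measurable_gaussD3_comp {α : Type*} [MeasurableSpace α] (j k l : Fin 3) {f : α → ℝ}
    {g : α → E3} (hf : Measurable f) (hg : Measurable g) :
    Measurable (fun a => gaussD3 j k l (f a) (g a)) :=
  (measurable_gaussD3 j k l).comp (hf.prodMk hg)

lemma inv_add_sq_le_wt {t : ℝ} (ht : 0 < t) (x : E3) :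
    ((t + ‖x‖ ^ 2) ^ 2)⁻¹ ≤ (1 + t⁻¹) ^ 2 * wt x := by
  unfold wt
  rw [← div_eq_mul_inv, inv_eq_one_div, div_le_div_iff₀ (by positivity) (by positivity),
    ← mul_pow, one_mul]
  gcongr
  have : (1 + t⁻¹) * (t + ‖x‖ ^ 2) = 1 + ‖x‖ ^ 2 + (t + t⁻¹ * ‖x‖ ^ 2) := by field_simp; ring
  rw [this]
  have : 0 ≤ t + t⁻¹ * ‖x‖ ^ 2 := by positivity
  linarith

lemma abs_oseenKernel_le_wt (j k l : Fin 3) {t : ℝ} (ht : 0 < t) (x : E3) :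
    |oseenKernel j k l t x| ≤ (2240 * (1 + t⁻¹) ^ 2) * wt x := by
  have h := inv_add_sq_le_wt ht x
  calc _ ≤ 2240 * ((t + ‖x‖ ^ 2) ^ 2)⁻¹ := abs_oseenKernel_le j k l ht x
    _ ≤ 2240 * ((1 + t⁻¹) ^ 2 * wt x) := by gcongr
    _ = _ := by ring

lemma integrableOn_inv_cube {a : ℝ} (ha : 0 < a) :
    IntegrableOn (fun σ : ℝ => 11 * ((σ + a) ^ 3)⁻¹) (Set.Ioi 0) := by
  have := (integral_inv_cube_exp_tail (s := 0) (a := a) (r := 0) (by linarith)).1.const_mul 11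
  simpa [IntegrableOn] using this

lemma abs_gaussD3_le_inv_cube (j k l : Fin 3) {t : ℝ} (ht : 0 < t) (x : E3) :
    |gaussD3 j k l t x| ≤ 11 * (t ^ 3)⁻¹ := by
  refine (abs_gaussD3_le j k l ht x).trans ?_
  gcongr
  refine mul_le_of_le_one_right (by positivity) ?_
  rw [Real.exp_le_one_iff]
  have : 0 ≤ ‖x‖ ^ 2 / (8 * t) := by positivity
  linarith

lemma continuous_oseenKernel (j k l : Fin 3) {t : ℝ} (ht : 0 < t) :
    Continuous (oseenKernel j k l t) := by
  have h : oseenKernel j k l t = fun x => kron k l * pd j (gauss t) x +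
      ∫ σ in Set.Ioi (0 : ℝ), gaussD3 j k l (σ + t) x := by
    funext x
    rw [oseenKernel_eq j k l ht, coe_pd, coe_gauss ht]
  rw [h]
  refine (continuous_const.mul (pd j (gauss t)).continuous).add ?_
  refine continuous_of_dominated (bound := fun σ => 11 * ((σ + t) ^ 3)⁻¹) ?_ ?_
    (integrableOn_inv_cube ht) ?_
  · exact fun x => (measurable_gaussD3_comp j k l (by fun_prop) measurable_const).aestronglyMeasurable
  · exact fun x => (ae_restrict_mem measurableSet_Ioi).mono fun σ hσ =>
      abs_gaussD3_le_inv_cube j k l (add_pos hσ ht) x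
  · refine (ae_restrict_mem measurableSet_Ioi).mono fun σ hσ => ?_
    have hσ' : 0 < σ + t := add_pos hσ ht
    have : (fun x => gaussD3 j k l (σ + t) x) = pd3 j k l (gauss (σ + t)) := by
      funext x; rw [pd3_gauss j k l hσ']
    rw [this]
    exact SchwartzMap.continuous _

/-- The kernel is odd. This is why constant products contribute nothing to the Duhamel integral. -/
lemma integral_oseenKernel (j k l : Fin 3) {t : ℝ} (ht : 0 < t) :
    ∫ x, oseenKernel j k l t x = 0 := by
  have h := integral_neg_eq_self (oseenKernel j k l t) volume
  simp_rw [oseenKernel_neg j k l ht] at h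
  rw [integral_neg] at h
  linarith

lemma integral_oseenKernel_sub (j k l : Fin 3) {t : ℝ} (ht : 0 < t) (x : E3) :
    ∫ y, oseenKernel j k l t (x - y) = 0 := by
  rw [integral_sub_left_eq_self (oseenKernel j k l t) volume x, integral_oseenKernel j k l ht]

/-- The convolution of a test function with the Oseen kernel. -/
def oseenCv (j k l : Fin 3) (a : ℝ) (φ : 𝓢(E3, ℝ)) (x : E3) : ℝ :=
  kron k l * cv φ (pd j (gauss a)) x +
    ∫ σ in Set.Ioi (0 : ℝ), cv φ (pd3 j k l (gauss (σ + a))) x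

lemma integral_mul_oseenKernel (j k l : Fin 3) {a : ℝ} (ha : 0 < a) (φ : 𝓢(E3, ℝ)) (x : E3) :
    ∫ y, φ (x - y) * oseenKernel j k l a y = oseenCv j k l a φ x := by
  have hφ : Integrable (fun y => φ (x - y)) := φ.integrable.comp_sub_left x
  have hprod : Integrable (fun p : ℝ × E3 => φ (x - p.2) * gaussD3 j k l (p.1 + a) p.2)
      ((volume.restrict (Set.Ioi 0)).prod volume) := by
    refine ((integrableOn_inv_cube ha).mul_prod hφ.abs).mono' ?_ ?_
    · refine Measurable.aestronglyMeasurable (Measurable.mul ?_ ?_)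
      · exact φ.continuous.measurable.comp (by fun_prop)
      · exact measurable_gaussD3_comp j k l (by fun_prop) (by fun_prop)
    · have h0 : ∀ᵐ p ∂((volume.restrict (Set.Ioi (0 : ℝ))).prod (volume : Measure E3)),
          p.1 ∈ Set.Ioi (0 : ℝ) :=
        Measure.quasiMeasurePreserving_fst.ae (ae_restrict_mem measurableSet_Ioi)
      filter_upwards [h0] with p hp
      rw [norm_mul, mul_comm]
      exact mul_le_mul_of_nonneg_right (abs_gaussD3_le_inv_cube j k l (add_pos hp ha) _)
        (norm_nonneg _)
  have hswap := integral_integral_swap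
    (f := fun (σ : ℝ) (y : E3) => φ (x - y) * gaussD3 j k l (σ + a) y) hprod
  have h1 : ∀ y, φ (x - y) * oseenKernel j k l a y =
      kron k l * (φ (x - y) * pd j (gauss a) y) +
        ∫ σ in Set.Ioi (0 : ℝ), φ (x - y) * gaussD3 j k l (σ + a) y := by
    intro y
    rw [oseenKernel_eq j k l ha, integral_const_mul, coe_pd, coe_gauss ha]
    ring
  simp_rw [h1]
  rw [integral_add, integral_const_mul, ← hswap]
  · unfold oseenCv
    congr 1
    refine setIntegral_congr_fun measurableSet_Ioi fun σ hσ => ?_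
    have hσ' : 0 < σ + a := add_pos hσ ha
    unfold cv
    simp_rw [pd3_gauss j k l hσ']
  · refine Integrable.const_mul ?_ _
    obtain ⟨C, hC⟩ := (pd j (gauss a)).decay 0 0
    exact hφ.mul_bdd (c := C) (SchwartzMap.continuous _).aestronglyMeasurable
      (Eventually.of_forall fun y => by simpa using hC.2 y)
  · exact hprod.integral_prod_right

lemma cv_pd_comm (j : Fin 3) (φ ψ : 𝓢(E3, ℝ)) (x : E3) : cv φ (pd j ψ) x = cv ψ (pd j φ) x := by
  have h1 := partialDeriv_cv j φ ψ
  have h2 := partialDeriv_cv j ψ φ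
  have h3 : cv φ ψ = cv ψ φ := funext fun y => cv_comm φ ψ y
  rw [cv_comm φ, cv_comm ψ, ← h1, ← h2, h3]

lemma cv_pd3_comm (j k l : Fin 3) (φ ψ : 𝓢(E3, ℝ)) (x : E3) :
    cv φ (pd3 j k l ψ) x = cv ψ (pd3 j k l φ) x := by
  have h3 : cv φ ψ = cv ψ φ := funext fun y => cv_comm φ ψ y
  rw [cv_comm φ, cv_comm ψ]
  unfold pd3
  rw [← partialDeriv_cv, ← partialDeriv_cv, ← partialDeriv_cv, ← partialDeriv_cv,
    ← partialDeriv_cv, ← partialDeriv_cv, h3]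

/-- The Gauss kernel regularizes the Oseen kernel of an earlier time. -/
lemma integral_heatKernel_mul_oseenKernel (j k l : Fin 3) {a b : ℝ} (ha : 0 < a) (hb : 0 < b)
    (x y : E3) :
    ∫ z, heatKernel b (x - z) * oseenKernel j k l a (z - y) = oseenKernel j k l (b + a) (x - y) := by
  have h0 : ∫ z, heatKernel b (x - z) * oseenKernel j k l a (z - y) =
      ∫ z, heatKernel b (x - y - z) * oseenKernel j k l a z := by
    rw [← integral_sub_right_eq_self (fun z => heatKernel b (x - y - z) * oseenKernel j k l a z) y]
    simp
  rw [h0, ← coe_gauss hb, integral_mul_oseenKernel j k l ha, oseenKernel_eq j k l (by positivity)]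
  unfold oseenCv
  rw [cv_comm, ← partialDeriv_cv, add_comm b a, cv_gauss ha hb, coe_gauss (by positivity)]
  congr 1
  refine setIntegral_congr_fun measurableSet_Ioi fun σ hσ => ?_
  have hσ : 0 < σ := hσ
  rw [cv_pd3_gauss j k l hb (by positivity), pd3_gauss j k l (by positivity)]
  congr 1
  ring

/-! ### Regularization of test functions -/

/-- Doubling the time uses only half of the exponent and frees a Gaussian factor that absorbs
polynomials in |z|; 3 bounds 2^{3/2}. -/
lemma heatKernel_le_heatKernel_double {a : ℝ} (ha : 0 < a) (z : E3) :
    heatKernel a z ≤ 3 * (heatKernel (2 * a) z * Real.exp (-(‖z‖ ^ 2 / (8 * a)))) := by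
  have h2 : (2 : ℝ) ^ (3 / 2 : ℝ) ≤ 3 := by
    have h : ((2 : ℝ) ^ (3 / 2 : ℝ)) ^ 2 = 8 := by
      rw [← Real.rpow_natCast, ← Real.rpow_mul (by norm_num)]; norm_num
    nlinarith [Real.rpow_nonneg (zero_le_two (α := ℝ)) (3 / 2)]
  have h : heatKernel a z = 2 ^ (3 / 2 : ℝ) *
      (heatKernel (2 * a) z * Real.exp (-(‖z‖ ^ 2 / (8 * a)))) := by
    unfold heatKernel
    rw [show 4 * Real.pi * (2 * a) = 2 * (4 * Real.pi * a) by ring,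
      Real.mul_rpow zero_le_two (by positivity), Real.rpow_neg zero_le_two (3 / 2),
      mul_assoc _ (Real.exp _) (Real.exp _), ← Real.exp_add]
    have : -‖z‖ ^ 2 / (4 * (2 * a)) + -(‖z‖ ^ 2 / (8 * a)) = -‖z‖ ^ 2 / (4 * a) := by
      field_simp; ring
    rw [this]
    field_simp
  rw [h]
  gcongr
  exact mul_nonneg (heatKernel_pos (by positivity) z).le (Real.exp_pos _).le

lemma norm_mul_heatKernel_le {a : ℝ} (ha : 0 < a) (z : E3) :
    ‖z‖ * heatKernel a z ≤ 12 * √a * heatKernel (2 * a) z := by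
  have h1 := heatKernel_le_heatKernel_double ha z
  have h2 : ‖z‖ * Real.exp (-(‖z‖ ^ 2 / (8 * a))) ≤ 4 * √a := by
    rw [Real.exp_neg, ← div_eq_mul_inv, div_le_iff₀ (Real.exp_pos _)]
    have h := Real.add_one_le_exp (‖z‖ ^ 2 / (8 * a))
    obtain ⟨s, hs, rfl⟩ : ∃ s : ℝ, 0 < s ∧ a = s ^ 2 :=
      ⟨√a, Real.sqrt_pos.2 ha, (Real.sq_sqrt ha.le).symm⟩
    rw [Real.sqrt_sq hs.le]
    have h3 : ‖z‖ ≤ 4 * s * (‖z‖ ^ 2 / (8 * s ^ 2) + 1) := by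
      have : 4 * s * (‖z‖ ^ 2 / (8 * s ^ 2) + 1) = (‖z‖ ^ 2 + 8 * s ^ 2) / (2 * s) := by
        field_simp; ring
      rw [this, le_div_iff₀ (by positivity)]
      nlinarith [sq_nonneg (‖z‖ - s)]
    exact h3.trans (by gcongr)
  calc ‖z‖ * heatKernel a z
      ≤ ‖z‖ * (3 * (heatKernel (2 * a) z * Real.exp (-(‖z‖ ^ 2 / (8 * a))))) := by gcongr
    _ = 3 * heatKernel (2 * a) z * (‖z‖ * Real.exp (-(‖z‖ ^ 2 / (8 * a)))) := by ring
    _ ≤ 3 * heatKernel (2 * a) z * (4 * √a) := by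
        have := heatKernel_pos (t := 2 * a) (by positivity) z
        gcongr
    _ = _ := by ring

lemma sq_mul_heatKernel_le {a : ℝ} (ha : 0 < a) (z : E3) :
    (1 + ‖z‖ ^ 2) ^ 2 * heatKernel a z ≤ 384 * (1 + a) ^ 2 * heatKernel (2 * a) z := by
  have h1 := heatKernel_le_heatKernel_double ha z
  have h2 : (1 + ‖z‖ ^ 2) ^ 2 * Real.exp (-(‖z‖ ^ 2 / (8 * a))) ≤ 128 * (1 + a) ^ 2 := by
    rw [Real.exp_neg, ← div_eq_mul_inv, div_le_iff₀ (Real.exp_pos _)]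
    have h := one_add_add_sq_le_exp (y := ‖z‖ ^ 2 / (8 * a)) (by positivity)
    set y := ‖z‖ ^ 2 / (8 * a) with hy
    have hy0 : 0 ≤ y := by positivity
    have hz : ‖z‖ ^ 2 = 8 * a * y := by rw [hy]; field_simp
    have h3 : (1 + ‖z‖ ^ 2) ^ 2 ≤ 128 * (1 + a) ^ 2 * (1 + y + y ^ 2 / 2) := by
      have h4 : (1 + ‖z‖ ^ 2) ≤ (1 + a) * (1 + 8 * y) := by rw [hz]; nlinarith
      calc (1 + ‖z‖ ^ 2) ^ 2 ≤ ((1 + a) * (1 + 8 * y)) ^ 2 := by gcongr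
        _ = (1 + a) ^ 2 * (1 + 8 * y) ^ 2 := by ring
        _ ≤ (1 + a) ^ 2 * (128 * (1 + y + y ^ 2 / 2)) := by gcongr; nlinarith
        _ = _ := by ring
    exact h3.trans (by gcongr)
  have hp := heatKernel_pos (t := 2 * a) (by positivity) z
  calc (1 + ‖z‖ ^ 2) ^ 2 * heatKernel a z
      ≤ (1 + ‖z‖ ^ 2) ^ 2 * (3 * (heatKernel (2 * a) z * Real.exp (-(‖z‖ ^ 2 / (8 * a))))) := by
        gcongr
    _ = 3 * heatKernel (2 * a) z * ((1 + ‖z‖ ^ 2) ^ 2 * Real.exp (-(‖z‖ ^ 2 / (8 * a)))) := by ring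
    _ ≤ 3 * heatKernel (2 * a) z * (128 * (1 + a) ^ 2) := by gcongr
    _ = _ := by ring

lemma schwartz_decay_wt (φ : 𝓢(E3, ℝ)) :
    ∃ C, 0 ≤ C ∧ ∀ x, |φ x| ≤ C * wt x := by
  obtain ⟨C₀, hC₀⟩ := φ.decay 0 0
  obtain ⟨C₄, hC₄⟩ := φ.decay 4 0
  refine ⟨2 * C₀ + 2 * C₄, by linarith [hC₀.1, hC₄.1], fun x => ?_⟩
  have h0 : |φ x| ≤ C₀ := by simpa using hC₀.2 x
  have h4 : ‖x‖ ^ 4 * |φ x| ≤ C₄ := by simpa using hC₄.2 x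
  unfold wt
  rw [← div_eq_mul_inv, le_div_iff₀ (by positivity)]
  nlinarith [abs_nonneg (φ x), mul_nonneg (abs_nonneg (φ x)) (sq_nonneg (1 - ‖x‖ ^ 2))]

lemma integrable_schwartz_moment (φ : 𝓢(E3, ℝ)) :
    Integrable (fun x => |φ x| * (1 + ‖x‖ ^ 2) ^ 2) := by
  have h0 := φ.integrable_pow_mul (μ := volume) 0
  have h2 := φ.integrable_pow_mul (μ := volume) 2
  have h4 := φ.integrable_pow_mul (μ := volume) 4
  refine ((h0.add (h2.const_mul 2)).add h4).congr (Eventually.of_forall fun x => ?_)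
  simp
  ring

/-- The heat flow preserves decay at the rate of the weight. -/
lemma integral_heatKernel_mul_wt_le {a : ℝ} (ha : 0 < a) (x : E3) :
    Integrable (fun y => heatKernel a y * wt (x - y)) ∧
    ∫ y, heatKernel a y * wt (x - y) ≤ 1536 * (1 + a) ^ 2 * wt x := by
  have h2a : 0 < 2 * a := by positivity
  have hle : ∀ y, heatKernel a y * wt (x - y) ≤
      (1536 * (1 + a) ^ 2 * wt x) * heatKernel (2 * a) y := by
    intro y
    calc heatKernel a y * wt (x - y) ≤ heatKernel a y * (4 * (1 + ‖y‖ ^ 2) ^ 2 * wt x) :=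
          mul_le_mul_of_nonneg_left (wt_sub_le x y) (heatKernel_pos ha y).le
      _ = 4 * wt x * ((1 + ‖y‖ ^ 2) ^ 2 * heatKernel a y) := by ring
      _ ≤ 4 * wt x * (384 * (1 + a) ^ 2 * heatKernel (2 * a) y) :=
          mul_le_mul_of_nonneg_left (sq_mul_heatKernel_le ha y) (by linarith [wt_nonneg x])
      _ = _ := by ring
  have hint : Integrable (fun y => heatKernel a y * wt (x - y)) := by
    refine ((integrable_heatKernel h2a).const_mul (1536 * (1 + a) ^ 2 * wt x)).mono'
      ((continuous_heatKernel ha).mul (continuous_wt.comp (by fun_prop))).aestronglyMeasurable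
      (Eventually.of_forall fun y => ?_)
    rw [Real.norm_of_nonneg (mul_nonneg (heatKernel_pos ha y).le (wt_nonneg _))]
    exact hle y
  refine ⟨hint, (integral_mono hint ((integrable_heatKernel h2a).const_mul _) hle).trans ?_⟩
  rw [integral_const_mul, integral_heatKernel h2a, mul_one]

lemma abs_cv_gauss_le {φ : 𝓢(E3, ℝ)} {C : ℝ} (hC : ∀ x, |φ x| ≤ C * wt x) {a : ℝ} (ha : 0 < a)
    (x : E3) : |cv (gauss a) φ x| ≤ C * (1536 * (1 + a) ^ 2) * wt x := by
  have hC0 : 0 ≤ C := by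
    have := (abs_nonneg _).trans (hC 0)
    exact nonneg_of_mul_nonneg_left this (wt_pos 0)
  obtain ⟨h1, h2⟩ := integral_heatKernel_mul_wt_le ha x
  rw [cv_comm]
  unfold cv
  rw [coe_gauss ha]
  calc |∫ y, φ (x - y) * heatKernel a y| ≤ ∫ y, C * (heatKernel a y * wt (x - y)) := by
        refine abs_integral_le_of_abs_le (h1.const_mul C) fun y => ?_
        rw [abs_mul, abs_of_pos (heatKernel_pos ha y)]
        calc _ ≤ (C * wt (x - y)) * heatKernel a y :=
              mul_le_mul_of_nonneg_right (hC _) (heatKernel_pos ha y).le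
          _ = _ := by ring
    _ = C * ∫ y, heatKernel a y * wt (x - y) := integral_const_mul _ _
    _ ≤ C * (1536 * (1 + a) ^ 2 * wt x) := by gcongr
    _ = _ := by ring

/-- A Schwartz function is Lipschitz and the first moment of the Gauss kernel at time a is of order
√a. -/
lemma abs_cv_gauss_sub_le (φ : 𝓢(E3, ℝ)) : ∃ C, 0 ≤ C ∧ ∀ a, 0 < a → ∀ x,
    |cv (gauss a) φ x - φ x| ≤ C * √a := by
  obtain ⟨L, hL⟩ := (SchwartzMap.fderivCLM ℝ E3 ℝ φ).decay 0 0
  have hlip : ∀ x y, |φ x - φ y| ≤ L * ‖x - y‖ := by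
    intro x y
    have := Convex.norm_image_sub_le_of_norm_fderiv_le (f := (φ : E3 → ℝ)) (s := Set.univ)
      (x := y) (y := x) (𝕜 := ℝ) (C := L) (fun z _ => φ.differentiableAt) (fun z _ => by simpa using hL.2 z) convex_univ
      (Set.mem_univ _) (Set.mem_univ _)
    simpa using this
  refine ⟨L * 12, by linarith [hL.1], fun a ha x => ?_⟩
  have h2a : 0 < 2 * a := by positivity
  have h1 : φ x = ∫ y, φ x * heatKernel a y := by
    rw [integral_const_mul, integral_heatKernel ha, mul_one]
  have hi : Integrable (fun y => φ (x - y) * heatKernel a y) := by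
    have := (integrable_heatKernel_sub_mul ha φ x).comp_sub_left x
    simpa [mul_comm] using this
  rw [cv_comm]
  unfold cv
  rw [coe_gauss ha]
  rw [h1]
  rw [← integral_sub hi ((integrable_heatKernel ha).const_mul _)]
  calc |∫ y, (φ (x - y) * heatKernel a y - φ x * heatKernel a y)|
      ≤ ∫ y, (L * (12 * √a)) * heatKernel (2 * a) y := by
        refine abs_integral_le_of_abs_le ((integrable_heatKernel h2a).const_mul _) fun y => ?_
        rw [← sub_mul, abs_mul, abs_of_pos (heatKernel_pos ha y)]
        calc |φ (x - y) - φ x| * heatKernel a y ≤ (L * ‖y‖) * heatKernel a y := by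
              refine mul_le_mul_of_nonneg_right ?_ (heatKernel_pos ha y).le
              simpa using hlip (x - y) x
          _ = L * (‖y‖ * heatKernel a y) := by ring
          _ ≤ L * (12 * √a * heatKernel (2 * a) y) :=
              mul_le_mul_of_nonneg_left (norm_mul_heatKernel_le ha y) hL.1.le
          _ = _ := by ring
    _ = L * 12 * √a := by rw [integral_const_mul, integral_heatKernel h2a]; ring

lemma tendsto_cv_gauss (φ : 𝓢(E3, ℝ)) (x : E3) {a : ℕ → ℝ} (ha : ∀ n, 0 < a n)
    (ha0 : Tendsto a atTop (𝓝 0)) : Tendsto (fun n => cv (gauss (a n)) φ x) atTop (𝓝 (φ x)) := by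
  obtain ⟨C, hC0, hC⟩ := abs_cv_gauss_sub_le φ
  have h0 : Tendsto (fun n => C * √(a n)) atTop (𝓝 0) := by
    have := (Real.continuous_sqrt.tendsto 0).comp ha0
    simpa using this.const_mul C
  rw [tendsto_iff_norm_sub_tendsto_zero]
  exact squeeze_zero (fun _ => norm_nonneg _) (fun n => hC _ (ha n) x) h0

lemma abs_cv_le_sup {φ : 𝓢(E3, ℝ)} {C : ℝ} (hC : ∀ y, |φ y| ≤ C) {t : ℝ} (ht : 0 < t) (x : E3) :
    |cv (gauss t) φ x| ≤ C := by
  unfold cv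
  rw [coe_gauss ht]
  exact abs_integral_le_integral_abs.trans (integral_heatKernel_abs_le φ hC ht x).1

/-- With the derivatives moved from the Gauss kernel to φ, the expression stays bounded as a → 0. -/
lemma oseenCv_eq (j k l : Fin 3) (a : ℝ) (φ : 𝓢(E3, ℝ)) (x : E3) :
    oseenCv j k l a φ x = kron k l * cv (gauss a) (pd j φ) x +
      ∫ σ in Set.Ioi (0 : ℝ), cv (gauss (σ + a)) (pd3 j k l φ) x := by
  unfold oseenCv
  simp_rw [cv_pd_comm j φ, cv_pd3_comm j k l φ]

lemma integral_Ioi_cv_shift (ψ : 𝓢(E3, ℝ)) (x : E3) (a : ℝ) :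
    ∫ σ in Set.Ioi (0 : ℝ), cv (gauss (σ + a)) ψ x = ∫ σ in Set.Ioi a, cv (gauss σ) ψ x := by
  have := (measurePreserving_add_right (volume : Measure ℝ) a).setIntegral_preimage_emb
    (measurableEmbedding_addRight a) (fun σ => cv (gauss σ) ψ x) (Set.Ioi a)
  rw [← this]
  congr 2
  ext σ
  simp

/-- After a time shift the regularization only removes σ ∈ (0, a] from an integral with bounded
integrand near 0, and replaces ∂_j φ by its heat flow. -/
lemma tendsto_oseenCv (j k l : Fin 3) (φ : 𝓢(E3, ℝ)) (x : E3) {a : ℕ → ℝ} (ha : ∀ n, 0 < a n)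
    (ha0 : Tendsto a atTop (𝓝 0)) :
    Tendsto (fun n => oseenCv j k l (a n) φ x) atTop (𝓝 (lerayDeriv j k l φ x)) := by
  simp_rw [oseenCv_eq, integral_Ioi_cv_shift]
  rw [lerayDeriv_eq]
  refine ((tendsto_cv_gauss (pd j φ) x ha ha0).const_mul _).add ?_
  set ψ := pd3 j k l φ with hψ
  obtain ⟨C, hC⟩ := ψ.decay 0 0
  have hint := integrableOn_cv_gauss ψ x
  have h1 : ∀ n, ∫ σ in Set.Ioi (a n), cv (gauss σ) ψ x =
      (∫ σ in Set.Ioi (0 : ℝ), cv (gauss σ) ψ x) - ∫ σ in Set.Ioc 0 (a n), cv (gauss σ) ψ x := by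
    intro n
    rw [← Set.Ioc_union_Ioi_eq_Ioi (ha n).le, setIntegral_union (Set.Ioc_disjoint_Ioi le_rfl)
      measurableSet_Ioi (hint.mono_set Set.Ioc_subset_Ioi_self)
      (hint.mono_set (Set.Ioi_subset_Ioi (ha n).le))]
    ring
  simp_rw [h1]
  have h2 : Tendsto (fun n => ∫ σ in Set.Ioc 0 (a n), cv (gauss σ) ψ x) atTop (𝓝 0) := by
    have hlim : Tendsto (fun n => C * a n) atTop (𝓝 0) := by simpa using ha0.const_mul C
    refine squeeze_zero_norm (fun n => ?_) hlim
    have := norm_setIntegral_le_of_norm_le_const (μ := volume) (s := Set.Ioc 0 (a n))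
      (f := fun σ => cv (gauss σ) ψ x) (C := C) (by simp) (fun σ hσ =>
        abs_cv_le_sup (fun y => by simpa using hC.2 y) hσ.1 x)
    simpa [Measure.real, (ha n).le] using this
  simpa using tendsto_const_nhds.sub h2

/-- For σ > 1 the derivatives stay on the Gauss kernel, whose time integral decays like the weight;
Peetre's inequality transfers the loss to a moment of φ. -/
lemma abs_integral_cv_gauss_tail_le (j k l : Fin 3) (φ : 𝓢(E3, ℝ)) {a : ℝ} (ha : 0 < a) (x : E3) :
    |∫ σ in Set.Ioi (1 : ℝ), cv (gauss (σ + a)) (pd3 j k l φ) x| ≤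
      2112 * 4 * (∫ y, |φ y| * (1 + ‖y‖ ^ 2) ^ 2) * wt x := by
  have hprod : Integrable (fun p : ℝ × E3 => gaussD3 j k l (p.1 + a) (x - p.2) * φ p.2)
      ((volume.restrict (Set.Ioi 1)).prod volume) := by
    refine (((integrableOn_inv_cube ha).mono_set
      (Set.Ioi_subset_Ioi zero_le_one)).mul_prod φ.integrable.abs).mono' ?_ ?_
    · refine Measurable.aestronglyMeasurable (Measurable.mul ?_ ?_)
      · exact measurable_gaussD3_comp j k l (by fun_prop) (by fun_prop)
      · exact φ.continuous.measurable.comp (by fun_prop)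
    · have h0 : ∀ᵐ p ∂((volume.restrict (Set.Ioi (1 : ℝ))).prod (volume : Measure E3)),
          p.1 ∈ Set.Ioi (1 : ℝ) :=
        Measure.quasiMeasurePreserving_fst.ae (ae_restrict_mem measurableSet_Ioi)
      filter_upwards [h0] with p hp
      have hp : 1 < p.1 := hp
      rw [norm_mul]
      exact mul_le_mul_of_nonneg_right (abs_gaussD3_le_inv_cube j k l (by linarith) _)
        (norm_nonneg _)
  have hswap := integral_integral_swap
    (f := fun (σ : ℝ) (y : E3) => gaussD3 j k l (σ + a) (x - y) * φ y) hprod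
  have e1 : ∫ σ in Set.Ioi (1 : ℝ), cv (gauss (σ + a)) (pd3 j k l φ) x =
      ∫ σ in Set.Ioi (1 : ℝ), ∫ y, gaussD3 j k l (σ + a) (x - y) * φ y := by
    refine setIntegral_congr_fun measurableSet_Ioi fun σ hσ => ?_
    have hσ : 1 < σ := hσ
    rw [cv_pd3_comm, cv_comm]
    unfold cv
    simp_rw [pd3_gauss j k l (by linarith : 0 < σ + a)]
  rw [e1, hswap]
  calc _ ≤ ∫ y, 2112 * 4 * wt x * (|φ y| * (1 + ‖y‖ ^ 2) ^ 2) := by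
        refine abs_integral_le_of_abs_le ((integrable_schwartz_moment φ).const_mul _) fun y => ?_
        rw [integral_mul_const, abs_mul]
        have h1 := (integrableOn_gaussD3 j k l (s := 1) (a := a) (by linarith) (x - y)).2
        have h2 : |∫ σ in Set.Ioi (1 : ℝ), gaussD3 j k l (σ + a) (x - y)| ≤
          ∫ σ in Set.Ioi (1 : ℝ), |gaussD3 j k l (σ + a) (x - y)| := abs_integral_le_integral_abs
        have h3 : ((1 + a + ‖x - y‖ ^ 2) ^ 2)⁻¹ ≤ wt (x - y) := by
          unfold wt
          gcongr
          linarith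
        have h4 := wt_sub_le x y
        calc _ ≤ (2112 * (4 * (1 + ‖y‖ ^ 2) ^ 2 * wt x)) * |φ y| := by
              gcongr
              linarith
          _ = _ := by ring
    _ = 2112 * 4 * (∫ y, |φ y| * (1 + ‖y‖ ^ 2) ^ 2) * wt x := by rw [integral_const_mul]; ring

/-- Uniform decay of the regularized symbols. -/
lemma exists_abs_oseenCv_le (j k l : Fin 3) (φ : 𝓢(E3, ℝ)) :
    ∃ C, ∀ a, 0 < a → a ≤ 1 → ∀ x, |oseenCv j k l a φ x| ≤ C * wt x := by
  obtain ⟨C₁, hC₁0, hC₁⟩ := schwartz_decay_wt (pd j φ)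
  obtain ⟨C₃, hC₃0, hC₃⟩ := schwartz_decay_wt (pd3 j k l φ)
  set m := ∫ y, |φ y| * (1 + ‖y‖ ^ 2) ^ 2 with hm
  refine ⟨C₁ * (1536 * 2 ^ 2) + C₃ * (1536 * 3 ^ 2) + 2112 * 4 * m, fun a ha ha1 x => ?_⟩
  have hw := wt_nonneg x
  rw [oseenCv_eq]
  set ψ := pd3 j k l φ with hψ
  have hint : IntegrableOn (fun σ => cv (gauss (σ + a)) ψ x) (Set.Ioi 0) := by
    have h := ((integrableOn_cv_gauss ψ x).mono_set (Set.Ioi_subset_Ioi ha.le))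
    have := ((measurePreserving_add_right (volume : Measure ℝ) a).integrableOn_comp_preimage
      (measurableEmbedding_addRight a) (f := fun σ => cv (gauss σ) ψ x) (s := Set.Ioi a)).2 h
    rwa [Set.preimage_add_const_Ioi, sub_self] at this
  -- For σ ≤ 1 the derivatives sit on φ and the heat flow preserves the weight; for σ > 1 they must
  -- sit on the kernel to give decay in σ.
  have hsplit : ∫ σ in Set.Ioi (0 : ℝ), cv (gauss (σ + a)) ψ x =
      (∫ σ in Set.Ioc (0 : ℝ) 1, cv (gauss (σ + a)) ψ x) +
        ∫ σ in Set.Ioi (1 : ℝ), cv (gauss (σ + a)) ψ x := by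
    rw [← Set.Ioc_union_Ioi_eq_Ioi (zero_le_one' ℝ), setIntegral_union
      (Set.Ioc_disjoint_Ioi le_rfl) measurableSet_Ioi (hint.mono_set Set.Ioc_subset_Ioi_self)
      (hint.mono_set (Set.Ioi_subset_Ioi zero_le_one))]
  rw [hsplit]
  have b1 : |kron k l * cv (gauss a) (pd j φ) x| ≤ C₁ * (1536 * 2 ^ 2) * wt x := by
    rw [abs_mul]
    calc _ ≤ 1 * (C₁ * (1536 * (1 + a) ^ 2) * wt x) :=
          mul_le_mul (abs_kron_le k l) (abs_cv_gauss_le hC₁ ha x) (abs_nonneg _) zero_le_one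
      _ ≤ 1 * (C₁ * (1536 * 2 ^ 2) * wt x) := by gcongr; linarith
      _ = _ := one_mul _
  have b2 : |∫ σ in Set.Ioc (0 : ℝ) 1, cv (gauss (σ + a)) ψ x| ≤ C₃ * (1536 * 3 ^ 2) * wt x := by
    have := norm_setIntegral_le_of_norm_le_const (μ := volume) (s := Set.Ioc (0 : ℝ) 1)
      (f := fun σ => cv (gauss (σ + a)) ψ x) (C := C₃ * (1536 * 3 ^ 2) * wt x) (by simp)
      (fun σ hσ => (abs_cv_gauss_le hC₃ (add_pos hσ.1 ha) x).trans (by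
        have h1 := hσ.1
        have h2 := hσ.2
        gcongr
        linarith))
    simpa [Measure.real] using this
  have b3 : |∫ σ in Set.Ioi (1 : ℝ), cv (gauss (σ + a)) ψ x| ≤ 2112 * 4 * m * wt x :=
    abs_integral_cv_gauss_tail_le j k l φ ha x
  refine (abs_add_le _ _).trans ?_
  have := abs_add_le (∫ σ in Set.Ioc (0 : ℝ) 1, cv (gauss (σ + a)) ψ x)
    (∫ σ in Set.Ioi (1 : ℝ), cv (gauss (σ + a)) ψ x)
  linarith

lemma exists_seq : ∃ a : ℕ → ℝ, (∀ n, 0 < a n) ∧ (∀ n, a n ≤ 1) ∧ Tendsto a atTop (𝓝 0) :=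
  ⟨fun n => 1 / ((n : ℝ) + 1), fun n => by positivity,
    fun n => by
      rw [div_le_one (by positivity)]
      have : (0 : ℝ) ≤ n := n.cast_nonneg
      linarith, tendsto_one_div_add_atTop_nhds_zero_nat⟩

lemma exists_abs_lerayDeriv_le (j k l : Fin 3) (φ : 𝓢(E3, ℝ)) :
    ∃ C, ∀ x, |lerayDeriv j k l φ x| ≤ C * wt x := by
  obtain ⟨C, hC⟩ := exists_abs_oseenCv_le j k l φ
  obtain ⟨a, ha, ha1, ha0⟩ := exists_seq
  exact ⟨C, fun x => le_of_tendsto (tendsto_oseenCv j k l φ x ha ha0).abs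
    (Eventually.of_forall fun n => hC _ (ha n) (ha1 n) x)⟩

/-! ### Pairing kernels with weighted integrable functions -/

lemma WtIntegrable.aestronglyMeasurable {P : E3 → ℝ} (hP : Integrable (fun y => P y * wt y)) :
    AEStronglyMeasurable P := by
  have h := hP.1.mul (continuous_wt.inv₀ fun y => (wt_pos y).ne').aestronglyMeasurable
  refine h.congr (Eventually.of_forall fun y => ?_)
  have := (wt_pos y).ne'
  simp only [Pi.mul_apply, Pi.inv_apply]
  field_simp

lemma abs_kernel_le {K : E3 → ℝ} {C : ℝ} (hK : ∀ z, |K z| ≤ C * wt z) (x y : E3) :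
    |K (x - y)| ≤ (4 * C * (1 + ‖x‖ ^ 2) ^ 2) * wt y := by
  have hC0 : 0 ≤ C := nonneg_of_mul_nonneg_left ((abs_nonneg _).trans (hK 0)) (wt_pos 0)
  calc |K (x - y)| ≤ C * wt (x - y) := hK _
    _ = C * wt (y - x) := by rw [← wt_neg, neg_sub]
    _ ≤ C * (4 * (1 + ‖x‖ ^ 2) ^ 2 * wt y) := by gcongr; exact wt_sub_le y x
    _ = _ := by ring

lemma integrable_kernel_mul {K : E3 → ℝ} {C : ℝ} (hKc : Continuous K)
    (hK : ∀ z, |K z| ≤ C * wt z) {P : E3 → ℝ} (hP : Integrable (fun y => P y * wt y)) (x : E3) :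
    Integrable (fun y => K (x - y) * P y) := by
  refine (hP.abs.const_mul (4 * C * (1 + ‖x‖ ^ 2) ^ 2)).mono'
    ((hKc.comp (by fun_prop)).aestronglyMeasurable.mul (WtIntegrable.aestronglyMeasurable hP))
    (Eventually.of_forall fun y => ?_)
  rw [Real.norm_eq_abs, abs_mul, abs_mul, abs_of_pos (wt_pos y)]
  calc _ ≤ ((4 * C * (1 + ‖x‖ ^ 2) ^ 2) * wt y) * |P y| := by
        gcongr
        exact abs_kernel_le hK x y
    _ = _ := by ring

lemma continuous_kernel_integral {K : E3 → ℝ} {C : ℝ} (hKc : Continuous K)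
    (hK : ∀ z, |K z| ≤ C * wt z) {P : E3 → ℝ} (hP : Integrable (fun y => P y * wt y)) :
    Continuous (fun x => ∫ y, K (x - y) * P y) := by
  have hC0 : 0 ≤ C := nonneg_of_mul_nonneg_left ((abs_nonneg _).trans (hK 0)) (wt_pos 0)
  rw [continuous_iff_continuousAt]
  intro x₀
  refine continuousAt_of_dominated
    (bound := fun y => (4 * C * (1 + (‖x₀‖ + 1) ^ 2) ^ 2) * |P y * wt y|) ?_ ?_
    (hP.abs.const_mul _) ?_
  · exact Eventually.of_forall fun x => (integrable_kernel_mul hKc hK hP x).1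
  · filter_upwards [Metric.ball_mem_nhds x₀ one_pos] with x hx
    refine Eventually.of_forall fun y => ?_
    have hx' : ‖x‖ ≤ ‖x₀‖ + 1 := by
      have h1 : ‖x - x₀‖ < 1 := by simpa [dist_eq_norm] using hx
      have h2 := norm_add_le (x - x₀) x₀
      rw [sub_add_cancel] at h2
      linarith
    rw [Real.norm_eq_abs, abs_mul, abs_mul, abs_of_pos (wt_pos y)]
    have hw := wt_nonneg y
    calc _ ≤ ((4 * C * (1 + ‖x‖ ^ 2) ^ 2) * wt y) * |P y| := by
          gcongr
          exact abs_kernel_le hK x y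
      _ ≤ ((4 * C * (1 + (‖x₀‖ + 1) ^ 2) ^ 2) * wt y) * |P y| := by gcongr
      _ = _ := by ring
  · exact Eventually.of_forall fun y => ((hKc.comp (by fun_prop)).mul continuous_const).continuousAt

/-- Vanishing against approximating kernels passes to the limit. -/
lemma sum_integral_eq_zero_of_kernels {ι : Type*} [Fintype ι] {P : ι → E3 → ℝ}
    (hP : ∀ i, Integrable (fun y => P i y * wt y)) {K : ι → ℕ → E3 → ℝ} {Ck : ι → ℕ → ℝ}
    (hKc : ∀ i n, Continuous (K i n)) (hK : ∀ i n z, |K i n z| ≤ Ck i n * wt z)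
    (φ : 𝓢(E3, ℝ)) {Q : ι → ℕ → E3 → ℝ} {C : ι → ℝ} (hQ : ∀ i n y, ∫ x, φ x * K i n (x - y) = -Q i n y)
    (hQb : ∀ i n y, |Q i n y| ≤ C i * wt y) {L : ι → E3 → ℝ}
    (hL : ∀ i y, Tendsto (fun n => Q i n y) atTop (𝓝 (L i y)))
    (h0 : ∀ n x, ∑ i, ∫ y, K i n (x - y) * P i y = 0) :
    ∑ i, ∫ y, P i y * L i y = 0 := by
  have hprod : ∀ i n, Integrable (fun p : E3 × E3 => φ p.1 * (K i n (p.1 - p.2) * P i p.2)) := by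
    intro i n
    have h1 := ((integrable_schwartz_moment φ).const_mul (4 * Ck i n)).mul_prod (hP i).abs
    refine h1.mono' ?_ (Eventually.of_forall fun p => ?_)
    · refine (φ.continuous.comp continuous_fst).aestronglyMeasurable.mul
        (((hKc i n).comp (by fun_prop)).aestronglyMeasurable.mul ?_)
      exact (WtIntegrable.aestronglyMeasurable (hP i)).comp_snd
    · rw [Real.norm_eq_abs, abs_mul, abs_mul, abs_mul, abs_of_pos (wt_pos p.2)]
      calc _ ≤ |φ p.1| * (((4 * Ck i n * (1 + ‖p.1‖ ^ 2) ^ 2) * wt p.2) * |P i p.2|) := by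
            gcongr
            exact abs_kernel_le (hK i n) p.1 p.2
        _ = _ := by ring
  have hzero : ∀ n, ∑ i, ∫ y, P i y * Q i n y = 0 := by
    intro n
    have h1 : ∀ i, ∫ x, φ x * ∫ y, K i n (x - y) * P i y = -∫ y, P i y * Q i n y := by
      intro i
      have := integral_integral_swap (f := fun x y => φ x * (K i n (x - y) * P i y)) (hprod i n)
      simp_rw [integral_const_mul] at this
      rw [this, ← integral_neg]
      congr 1
      funext y
      simp_rw [← mul_assoc]
      rw [integral_mul_const, hQ]
      ring
    have h2 : ∫ x, φ x * ∑ i, ∫ y, K i n (x - y) * P i y = 0 := by simp [h0 n]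
    simp_rw [Finset.mul_sum] at h2
    rw [integral_finsetSum] at h2
    · simp_rw [h1] at h2
      rw [Finset.sum_neg_distrib, neg_eq_zero] at h2
      exact h2
    · intro i _
      have := (hprod i n).integral_prod_left
      simpa only [integral_const_mul] using this
  have hlim : Tendsto (fun n => ∑ i, ∫ y, P i y * Q i n y) atTop (𝓝 (∑ i, ∫ y, P i y * L i y)) := by
    refine tendsto_finsetSum _ fun i _ => ?_
    refine tendsto_integral_of_dominated_convergence (fun y => C i * |P i y * wt y|) ?_
      ((hP i).abs.const_mul _) ?_ ?_
    · intro n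
      refine (WtIntegrable.aestronglyMeasurable (hP i)).mul ?_
      have hm : StronglyMeasurable (fun y => ∫ x, φ x * K i n (x - y)) := by
        have : Continuous (fun p : E3 × E3 => φ p.2 * K i n (p.2 - p.1)) :=
          (φ.continuous.comp continuous_snd).mul ((hKc i n).comp (by fun_prop))
        exact this.stronglyMeasurable.integral_prod_right
      have e : (fun y => ∫ x, φ x * K i n (x - y)) = fun y => -Q i n y := funext fun y => hQ i n y
      rw [e] at hm
      have h2 := hm.neg.aestronglyMeasurable (μ := volume)
      exact h2.congr (Eventually.of_forall fun y => by simp)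
    · refine fun n => Eventually.of_forall fun y => ?_
      rw [Real.norm_eq_abs, abs_mul, abs_mul, abs_of_pos (wt_pos y)]
      calc _ ≤ |P i y| * (C i * wt y) := by gcongr; exact hQb i n y
        _ = _ := by ring
    · exact Eventually.of_forall fun y => (hL i y).const_mul _
  exact tendsto_nhds_unique hlim (by simp [hzero])

lemma integral_mul_oseenKernel_sub (j k l : Fin 3) {a : ℝ} (ha : 0 < a) (φ : 𝓢(E3, ℝ)) (y : E3) :
    ∫ x, φ x * oseenKernel j k l a (x - y) = -oseenCv j k l a φ y := by
  rw [← integral_mul_oseenKernel j k l ha, ← integral_neg,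
    ← integral_sub_left_eq_self _ volume y]
  congr 1
  funext x
  rw [sub_sub_cancel_left, oseenKernel_neg j k l ha]
  ring

/-- Removes the regularization: by oddness, testing the convolution with φ puts -`oseenCv` on the
products, and this converges to the symbol with a bound uniform in a ≤ 1. -/
lemma sum_integral_lerayDeriv_eq_zero (l : Fin 3) {P : Fin 3 → Fin 3 → E3 → ℝ}
    (hP : ∀ j k, Integrable (fun y => P j k y * wt y)) {a : ℕ → ℝ} (ha : ∀ n, 0 < a n)
    (ha1 : ∀ n, a n ≤ 1) (ha0 : Tendsto a atTop (𝓝 0))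
    (h0 : ∀ n x, ∑ j, ∑ k, ∫ y, oseenKernel j k l (a n) (x - y) * P j k y = 0) (φ : 𝓢(E3, ℝ)) :
    ∑ j, ∑ k, ∫ y, P j k y * lerayDeriv j k l φ y = 0 := by
  choose C hC using fun j k => exists_abs_oseenCv_le j k l φ
  have := sum_integral_eq_zero_of_kernels (ι := Fin 3 × Fin 3) (P := fun i => P i.1 i.2)
    (fun i => hP i.1 i.2) (K := fun i n => oseenKernel i.1 i.2 l (a n))
    (Ck := fun _ n => 2240 * (1 + (a n)⁻¹) ^ 2)
    (fun i n => continuous_oseenKernel i.1 i.2 l (ha n))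
    (fun i n z => abs_oseenKernel_le_wt i.1 i.2 l (ha n) z) φ
    (Q := fun i n => oseenCv i.1 i.2 l (a n) φ) (C := fun i => C i.1 i.2)
    (fun i n y => integral_mul_oseenKernel_sub i.1 i.2 l (ha n) φ y)
    (fun i n y => hC i.1 i.2 _ (ha n) (ha1 n) y) (L := fun i => lerayDeriv i.1 i.2 l φ)
    (fun i y => tendsto_oseenCv i.1 i.2 l φ y ha ha0)
    (fun n x => by rw [Fintype.sum_prod_type]; exact h0 n x)
  rwa [Fintype.sum_prod_type] at this

lemma abs_partialDeriv_heatKernel_le_wt (j : Fin 3) {t : ℝ} (ht : 0 < t) (x : E3) :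
    |partialDeriv j (heatKernel t) x| ≤ (128 * (1 + t⁻¹) ^ 2) * wt x := by
  have h := inv_add_sq_le_wt ht x
  calc _ ≤ (t ^ 2)⁻¹ * Real.exp (-(‖x‖ ^ 2 / (8 * t))) := abs_partialDeriv_heatKernel_le j ht x
    _ ≤ 128 * ((t + ‖x‖ ^ 2) ^ 2)⁻¹ := exp_neg_div_le ht
    _ ≤ 128 * ((1 + t⁻¹) ^ 2 * wt x) := by gcongr
    _ = _ := by ring

lemma integral_partialDeriv_eq_zero_of_heatKernel (r : Fin 3) {f : E3 → ℝ}
    (hf : Integrable (fun y => f y * wt y)) {a : ℕ → ℝ} (ha : ∀ n, 0 < a n)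
    (ha1 : ∀ n, a n ≤ 1) (ha0 : Tendsto a atTop (𝓝 0))
    (h0 : ∀ n x, ∫ y, partialDeriv r (heatKernel (a n)) (x - y) * f y = 0) (φ : 𝓢(E3, ℝ)) :
    ∫ y, f y * partialDeriv r φ y = 0 := by
  obtain ⟨C, hC0, hC⟩ := schwartz_decay_wt (pd r φ)
  have := sum_integral_eq_zero_of_kernels (ι := Unit) (P := fun _ => f)
    (fun _ => hf) (K := fun _ n => partialDeriv r (heatKernel (a n)))
    (Ck := fun _ n => 128 * (1 + (a n)⁻¹) ^ 2)
    (fun _ n => by rw [← coe_gauss (ha n), ← coe_pd]; exact SchwartzMap.continuous _)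
    (fun _ n z => abs_partialDeriv_heatKernel_le_wt r (ha n) z) φ
    (Q := fun _ n => cv (gauss (a n)) (pd r φ)) (C := fun _ => C * (1536 * 2 ^ 2))
    (fun _ n y => by
      rw [cv_pd_comm]
      unfold cv
      rw [← integral_neg, ← integral_sub_left_eq_self _ volume y]
      congr 1
      funext x
      rw [sub_sub_cancel_left, partialDeriv_heatKernel_neg, coe_pd, coe_gauss (ha n)]
      ring)
    (fun _ n y => by
      refine (abs_cv_gauss_le hC (ha n) y).trans ?_
      have := wt_nonneg y
      have := ha n
      gcongr
      linarith [ha1 n])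
    (L := fun _ => pd r φ) (fun _ y => tendsto_cv_gauss (pd r φ) y ha ha0)
    (fun n x => by simpa using h0 n x)
  rw [← coe_pd]
  simpa using this

/-- The symbol annihilates constants. -/
lemma integral_lerayDeriv (j k l : Fin 3) (φ : 𝓢(E3, ℝ)) : ∫ y, lerayDeriv j k l φ y = 0 := by
  obtain ⟨a, ha, ha1, ha0⟩ := exists_seq
  -- The matrix of products is taken to be the constant 1 in the single entry (j, k); the
  -- regularized pairings vanish because the Oseen kernel has mean zero.
  have := sum_integral_lerayDeriv_eq_zero l
    (P := fun j' k' _ => if j' = j ∧ k' = k then 1 else 0)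
    (fun j' k' => integrable_wt.const_mul _) ha ha1 ha0
    (fun n x => by simp_rw [integral_mul_const, integral_oseenKernel_sub _ _ _ (ha n)]; simp) φ
  simp_rw [integral_const_mul] at this
  rw [Finset.sum_eq_single j, Finset.sum_eq_single k] at this
  · simpa using this
  · intro b _ hb
    simp [hb]
  · simp
  · intro b _ hb
    simp [hb]
  · simp

/-! ### Functions of time with vanishing primitive -/

/-- Half lines form a π-system generating the Borel sets; the vanishing total integral handles
complements. -/
lemma ae_eq_zero_of_forall_setIntegral_Iio {g : ℝ → ℝ} (hg : Integrable g) (h0 : ∫ s, g s = 0)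
    (h : ∀ a, ∫ s in Set.Iio a, g s = 0) : g =ᵐ[volume] 0 := by
  suffices ∀ s, MeasurableSet s → ∫ x in s, g x = 0 from
    hg.ae_eq_zero_of_forall_setIntegral_eq_zero fun s hs _ => this s hs
  intro s hs
  induction s, hs using MeasurableSpace.induction_on_inter (borel_eq_generateFrom_Iio ℝ)
    isPiSystem_Iio with
  | empty => simp
  | basic t ht =>
    obtain ⟨a, rfl⟩ := ht
    exact h a
  | compl t ht ih =>
    have := integral_add_compl ht hg
    rw [ih, h0] at this
    linarith
  | iUnion f hd hm ih =>
    rw [integral_iUnion hm hd hg.integrableOn]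
    simp [ih]

/-- The hypothesis is available for almost every endpoint only, because Fubini for the Duhamel
integral is justified only for such t. -/
lemma ae_eq_zero_of_primitive {g : ℝ → ℝ} {T : ℝ}
    (h : ∀ᵐ t ∂(volume.restrict (Set.Ioo 0 T)),
      IntegrableOn g (Set.Ioo 0 t) ∧ ∫ s in Set.Ioo 0 t, g s = 0) :
    ∀ᵐ s ∂(volume.restrict (Set.Ioo 0 T)), g s = 0 := by
  have h' : ∀ᵐ t : ℝ, t ∈ Set.Ioo 0 T →
      IntegrableOn g (Set.Ioo 0 t) ∧ ∫ s in Set.Ioo 0 t, g s = 0 :=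
    (ae_restrict_iff' measurableSet_Ioo).1 h
  have key : ∀ t₁ ∈ Set.Ioo 0 T, IntegrableOn g (Set.Ioo 0 t₁) → ∫ s in Set.Ioo 0 t₁, g s = 0 →
      ∀ᵐ s : ℝ, s ∈ Set.Ioo 0 t₁ → g s = 0 := by
    intro t₁ ht₁ hg hg0
    set f := (Set.Ioo 0 t₁).indicator g with hf
    have hfi : Integrable f := (integrable_indicator_iff measurableSet_Ioo).2 hg
    have hF : ∀ a, ∫ s in Set.Iio a, f s = ∫ s in Set.Ioo 0 t₁ ∩ Set.Iio a, g s := by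
      intro a
      rw [hf, setIntegral_indicator measurableSet_Ioo, Set.inter_comm]
    have hcont : Continuous (fun a => ∫ s in Set.Iio a, f s) := by
      have h1 : (fun a => ∫ s in Set.Iio a, f s) =
          fun a => (∫ s in Set.Iic (0 : ℝ), f s) + ∫ s in (0 : ℝ)..a, f s := by
        funext a
        rw [← intervalIntegral.integral_Iic_sub_Iic hfi.integrableOn hfi.integrableOn,
          integral_Iic_eq_integral_Iio (x := a)]
        ring
      rw [h1]
      exact continuous_const.add (intervalIntegral.continuous_primitive
        (fun a b => hfi.intervalIntegrable) 0)
    have hae : (fun a => ∫ s in Set.Iio a, f s) =ᵐ[volume.restrict (Set.Ioo 0 t₁)] fun _ => 0 := by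
      rw [EventuallyEq, ae_restrict_iff' measurableSet_Ioo]
      filter_upwards [h'] with a ha ha1
      rw [hF, Set.Ioo_inter_Iio, min_eq_right ha1.2.le]
      exact (ha ⟨ha1.1, ha1.2.trans ht₁.2⟩).2
    -- The primitive is continuous, so vanishing at almost every endpoint gives vanishing at every
    -- endpoint.
    have hEq := Measure.eqOn_Ioo_of_ae_eq volume hae hcont.continuousOn continuousOn_const
    have hz : f =ᵐ[volume] 0 := by
      refine ae_eq_zero_of_forall_setIntegral_Iio hfi ?_ fun a => ?_
      · rw [hf, integral_indicator measurableSet_Ioo, hg0]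
      · rcases le_or_gt a 0 with ha | ha
        · rw [hF, Set.Ioo_inter_Iio, Set.Ioo_eq_empty]
          · simp
          · simp [ha]
        · rcases lt_or_ge a t₁ with ha1 | ha1
          · exact hEq ⟨ha, ha1⟩
          · rw [hF, Set.Ioo_inter_Iio, min_eq_left ha1, hg0]
    filter_upwards [hz] with s hs hs1
    simpa [hf, Set.indicator_of_mem hs1] using hs
  -- Beyond each rational q < T lies a good endpoint; countably many of them exhaust (0, T), so the
  -- null sets can be united.
  have hex : ∀ q : ℚ, (q : ℝ) ∈ Set.Ioo 0 T → ∃ t₁ ∈ Set.Ioo (q : ℝ) T,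
      IntegrableOn g (Set.Ioo 0 t₁) ∧ ∫ s in Set.Ioo 0 t₁, g s = 0 := by
    intro q hq
    have hne : (ae (volume.restrict (Set.Ioo (q : ℝ) T))).NeBot := by
      rw [ae_restrict_neBot]
      simp [hq.2]
    have h3 : ∀ᵐ t ∂(volume.restrict (Set.Ioo (q : ℝ) T)), t ∈ Set.Ioo (q : ℝ) T ∧
        IntegrableOn g (Set.Ioo 0 t) ∧ ∫ s in Set.Ioo 0 t, g s = 0 := by
      rw [ae_restrict_iff' measurableSet_Ioo]
      filter_upwards [h'] with t ht ht1
      exact ⟨ht1, ht ⟨hq.1.trans ht1.1, ht1.2⟩⟩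
    obtain ⟨t₁, h4, h5⟩ := h3.exists
    exact ⟨t₁, h4, h5⟩
  have hall : ∀ᵐ s : ℝ, ∀ q : ℚ, (q : ℝ) ∈ Set.Ioo 0 T → s ∈ Set.Ioo (0 : ℝ) q → g s = 0 := by
    rw [ae_all_iff]
    intro q
    by_cases hq : (q : ℝ) ∈ Set.Ioo 0 T
    · obtain ⟨t₁, ht₁, hg, hg0⟩ := hex q hq
      filter_upwards [key t₁ ⟨hq.1.trans ht₁.1, ht₁.2⟩ hg hg0] with s hs _ hs1
      exact hs ⟨hs1.1, hs1.2.trans ht₁.1⟩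
    · exact Eventually.of_forall fun s h => absurd h hq
  rw [ae_restrict_iff' measurableSet_Ioo]
  filter_upwards [hall] with s hs hs1
  obtain ⟨q, hq1, hq2⟩ := exists_rat_btwn hs1.2
  exact hs q ⟨hs1.1.trans hq1, hq2⟩ ⟨hs1.1, hq1⟩

/-! ### Regularized Duhamel integrals -/

/-- Scaling by √τ: the factor τ⁻² of the integrand and the Jacobian τ^{3/2} leave τ^{-1/2}. -/
lemma integral_inv_add_sq {τ : ℝ} (hτ : 0 < τ) :
    Integrable (fun z : E3 => ((τ + ‖z‖ ^ 2) ^ 2)⁻¹) ∧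
    ∫ z : E3, ((τ + ‖z‖ ^ 2) ^ 2)⁻¹ = τ ^ (-(1 / 2) : ℝ) * ∫ z, wt z := by
  have hs : 0 < √τ := Real.sqrt_pos.2 hτ
  have hsq : √τ ^ 2 = τ := Real.sq_sqrt hτ.le
  have h : (fun z : E3 => ((τ + ‖z‖ ^ 2) ^ 2)⁻¹) =
      fun z => (τ ^ 2)⁻¹ * wt ((√τ)⁻¹ • z) := by
    funext z
    unfold wt
    rw [norm_smul, mul_pow, norm_inv, Real.norm_of_nonneg hs.le, inv_pow, hsq]
    field_simp
  rw [h]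
  refine ⟨(integrable_wt.comp_smul (inv_ne_zero hs.ne')).const_mul _, ?_⟩
  rw [integral_const_mul, Measure.integral_comp_inv_smul volume wt (√τ)]
  simp only [finrank_euclideanSpace, Fintype.card_fin, smul_eq_mul]
  rw [abs_of_pos (by positivity), ← mul_assoc]
  congr 1
  rw [Real.rpow_neg hτ.le, ← Real.sqrt_eq_rpow]
  nth_rewrite 1 [← hsq]
  field_simp

/-- The domination for Fubini in the regularized Duhamel integral. The L¹ norm of the Oseen kernel
costs τ^{-1/2}, and the Gaussian about x' pays for moving the weight to y. -/
lemma exists_integral_heat_oseen_le (j k l : Fin 3) {b : ℝ} (hb : 0 < b) (x' : E3) :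
    ∃ c₁ c₂ : ℝ, 0 ≤ c₁ ∧ 0 ≤ c₂ ∧ ∀ τ, 0 < τ → ∀ y,
      Integrable (fun x => heatKernel b (x' - x) * oseenKernel j k l τ (x - y)) ∧
      ∫ x, |heatKernel b (x' - x) * oseenKernel j k l τ (x - y)| ≤
        wt y * (c₁ + c₂ * τ ^ (-(1 / 2) : ℝ)) := by
  have h2b : 0 < 2 * b := by positivity
  set D := 1536 * (1 + ‖x'‖ ^ 2) ^ 2 * (1 + b) ^ 2 with hD
  set κ := (8 * (√(2 * b)) ^ 3)⁻¹ with hκ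
  have hκ0 : 0 < κ := by have := Real.sqrt_pos.2 h2b; positivity
  have hD0 : 0 < D := by positivity
  have hW : 0 ≤ ∫ z, wt z := integral_nonneg wt_nonneg
  refine ⟨17920 * D, 17920 * D * κ * ∫ z, wt z, by positivity, by positivity, fun τ hτ y => ?_⟩
  obtain ⟨hi, hival⟩ := integral_inv_add_sq hτ
  have hw := wt_nonneg y
  have hG : ∀ x, (1 + ‖x‖ ^ 2) ^ 2 * heatKernel b (x' - x) ≤ D * heatKernel (2 * b) (x' - x) := by
    intro x
    have h1 : (1 + ‖x‖ ^ 2) ^ 2 ≤ 4 * (1 + ‖x'‖ ^ 2) ^ 2 * (1 + ‖x' - x‖ ^ 2) ^ 2 := by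
      have h := wt_sub_le x x'
      rw [← wt_neg, neg_sub] at h
      unfold wt at h
      rw [← div_eq_mul_inv, inv_eq_one_div, div_le_div_iff₀ (by positivity) (by positivity)] at h
      linarith
    have h2 := sq_mul_heatKernel_le hb (x' - x)
    have h3 := heatKernel_pos hb (x' - x)
    calc _ ≤ 4 * (1 + ‖x'‖ ^ 2) ^ 2 * (1 + ‖x' - x‖ ^ 2) ^ 2 * heatKernel b (x' - x) := by gcongr
      _ = 4 * (1 + ‖x'‖ ^ 2) ^ 2 * ((1 + ‖x' - x‖ ^ 2) ^ 2 * heatKernel b (x' - x)) := by ring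
      _ ≤ 4 * (1 + ‖x'‖ ^ 2) ^ 2 * (384 * (1 + b) ^ 2 * heatKernel (2 * b) (x' - x)) := by gcongr
      _ = _ := by rw [hD]; ring
  have hO : ∀ x, |oseenKernel j k l τ (x - y)| ≤
      2240 * (4 * (1 + ‖x‖ ^ 2) ^ 2 * wt y * (2 + 2 * ((τ + ‖x - y‖ ^ 2) ^ 2)⁻¹)) := by
    intro x
    refine (abs_oseenKernel_le j k l hτ (x - y)).trans ?_
    -- Separates the decay `wt (x - y)`, uniform in τ, from the singularity near x = y, which the
    -- next integral evaluates by scaling. Later 17920 = 2240 · 4 · 2.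
    have h1 : ((τ + ‖x - y‖ ^ 2) ^ 2)⁻¹ ≤ wt (x - y) * (2 + 2 * ((τ + ‖x - y‖ ^ 2) ^ 2)⁻¹) := by
      set m := τ + ‖x - y‖ ^ 2 with hm
      have hm0 : 0 < m := by positivity
      have h2 : 1 + ‖x - y‖ ^ 2 ≤ 1 + m := by rw [hm]; linarith
      have h3 : (1 + ‖x - y‖ ^ 2) ^ 2 ≤ 2 * m ^ 2 + 2 := by
        have : (1 + ‖x - y‖ ^ 2) ^ 2 ≤ (1 + m) ^ 2 := by gcongr
        nlinarith [sq_nonneg (m - 1)]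
      unfold wt
      rw [inv_mul_eq_div, le_div_iff₀ (by positivity), inv_mul_eq_div, div_le_iff₀ (by positivity)]
      have : (2 + 2 * (m ^ 2)⁻¹) * m ^ 2 = 2 * m ^ 2 + 2 := by field_simp
      rw [this]
      exact h3
    have h4 : wt (x - y) ≤ 4 * (1 + ‖x‖ ^ 2) ^ 2 * wt y := by
      rw [← wt_neg, neg_sub]; exact wt_sub_le y x
    gcongr
    exact h1.trans (by gcongr)
  have hle : ∀ x, |heatKernel b (x' - x) * oseenKernel j k l τ (x - y)| ≤
      wt y * (17920 * D * heatKernel (2 * b) (x' - x) +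
        17920 * D * κ * ((τ + ‖x - y‖ ^ 2) ^ 2)⁻¹) := by
    intro x
    have hp := heatKernel_pos hb (x' - x)
    have hp2 := heatKernel_pos h2b (x' - x)
    have hk := heatKernel_le_const h2b (x' - x)
    have hm : 0 ≤ ((τ + ‖x - y‖ ^ 2) ^ 2)⁻¹ := by positivity
    rw [abs_mul, abs_of_pos hp]
    calc _ ≤ heatKernel b (x' - x) *
          (2240 * (4 * (1 + ‖x‖ ^ 2) ^ 2 * wt y * (2 + 2 * ((τ + ‖x - y‖ ^ 2) ^ 2)⁻¹))) := by
          gcongr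
          exact hO x
      _ = 17920 * wt y * (1 + ((τ + ‖x - y‖ ^ 2) ^ 2)⁻¹) *
          ((1 + ‖x‖ ^ 2) ^ 2 * heatKernel b (x' - x)) := by ring
      _ ≤ 17920 * wt y * (1 + ((τ + ‖x - y‖ ^ 2) ^ 2)⁻¹) * (D * heatKernel (2 * b) (x' - x)) :=
          mul_le_mul_of_nonneg_left (hG x) (by positivity)
      _ = 17920 * wt y * D * (heatKernel (2 * b) (x' - x) +
          ((τ + ‖x - y‖ ^ 2) ^ 2)⁻¹ * heatKernel (2 * b) (x' - x)) := by ring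
      _ ≤ 17920 * wt y * D * (heatKernel (2 * b) (x' - x) +
          ((τ + ‖x - y‖ ^ 2) ^ 2)⁻¹ * κ) := by gcongr
      _ = _ := by ring
  have hb1 : Integrable (fun x => 17920 * D * heatKernel (2 * b) (x' - x)) :=
    ((integrable_heatKernel h2b).comp_sub_left x').const_mul _
  have hb2 : Integrable (fun x => 17920 * D * κ * ((τ + ‖x - y‖ ^ 2) ^ 2)⁻¹) :=
    (hi.comp_sub_right y).const_mul _
  have hint : Integrable (fun x => heatKernel b (x' - x) * oseenKernel j k l τ (x - y)) := by
    refine ((hb1.add hb2).const_mul (wt y)).mono' ?_ (Eventually.of_forall hle)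
    exact (((continuous_heatKernel hb).comp (by fun_prop)).mul
      ((continuous_oseenKernel j k l hτ).comp (by fun_prop))).aestronglyMeasurable
  refine ⟨hint, (integral_mono hint.abs ((hb1.add hb2).const_mul (wt y)) hle).trans ?_⟩
  rw [integral_const_mul]
  simp only [Pi.add_apply]
  rw [integral_add hb1 hb2, integral_const_mul, integral_const_mul,
    integral_sub_left_eq_self (heatKernel (2 * b)) volume x', integral_heatKernel h2b,
    integral_sub_right_eq_self (fun z : E3 => ((τ + ‖z‖ ^ 2) ^ 2)⁻¹) y, hival]
  apply le_of_eq
  ring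

/-- By Fubini and the semigroup law, e^{(T-t)Δ} advances each kernel from time t-s to T-s. On the
right t is then only the upper limit of integration, so one may differentiate in it. The assumption
`hgood` controls the singularity (t-s)^{-1/2}. -/
lemma duhamel_regularized (j k l : Fin 3) {P : ℝ → E3 → ℝ} {t T : ℝ} (htT : t < T)
    (x' : E3) (hP : Integrable (fun p : ℝ × E3 => P p.1 p.2 * wt p.2)
      ((volume.restrict (Set.Ioo 0 t)).prod volume))
    (hgood : IntegrableOn (fun s => (∫ y, |P s y * wt y|) * (t - s) ^ (-(1 / 2) : ℝ))
      (Set.Ioo 0 t)) :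
    Integrable (fun x => heatKernel (T - t) (x' - x) *
      ∫ s in Set.Ioo 0 t, ∫ y, oseenKernel j k l (t - s) (x - y) * P s y) ∧
    IntegrableOn (fun s => ∫ y, oseenKernel j k l (T - s) (x' - y) * P s y) (Set.Ioo 0 t) ∧
    ∫ x, heatKernel (T - t) (x' - x) *
      (∫ s in Set.Ioo 0 t, ∫ y, oseenKernel j k l (t - s) (x - y) * P s y) =
      ∫ s in Set.Ioo 0 t, ∫ y, oseenKernel j k l (T - s) (x' - y) * P s y := by
  have hb : 0 < T - t := by linarith
  obtain ⟨c₁, c₂, hc₁, hc₂, hbound⟩ := exists_integral_heat_oseen_le j k l hb x'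
  obtain ⟨E, hEm, hE⟩ := measurable_oseenKernel j k l
  set μ := (volume.restrict (Set.Ioo 0 t)).prod (volume : Measure E3) with hμ
  have hmem : ∀ᵐ p ∂μ, p.1 ∈ Set.Ioo 0 t :=
    Measure.quasiMeasurePreserving_fst.ae (ae_restrict_mem measurableSet_Ioo)
  have hPm : AEStronglyMeasurable (fun p : ℝ × E3 => P p.1 p.2) μ := by
    have h := hP.1.mul ((continuous_wt.inv₀ fun y => (wt_pos y).ne').comp
      continuous_snd).aestronglyMeasurable
    refine h.congr (Eventually.of_forall fun p => ?_)
    have := (wt_pos p.2).ne'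
    simp only [Pi.mul_apply, Function.comp_apply, Pi.inv_apply]
    field_simp
  let F : (ℝ × E3) × E3 → ℝ := fun q =>
    (heatKernel (T - t) (x' - q.2) * oseenKernel j k l (t - q.1.1) (q.2 - q.1.2)) * P q.1.1 q.1.2
  have hFm : AEStronglyMeasurable F (μ.prod volume) := by
    have h1 : Measurable (fun q : (ℝ × E3) × E3 =>
        heatKernel (T - t) (x' - q.2) * E (t - q.1.1, q.2 - q.1.2)) :=
      ((continuous_heatKernel hb).measurable.comp (by fun_prop)).mul
        (hEm.comp (Measurable.prodMk (by fun_prop) (by fun_prop)))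
    have h2 := h1.aestronglyMeasurable.mul (hPm.comp_fst (ν := (volume : Measure E3)))
    refine h2.congr ?_
    filter_upwards [Measure.quasiMeasurePreserving_fst.ae hmem] with q hq
    simp only [F, Pi.mul_apply]
    rw [hE _ (by linarith [hq.2])]
  have hFi : Integrable F (μ.prod volume) := by
    rw [integrable_prod_iff hFm]
    refine ⟨?_, ?_⟩
    · filter_upwards [hmem] with p hp
      have h := (hbound (t - p.1) (by linarith [hp.2]) p.2).1.mul_const (P p.1 p.2)
      exact h
    · have hdom : Integrable (fun p : ℝ × E3 =>
          |P p.1 p.2 * wt p.2| * (c₁ + c₂ * (t - p.1) ^ (-(1 / 2) : ℝ))) μ := by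
        rw [hμ, integrable_prod_iff]
        · refine ⟨?_, ?_⟩
          · filter_upwards [hP.prod_right_ae] with s hs
            exact hs.abs.mul_const _
          · have h1 := (hP.integral_norm_prod_left.const_mul c₁).add (hgood.const_mul c₂)
            refine h1.congr ?_
            filter_upwards [ae_restrict_mem measurableSet_Ioo] with s hs
            have hnn : 0 ≤ c₁ + c₂ * (t - s) ^ (-(1 / 2) : ℝ) := by
              have : 0 < t - s := by linarith [hs.2]
              positivity
            simp only [norm_mul, Real.norm_eq_abs, abs_abs, abs_mul, Pi.add_apply]
            rw [integral_mul_const, abs_of_nonneg hnn]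
            ring
        · refine hP.1.norm.mul (Measurable.aestronglyMeasurable ?_)
          fun_prop
      refine hdom.mono' hFm.norm.integral_prod_right' ?_
      filter_upwards [hmem] with p hp
      rw [Real.norm_of_nonneg (integral_nonneg fun _ => norm_nonneg _)]
      simp only [F, norm_mul, Real.norm_eq_abs]
      simp_rw [← abs_mul (heatKernel _ _)]
      rw [integral_mul_const]
      have h1 := (hbound (t - p.1) (by linarith [hp.2]) p.2).2
      calc _ ≤ (wt p.2 * (c₁ + c₂ * (t - p.1) ^ (-(1 / 2) : ℝ))) * |P p.1 p.2| := by gcongr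
        _ = _ := by rw [abs_mul, abs_of_pos (wt_pos p.2)]; ring
  have hx : (fun x => ∫ p, F (p, x) ∂μ) =ᵐ[volume] fun x => heatKernel (T - t) (x' - x) *
      ∫ s in Set.Ioo 0 t, ∫ y, oseenKernel j k l (t - s) (x - y) * P s y := by
    filter_upwards [hFi.prod_left_ae] with x hxi
    have hG := (heatKernel_pos hb (x' - x)).ne'
    have h1 : Integrable (fun p : ℝ × E3 => oseenKernel j k l (t - p.1) (x - p.2) * P p.1 p.2)
        μ := by
      refine (hxi.const_mul (heatKernel (T - t) (x' - x))⁻¹).congr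
        (Eventually.of_forall fun p => ?_)
      simp only [F]
      field_simp
    rw [← integral_prod (fun p : ℝ × E3 => oseenKernel j k l (t - p.1) (x - p.2) * P p.1 p.2) h1,
      ← integral_const_mul]
    simp only [F, mul_assoc]
    rfl
  have hp : (fun p => ∫ x, F (p, x)) =ᵐ[μ] fun p =>
      oseenKernel j k l (T - p.1) (x' - p.2) * P p.1 p.2 := by
    filter_upwards [hmem] with p hp
    simp only [F]
    rw [integral_mul_const, integral_heatKernel_mul_oseenKernel j k l (by linarith [hp.2]) hb]
    congr 2
    ring
  have hpi : Integrable (fun p : ℝ × E3 =>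
      oseenKernel j k l (T - p.1) (x' - p.2) * P p.1 p.2) μ := hFi.integral_prod_left.congr hp
  refine ⟨hFi.integral_prod_right.congr hx, hpi.integral_prod_left, ?_⟩
  rw [← integral_congr_ae hx, ← integral_prod (fun p : ℝ × E3 =>
    oseenKernel j k l (T - p.1) (x' - p.2) * P p.1 p.2) hpi, ← hμ, ← integral_congr_ae hp]
  exact (integral_integral_swap (f := fun p x => F (p, x)) hFi).symm

/-- The convolution of two integrable functions on the line exists almost everywhere; τ^{-1/2} is
integrable once cut off to (0, T). -/
lemma ae_integrableOn_mul_rpow {p : ℝ → ℝ} {T : ℝ} (hT : 0 < T) (hp : IntegrableOn p (Set.Ioo 0 T)) :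
    ∀ᵐ t ∂(volume.restrict (Set.Ioo 0 T)),
      IntegrableOn (fun s => p s * (t - s) ^ (-(1 / 2) : ℝ)) (Set.Ioo 0 t) := by
  have h1 : Integrable ((Set.Ioo 0 T).indicator p) := (integrable_indicator_iff measurableSet_Ioo).2 hp
  have h2 : Integrable ((Set.Ioo 0 T).indicator fun τ : ℝ => τ ^ (-(1 / 2) : ℝ)) :=
    (integrable_indicator_iff measurableSet_Ioo).2
      ((intervalIntegral.integrableOn_Ioo_rpow_iff hT).2 (by norm_num))
  have h3 := h1.ae_convolution_exists (ContinuousLinearMap.mul ℝ ℝ) h2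
  rw [ae_restrict_iff' measurableSet_Ioo]
  filter_upwards [h3] with t ht ht1
  have h4 : Integrable (fun s => (Set.Ioo 0 T).indicator p s *
    (Set.Ioo 0 T).indicator (fun τ : ℝ => τ ^ (-(1 / 2) : ℝ)) (t - s)) := ht
  refine h4.integrableOn.congr_fun (fun s hs => ?_) measurableSet_Ioo
  simp only
  rw [Set.indicator_of_mem (show s ∈ Set.Ioo 0 T from ⟨hs.1, hs.2.trans ht1.2⟩),
    Set.indicator_of_mem (show t - s ∈ Set.Ioo 0 T from
      ⟨by linarith [hs.2], by linarith [hs.1, ht1.2]⟩)]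

/-- If a Duhamel integral vanishes at all times, then its integrand vanishes. -/
theorem ae_kernel_eq_zero_of_duhamel (l : Fin 3) {P : Fin 3 → Fin 3 → ℝ → E3 → ℝ}
    (hP : ∀ T, 0 < T → ∀ j k, Integrable (fun p : ℝ × E3 => P j k p.1 p.2 * wt p.2)
      ((volume.restrict (Set.Ioo 0 T)).prod volume))
    (hB : ∀ t, 0 < t → ∀ᵐ x : E3, ∑ j, ∑ k, ∫ s in Set.Ioo 0 t, ∫ y,
      oseenKernel j k l (t - s) (x - y) * P j k s y = 0) {T : ℝ} (hT : 0 < T) (x' : E3) :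
    ∀ᵐ s ∂(volume.restrict (Set.Ioo 0 T)),
      ∑ j, ∑ k, ∫ y, oseenKernel j k l (T - s) (x' - y) * P j k s y = 0 := by
  apply ae_eq_zero_of_primitive
  have hgood : ∀ᵐ t ∂(volume.restrict (Set.Ioo 0 T)), ∀ j k,
      IntegrableOn (fun s => (∫ y, |P j k s y * wt y|) * (t - s) ^ (-(1 / 2) : ℝ))
        (Set.Ioo 0 t) := by
    rw [ae_all_iff]
    intro j
    rw [ae_all_iff]
    intro k
    exact ae_integrableOn_mul_rpow hT (hP T hT j k).integral_norm_prod_left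
  filter_upwards [hgood, ae_restrict_mem measurableSet_Ioo] with t hg ht
  have hreg := fun j k => duhamel_regularized j k l ht.2 x' (hP t ht.1 j k) (hg j k)
  have hb : 0 < T - t := by linarith [ht.2]
  refine ⟨integrable_finsetSum _ fun j _ => integrable_finsetSum _ fun k _ => (hreg j k).2.1, ?_⟩
  rw [integral_finsetSum _ fun j _ => integrable_finsetSum _ fun k _ => (hreg j k).2.1]
  simp_rw [integral_finsetSum _ fun k _ => (hreg _ k).2.1, ← (hreg _ _).2.2]
  simp_rw [← integral_finsetSum _ fun k _ => (hreg _ k).1]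
  rw [← integral_finsetSum _ fun j _ => integrable_finsetSum _ fun k _ => (hreg j k).1]
  refine integral_eq_zero_of_ae ?_
  filter_upwards [hB t ht.1] with x hx
  simp_rw [← Finset.mul_sum]
  rw [hx, mul_zero]
  rfl

/-! ### Weighted integrability of products -/

lemma abs_apply_mul_apply_le (a : E3) (j k : Fin 3) : |a j * a k| ≤ ‖a‖ ^ 2 := by
  rw [abs_mul, sq]
  exact mul_le_mul (abs_coord_le a j) (abs_coord_le a k) (abs_nonneg _) (norm_nonneg _)

lemma abs_mul_wt_le (a x : E3) (j k : Fin 3) :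
    ‖a j * a k * wt x‖ ≤ 4 * (‖a‖ ^ 2 / (1 + ‖x‖) ^ 4) := by
  rw [Real.norm_eq_abs, abs_mul, abs_of_pos (wt_pos x)]
  exact (mul_le_mul_of_nonneg_right (abs_apply_mul_apply_le a j k) (wt_nonneg x)).trans
    (norm_sq_le_of_weighted a x)

lemma aestronglyMeasurable_coord {X : Type*} [MeasurableSpace X] {μ : Measure X} {f : X → E3}
    (hf : AEStronglyMeasurable f μ) (j : Fin 3) : AEStronglyMeasurable (fun p => f p j) μ :=
  (EuclideanSpace.proj (𝕜 := ℝ) j).continuous.comp_aestronglyMeasurable hf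

lemma WeightedL2.integrable_sq_wt {v : E3 → E3} (hv : WeightedL2 v) :
    Integrable (fun x => ‖v x‖ ^ 2 * wt x) := by
  refine (hv.integrable.const_mul 4).mono'
    ((hv.aestronglyMeasurable.norm.pow 2).mul continuous_wt.aestronglyMeasurable)
    (Eventually.of_forall fun x => ?_)
  rw [Real.norm_of_nonneg (mul_nonneg (sq_nonneg _) (wt_nonneg x))]
  exact norm_sq_le_of_weighted _ _

lemma WeightedL2.integrable_mul_wt {v : E3 → E3} (hv : WeightedL2 v) (j k : Fin 3) :
    Integrable (fun x => v x j * v x k * wt x) :=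
  (hv.integrable.const_mul 4).mono'
    (((aestronglyMeasurable_coord hv.aestronglyMeasurable j).mul
      (aestronglyMeasurable_coord hv.aestronglyMeasurable k)).mul
      continuous_wt.aestronglyMeasurable)
    (Eventually.of_forall fun _ => abs_mul_wt_le _ _ _ _)

lemma WeightedL2.integrable_norm_wt {v : E3 → E3} (hv : WeightedL2 v) :
    Integrable (fun x => ‖v x‖ * wt x) := by
  refine (integrable_wt.add hv.integrable_sq_wt).mono'
    (hv.aestronglyMeasurable.norm.mul continuous_wt.aestronglyMeasurable)
    (Eventually.of_forall fun x => ?_)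
  rw [Real.norm_of_nonneg (mul_nonneg (norm_nonneg _) (wt_nonneg x))]
  have h := wt_pos x
  simp only [Pi.add_apply]
  nlinarith [sq_nonneg (‖v x‖ - 1), sq_nonneg ‖v x‖]

lemma WeightedL2.integrable_apply_wt {v : E3 → E3} (hv : WeightedL2 v) (l : Fin 3) :
    Integrable (fun x => v x l * wt x) := by
  refine hv.integrable_norm_wt.mono' ((aestronglyMeasurable_coord hv.aestronglyMeasurable l).mul
    continuous_wt.aestronglyMeasurable) (Eventually.of_forall fun x => ?_)
  rw [norm_mul, Real.norm_of_nonneg (wt_nonneg x)]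
  exact mul_le_mul_of_nonneg_right (abs_coord_le _ _) (wt_nonneg x)

lemma InPathSpace.integrable_mul_wt {u : ℝ → E3 → E3} (hu : InPathSpace u) (j k : Fin 3) {t : ℝ}
    (ht : 0 < t) : Integrable (fun p : ℝ × E3 => u p.1 p.2 j * u p.1 p.2 k * wt p.2)
      ((volume.restrict (Set.Ioo 0 t)).prod volume) := by
  have hle : (volume.restrict (Set.Ioo 0 t)).prod (volume : Measure E3) ≤
      (volume.restrict (Set.Ioi 0)).prod volume :=
    Measure.prod_mono (Measure.restrict_mono_set _ Set.Ioo_subset_Ioi_self) le_rfl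
  have hm := hu.aestronglyMeasurable.mono_measure hle
  exact ((hu.integrable t ht).const_mul 4).mono'
    (((aestronglyMeasurable_coord hm j).mul (aestronglyMeasurable_coord hm k)).mul
      (continuous_wt.comp continuous_snd).aestronglyMeasurable)
    (Eventually.of_forall fun p => abs_mul_wt_le _ _ _ _)

/-! ### Vanishing Duhamel integrals -/

lemma exists_seq_rat (s : ℝ) : ∃ q : ℕ → ℚ, (∀ n, s < q n) ∧ (∀ n, (q n : ℝ) - s ≤ 1) ∧
    Tendsto (fun n => (q n : ℝ) - s) atTop (𝓝 0) := by
  have h : ∀ n : ℕ, ∃ q : ℚ, s < q ∧ (q : ℝ) < s + 1 / ((n : ℝ) + 1) := fun n =>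
    exists_rat_btwn (lt_add_of_pos_right s Nat.one_div_pos_of_nat)
  choose q hq1 hq2 using h
  refine ⟨q, hq1, fun n => ?_, ?_⟩
  · have h1 : 1 / ((n : ℝ) + 1) ≤ 1 := by
      rw [div_le_one (by positivity)]
      linarith [Nat.cast_nonneg (α := ℝ) n]
    linarith [hq2 n]
  · exact squeeze_zero (fun n => by linarith [hq1 n]) (fun n => by linarith [hq2 n])
      tendsto_one_div_add_atTop_nhds_zero_nat

/-- Rational end times allow one null set of s to serve them all, so that an end time may later
approach s. -/
lemma ae_Ioi_of_forall_Ioo_rat {p : ℝ → ℚ → Prop}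
    (h : ∀ q : ℚ, 0 < (q : ℝ) → ∀ᵐ s ∂(volume.restrict (Set.Ioo 0 (q : ℝ))), p s q) :
    ∀ᵐ s ∂(volume.restrict (Set.Ioi (0 : ℝ))), ∀ q : ℚ, s < (q : ℝ) → p s q := by
  have h2 : ∀ᵐ s : ℝ ∂volume, ∀ q : ℚ, 0 < (q : ℝ) → s ∈ Set.Ioo 0 (q : ℝ) → p s q := by
    rw [ae_all_iff]
    intro q
    by_cases hq : 0 < (q : ℝ)
    · filter_upwards [(ae_restrict_iff' measurableSet_Ioo).1 (h q hq)] with s hs _ using hs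
    · exact Eventually.of_forall fun s hq' => absurd hq' hq
  filter_upwards [ae_restrict_of_ae h2, ae_restrict_mem measurableSet_Ioi] with s hs h0 q hq
  exact hs q (lt_trans h0 hq) ⟨h0, hq⟩

lemma ae_integrable_wt {P : ℝ → E3 → ℝ}
    (hP : ∀ T, 0 < T → Integrable (fun p : ℝ × E3 => P p.1 p.2 * wt p.2)
      ((volume.restrict (Set.Ioo 0 T)).prod volume)) :
    ∀ᵐ s ∂(volume.restrict (Set.Ioi (0 : ℝ))), Integrable (fun y => P s y * wt y) := by
  have := ae_Ioi_of_forall_Ioo_rat (p := fun s _ => Integrable (fun y => P s y * wt y) volume)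
    fun q hq => (hP (q : ℝ) hq).prod_right_ae
  filter_upwards [this] with s hs
  obtain ⟨q, hq, -⟩ := exists_seq_rat s
  exact hs _ (hq 0)

/-- For fixed end time and fixed point the integrand vanishes for a.e. s. Rational times and a dense
sequence of points keep the exceptions null; continuity in x recovers all points, and a = q - s with
rational q decreasing to s. -/
theorem ae_exists_seq_kernel_eq_zero (l : Fin 3) {P : Fin 3 → Fin 3 → ℝ → E3 → ℝ}
    (hP : ∀ T, 0 < T → ∀ j k, Integrable (fun p : ℝ × E3 => P j k p.1 p.2 * wt p.2)
      ((volume.restrict (Set.Ioo 0 T)).prod volume))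
    (hB : ∀ t, 0 < t → ∀ᵐ x : E3, ∑ j, ∑ k, ∫ s in Set.Ioo 0 t, ∫ y,
      oseenKernel j k l (t - s) (x - y) * P j k s y = 0) :
    ∀ᵐ s ∂(volume.restrict (Set.Ioi (0 : ℝ))), ∃ a : ℕ → ℝ, (∀ n, 0 < a n) ∧ (∀ n, a n ≤ 1) ∧
      Tendsto a atTop (𝓝 0) ∧
      ∀ n x, ∑ j, ∑ k, ∫ y, oseenKernel j k l (a n) (x - y) * P j k s y = 0 := by
  have h1 := ae_Ioi_of_forall_Ioo_rat (p := fun s q => ∀ i : ℕ,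
    ∑ j, ∑ k, ∫ y, oseenKernel j k l (q - s) (TopologicalSpace.denseSeq E3 i - y) * P j k s y = 0)
    fun q hq => by
      rw [ae_all_iff]
      exact fun i => ae_kernel_eq_zero_of_duhamel l hP hB hq _
  have h2 : ∀ᵐ s ∂(volume.restrict (Set.Ioi (0 : ℝ))), ∀ j k,
      Integrable (fun y => P j k s y * wt y) := by
    rw [ae_all_iff]; intro j
    rw [ae_all_iff]; intro k
    exact ae_integrable_wt fun T hT => hP T hT j k
  filter_upwards [h1, h2] with s hs1 hs2
  obtain ⟨q, hq0, hq1, hq2⟩ := exists_seq_rat s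
  have hpos : ∀ n, 0 < (q n : ℝ) - s := fun n => by linarith [hq0 n]
  refine ⟨fun n => q n - s, hpos, hq1, hq2, fun n x => ?_⟩
  have hc : Continuous fun x => ∑ j, ∑ k, ∫ y, oseenKernel j k l (q n - s) (x - y) * P j k s y :=
    continuous_finsetSum _ fun j _ => continuous_finsetSum _ fun k _ =>
      continuous_kernel_integral (continuous_oseenKernel j k l (hpos n))
        (abs_oseenKernel_le_wt j k l (hpos n)) (hs2 j k)
  exact congrFun ((TopologicalSpace.denseRange_denseSeq E3).equalizer hc
    (continuous_const (y := (0 : ℝ))) (funext fun i => hs1 _ (hq0 n) i)) x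

/-! ### The bilinear term along the heat flow -/

lemma continuous_oseenCv (j k l : Fin 3) (φ : 𝓢(E3, ℝ)) {a : ℝ} (ha : 0 < a) :
    Continuous (oseenCv j k l a φ) := by
  have h : oseenCv j k l a φ = fun x => ∫ y, oseenKernel j k l a (x - y) * φ y := by
    funext x
    rw [← integral_mul_oseenKernel j k l ha, ← integral_sub_left_eq_self _ volume x]
    simp [mul_comm]
  rw [h]
  exact continuous_kernel_integral (continuous_oseenKernel j k l ha)
    (abs_oseenKernel_le_wt j k l ha) (φ.integrable.mul_bdd (c := 1)
      continuous_wt.aestronglyMeasurable (Eventually.of_forall fun x => by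
        rw [Real.norm_of_nonneg (wt_nonneg x)]; exact wt_le_one x))

lemma aestronglyMeasurable_lerayDeriv (j k l : Fin 3) (φ : 𝓢(E3, ℝ)) :
    AEStronglyMeasurable (lerayDeriv j k l φ) := by
  obtain ⟨a, ha, -, ha0⟩ := exists_seq
  exact aestronglyMeasurable_of_tendsto_ae atTop
    (fun n => (continuous_oseenCv j k l φ (ha n)).aestronglyMeasurable)
    (Eventually.of_forall fun x => tendsto_oseenCv j k l φ x ha ha0)

lemma exists_heatKernel_le_wt {t : ℝ} (ht : 0 < t) : ∃ C, ∀ z, |heatKernel t z| ≤ C * wt z := by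
  obtain ⟨C, -, hC⟩ := schwartz_decay_wt (gauss t)
  rw [coe_gauss ht] at hC
  exact ⟨C, hC⟩

lemma integrable_heatKernel_mul {t : ℝ} (ht : 0 < t) {f : E3 → ℝ}
    (hf : Integrable (fun y => f y * wt y)) (x : E3) :
    Integrable (fun y => heatKernel t (x - y) * f y) := by
  obtain ⟨C, hC⟩ := exists_heatKernel_le_wt ht
  exact integrable_kernel_mul (continuous_heatKernel ht) hC hf x

lemma continuous_heat {t : ℝ} (ht : 0 < t) {f : E3 → ℝ}
    (hf : Integrable (fun y => f y * wt y)) : Continuous (heat t f) := by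
  obtain ⟨C, hC⟩ := exists_heatKernel_le_wt ht
  exact continuous_kernel_integral (continuous_heatKernel ht) hC hf

/-- Locally uniform domination in time for continuity of the heat flow; 8 = 4^{3/2} compares the
prefactors at t₀/2 and 2t₀. -/
lemma heatKernel_le_of_mem {t₀ t : ℝ} (ht₀ : 0 < t₀) (h1 : t₀ / 2 ≤ t) (h2 : t ≤ 2 * t₀) (z : E3) :
    heatKernel t z ≤ 8 * heatKernel (2 * t₀) z := by
  have ht : 0 < t := by linarith
  unfold heatKernel
  have h4 : (4 : ℝ) ^ (-(3 / 2) : ℝ) = 1 / 8 := by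
    rw [show (4 : ℝ) = 2 ^ (2 : ℝ) by norm_num, ← Real.rpow_mul (by norm_num)]
    norm_num
  have h3 : (4 * Real.pi * (2 * t₀)) ^ (-(3 / 2) : ℝ) =
      1 / 8 * (4 * Real.pi * (t₀ / 2)) ^ (-(3 / 2) : ℝ) := by
    rw [← h4, ← Real.mul_rpow (by norm_num) (by positivity)]
    congr 1; ring
  rw [h3]
  have h5 : (4 * Real.pi * t) ^ (-(3 / 2) : ℝ) ≤ (4 * Real.pi * (t₀ / 2)) ^ (-(3 / 2) : ℝ) :=
    Real.rpow_le_rpow_of_nonpos (by positivity) (by gcongr) (by norm_num)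
  have h6 : Real.exp (-(‖z‖ ^ 2) / (4 * t)) ≤ Real.exp (-(‖z‖ ^ 2) / (4 * (2 * t₀))) := by
    rw [Real.exp_le_exp, neg_div, neg_div, neg_le_neg_iff]
    gcongr
  calc _ ≤ (4 * Real.pi * (t₀ / 2)) ^ (-(3 / 2) : ℝ) * Real.exp (-(‖z‖ ^ 2) / (4 * (2 * t₀))) := by
        gcongr
    _ = _ := by ring

/-- Jensen's inequality for the probability density of the Gauss kernel, read off from the
nonnegative variance. -/
lemma sq_integral_heatKernel_mul_le {t : ℝ} (ht : 0 < t) {f : E3 → ℝ} (x : E3)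
    (h1 : Integrable (fun y => heatKernel t (x - y) * f y))
    (h2 : Integrable (fun y => heatKernel t (x - y) * f y ^ 2)) :
    (∫ y, heatKernel t (x - y) * f y) ^ 2 ≤ ∫ y, heatKernel t (x - y) * f y ^ 2 := by
  set g := ∫ y, heatKernel t (x - y) * f y with hg
  have h0 : Integrable (fun y => heatKernel t (x - y)) := (integrable_heatKernel ht).comp_sub_left x
  have hi : ∫ y, heatKernel t (x - y) = 1 := by
    rw [integral_sub_left_eq_self (heatKernel t) volume x, integral_heatKernel ht]
  have h : 0 ≤ ∫ y, heatKernel t (x - y) * (f y - g) ^ 2 :=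
    integral_nonneg fun y => mul_nonneg (heatKernel_pos ht _).le (sq_nonneg _)
  have he : ∀ y, heatKernel t (x - y) * (f y - g) ^ 2 = heatKernel t (x - y) * f y ^ 2 -
      2 * g * (heatKernel t (x - y) * f y) + g ^ 2 * heatKernel t (x - y) := fun y => by ring
  simp_rw [he] at h
  have h3 := h1.const_mul (2 * g)
  have h4 := h2.sub h3
  have h5 := h0.const_mul (g ^ 2)
  have h6 := integral_add h4 h5
  simp only [Pi.sub_apply] at h6
  rw [h6, integral_sub h2 h3, integral_const_mul, integral_const_mul, hi, ← hg] at h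
  linarith

lemma integrable_heat_mul_wt {t : ℝ} (ht : 0 < t) {f : E3 → ℝ}
    (hf : Integrable (fun y => f y * wt y)) :
    Integrable (fun x => heat t f x * wt x) := by
  have hm : AEStronglyMeasurable f := WtIntegrable.aestronglyMeasurable hf
  have hF : Integrable (fun p : E3 × E3 => heatKernel t (p.1 - p.2) * f p.2 * wt p.1) := by
    have hFm : AEStronglyMeasurable (fun p : E3 × E3 => heatKernel t (p.1 - p.2) * f p.2 * wt p.1) :=
      (((continuous_heatKernel ht).comp (by fun_prop)).aestronglyMeasurable.mul hm.comp_snd).mul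
        (continuous_wt.comp continuous_fst).aestronglyMeasurable
    have hx : ∀ y : E3, Integrable (fun x => heatKernel t (x - y) * wt x) ∧
        ∫ x, heatKernel t (x - y) * wt x ≤ 1536 * (1 + t) ^ 2 * wt y := by
      intro y
      obtain ⟨h1, h2⟩ := integral_heatKernel_mul_wt_le ht y
      have he : ∀ x, heatKernel t (x - y) * wt x = heatKernel t (y - x) * wt (y - (y - x)) := by
        intro x
        rw [← heatKernel_neg, neg_sub, sub_sub_cancel]
      simp_rw [he]
      exact ⟨h1.comp_sub_left y, by
        rwa [integral_sub_left_eq_self (fun z => heatKernel t z * wt (y - z)) volume y]⟩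
    rw [Measure.volume_eq_prod, integrable_prod_iff' hFm]
    refine ⟨Eventually.of_forall fun y => ?_, ?_⟩
    · refine ((hx y).1.mul_const (f y)).congr (Eventually.of_forall fun x => ?_)
      simp only
      ring
    · refine (hf.abs.const_mul (1536 * (1 + t) ^ 2)).mono' hFm.norm.prod_swap.integral_prod_right'
        (Eventually.of_forall fun y => ?_)
      rw [Real.norm_of_nonneg (integral_nonneg fun _ => norm_nonneg _)]
      have he : ∀ x, ‖heatKernel t (x - y) * f y * wt x‖ = heatKernel t (x - y) * wt x * |f y| := by
        intro x
        rw [norm_mul, norm_mul, Real.norm_of_nonneg (heatKernel_pos ht _).le,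
          Real.norm_of_nonneg (wt_nonneg x), Real.norm_eq_abs]
        ring
      simp_rw [he]
      rw [integral_mul_const, abs_mul, abs_of_pos (wt_pos y)]
      calc _ ≤ 1536 * (1 + t) ^ 2 * wt y * |f y| := by gcongr; exact (hx y).2
        _ = _ := by ring
  refine hF.integral_prod_left.congr (Eventually.of_forall fun x => ?_)
  simp only
  rw [integral_mul_const]
  rfl

lemma continuousAt_heat {f : E3 → ℝ} (hf : Integrable (fun y => f y * wt y)) {t₀ : ℝ}
    (ht₀ : 0 < t₀) (x : E3) : ContinuousAt (fun t => heat t f x) t₀ := by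
  unfold heat
  have hmem : ∀ᶠ t in 𝓝 t₀, t ∈ Set.Ioo (t₀ / 2) (2 * t₀) :=
    Ioo_mem_nhds (by linarith) (by linarith)
  refine continuousAt_of_dominated
    (bound := fun y => 8 * (heatKernel (2 * t₀) (x - y) * |f y|)) ?_ ?_ ?_ ?_
  · filter_upwards [hmem] with t ht
    exact (integrable_heatKernel_mul (by linarith [ht.1]) hf x).1
  · filter_upwards [hmem] with t ht
    refine Eventually.of_forall fun y => ?_
    rw [norm_mul, Real.norm_of_nonneg (heatKernel_pos (by linarith [ht.1]) _).le, Real.norm_eq_abs,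
      ← mul_assoc]
    gcongr
    exact heatKernel_le_of_mem ht₀ ht.1.le ht.2.le _
  · refine (integrable_heatKernel_mul (by positivity) (f := fun y => |f y|) ?_ x).const_mul 8
    refine hf.abs.congr (Eventually.of_forall fun y => ?_)
    simp only
    rw [abs_mul, abs_of_pos (wt_pos y)]
  · refine Eventually.of_forall fun y => ContinuousAt.mul ?_ continuousAt_const
    unfold heatKernel
    refine ContinuousAt.mul (ContinuousAt.rpow_const (by fun_prop) (Or.inl (by positivity))) ?_
    exact (continuousAt_const.div (by fun_prop) (by positivity)).rexp

/-- Near t₀ products of heat-flow components are dominated by 64 e^{2t₀Δ}|u₀|², by Jensen; this is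
integrable against the weight, hence against the symbol. -/
lemma continuousAt_lerayBilinear_heat {u₀ : E3 → E3} (h : WeightedL2 u₀) (l : Fin 3)
    (φ : 𝓢(E3, ℝ)) {t₀ : ℝ} (ht₀ : 0 < t₀) :
    ContinuousAt (fun t => lerayBilinear (heatVec t u₀) (heatVec t u₀) l φ) t₀ := by
  unfold lerayBilinear
  have hmem : ∀ᶠ t in 𝓝 t₀, t ∈ Set.Ioo (t₀ / 2) (2 * t₀) :=
    Ioo_mem_nhds (by linarith) (by linarith)
  have hsum : ∀ {g : Fin 3 → Fin 3 → ℝ → ℝ}, (∀ j k, ContinuousAt (g j k) t₀) →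
      ContinuousAt (fun t => -∑ j, ∑ k, g j k t) t₀ := fun hg =>
    (tendsto_finsetSum _ fun j _ => tendsto_finsetSum _ fun k _ => hg j k).neg
  refine hsum fun j k => ?_
  have h2 : 0 < 2 * t₀ := by positivity
  obtain ⟨C, hC⟩ := exists_abs_lerayDeriv_le j k l φ
  have hn := h.integrable_norm_wt
  have hs := h.integrable_sq_wt
  have hbd : ∀ t ∈ Set.Ioo (t₀ / 2) (2 * t₀), ∀ x i, |heatVec t u₀ x i| ≤
      8 * ∫ y, heatKernel (2 * t₀) (x - y) * ‖u₀ y‖ := by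
    intro t ht x i
    have hi := integrable_heatKernel_mul h2 hn x
    rw [← integral_const_mul]
    change |∫ y, heatKernel t (x - y) * u₀ y i| ≤ _
    refine abs_integral_le_of_abs_le (hi.const_mul 8) fun y => ?_
    rw [abs_mul, abs_of_pos (heatKernel_pos (by linarith [ht.1]) _), ← mul_assoc]
    exact mul_le_mul (heatKernel_le_of_mem ht₀ ht.1.le ht.2.le _) (abs_coord_le _ _)
      (abs_nonneg _) (mul_nonneg (by norm_num) (heatKernel_pos h2 _).le)
  refine continuousAt_of_dominated (bound := fun x => 64 * C *
    (heat (2 * t₀) (fun y => ‖u₀ y‖ ^ 2) x * wt x)) ?_ ?_ ?_ ?_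
  · filter_upwards [hmem] with t ht
    have h0 : 0 < t := by linarith [ht.1]
    exact ((continuous_heat h0 (h.integrable_apply_wt j)).mul
      (continuous_heat h0 (h.integrable_apply_wt k))).aestronglyMeasurable.mul
      (aestronglyMeasurable_lerayDeriv j k l φ)
  · filter_upwards [hmem] with t ht
    refine Eventually.of_forall fun x => ?_
    have hsq := sq_integral_heatKernel_mul_le h2 (f := fun y => ‖u₀ y‖) x
      (integrable_heatKernel_mul h2 hn x) (integrable_heatKernel_mul h2 hs x)
    set g := ∫ y, heatKernel (2 * t₀) (x - y) * ‖u₀ y‖ with hg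
    have hg0 : 0 ≤ g := integral_nonneg fun y => mul_nonneg (heatKernel_pos h2 _).le (norm_nonneg _)
    have hC0 : 0 ≤ C * wt x := (abs_nonneg _).trans (hC x)
    rw [norm_mul, norm_mul]
    simp only [Real.norm_eq_abs]
    calc _ ≤ (8 * g) * (8 * g) * (C * wt x) := by
          gcongr
          · exact hbd t ht x j
          · exact hbd t ht x k
          · exact hC x
      _ = 64 * (g ^ 2 * (C * wt x)) := by ring
      _ ≤ 64 * (heat (2 * t₀) (fun y => ‖u₀ y‖ ^ 2) x * (C * wt x)) := by
          gcongr
          exact hsq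
      _ = _ := by ring
  · exact (integrable_heat_mul_wt h2 hs).const_mul _
  · refine Eventually.of_forall fun x => ?_
    exact ((continuousAt_heat (h.integrable_apply_wt j) ht₀ x).mul
      (continuousAt_heat (h.integrable_apply_wt k) ht₀ x)).mul continuousAt_const

lemma eq_zero_of_ae_of_continuousAt {g : ℝ → ℝ}
    (h : ∀ᵐ s ∂(volume.restrict (Set.Ioi (0 : ℝ))), g s = 0) {t : ℝ} (ht : 0 < t)
    (hg : ContinuousAt g t) : g t = 0 := by
  by_contra hne
  have h1 : {s | g s ≠ 0 ∧ 0 < s} ∈ 𝓝 t :=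
    (hg.eventually_ne hne).and (Ioi_mem_nhds ht)
  have h2 := Measure.measure_pos_of_mem_nhds volume h1
  rw [ae_restrict_iff' measurableSet_Ioi] at h
  refine h2.ne' (measure_mono_null (fun s hs => ?_) h)
  simp only [Set.mem_ofPred_eq, Set.mem_compl_iff, Set.mem_Ioi] at hs ⊢
  exact fun h3 => hs.1 (h3 hs.2)

lemma lerayBilinear_congr {v w : E3 → E3} (h : v =ᵐ[volume] w) (l : Fin 3) (φ : 𝓢(E3, ℝ)) :
    lerayBilinear v v l φ = lerayBilinear w w l φ := by
  unfold lerayBilinear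
  congr 1
  refine Finset.sum_congr rfl fun j _ => Finset.sum_congr rfl fun k _ => integral_congr_ae ?_
  filter_upwards [h] with x hx
  rw [hx]

/-- If the nonlinear term of a mild solution vanishes, then its datum is of Beltrami type. -/
theorem IsMildSolution.isBeltramiType {u₀ : E3 → E3} {u : ℝ → E3 → E3} (hu : IsMildSolution u₀ u)
    (h : ∀ l t, 0 < t → ∀ᵐ x : E3, duhamel u u t x l = 0) : IsBeltramiType u₀ := by
  refine ⟨hu.data_solenoidal, fun t ht l φ => ?_⟩
  have h1 := ae_exists_seq_kernel_eq_zero l (P := fun j k s y => u s y j * u s y k)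
    (fun T hT j k => hu.inPathSpace.integrable_mul_wt j k hT) (fun t ht => h l t ht)
  refine eq_zero_of_ae_of_continuousAt
    (g := fun t => lerayBilinear (heatVec t u₀) (heatVec t u₀) l φ) ?_ ht
    (continuousAt_lerayBilinear_heat hu.data_weightedL2 l φ ht)
  filter_upwards [h1, ae_restrict_mem measurableSet_Ioi] with s hs hs0
  obtain ⟨a, ha, ha1, ha0, hz⟩ := hs
  have h2 : u s =ᵐ[volume] heatVec s u₀ := by
    have h3 : ∀ᵐ x : E3, ∀ l, duhamel u u s x l = 0 := ae_all_iff.2 fun l => h l s hs0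
    filter_upwards [hu.integral_equation s hs0, h3] with x hx hx'
    rw [hx]
    ext i
    simp [hx' i]
  rw [← lerayBilinear_congr h2]
  unfold lerayBilinear
  rw [sum_integral_lerayDeriv_eq_zero l (P := fun j k y => u s y j * u s y k)
    (fun j k => (hu.inPathSpace.weightedL2 s hs0).integrable_mul_wt j k) ha ha1 ha0 hz φ, neg_zero]

lemma heatVec_const {u₀ : E3 → E3} {c : E3} (h : ∀ᵐ x, u₀ x = c) {t : ℝ} (ht : 0 < t) (x : E3) :
    heatVec t u₀ x = c := by
  ext l
  change ∫ y, heatKernel t (x - y) * u₀ y l = c l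
  rw [integral_congr_ae (g := fun y => heatKernel t (x - y) * c l)
    (by filter_upwards [h] with y hy; rw [hy]), integral_mul_const,
    integral_sub_left_eq_self (heatKernel t) volume x, integral_heatKernel ht, one_mul]

lemma isBeltramiType_of_const {u₀ : E3 → E3} (hs : IsSolenoidal u₀) {c : E3}
    (h : ∀ᵐ x, u₀ x = c) : IsBeltramiType u₀ := by
  refine ⟨hs, fun t ht l φ => ?_⟩
  unfold lerayBilinear
  simp_rw [heatVec_const h ht, integral_const_mul, integral_lerayDeriv]
  simp

/-! ### Characters of the reflection group -/

lemma reflectSign_add (α α' β : Fin 3 → ZMod 2) :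
    reflectSign (α + α') β = reflectSign α β * reflectSign α' β := by
  unfold reflectSign
  rw [← Finset.prod_mul_distrib]
  refine Finset.prod_congr rfl fun i _ => ?_
  rw [Pi.add_apply, ZMod.val_add, pow_mul, ← neg_one_pow_eq_pow_mod_two, ← pow_mul, add_mul, pow_add]

lemma reflectSign_zero (β : Fin 3 → ZMod 2) : reflectSign 0 β = 1 := by
  simp [reflectSign]

lemma reflectSign_mul_self (α β : Fin 3 → ZMod 2) : reflectSign α β * reflectSign α β = 1 := by
  rw [← reflectSign_add, CharTwo.add_self_eq_zero, reflectSign_zero]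

lemma reflectSign_basicType (j : Fin 3) (β : Fin 3 → ZMod 2) :
    reflectSign (basicType j) β = (-1) ^ (β j).val := by
  unfold reflectSign basicType
  rw [Finset.prod_eq_single j]
  · simp [ZMod.val_one]
  · intro i _ hi
    simp [hi]
  · simp

/-- Orthogonality of the characters of (ℤ/2)³; the sum factorizes over the coordinates. -/
lemma sum_reflectSign (α : Fin 3 → ZMod 2) :
    ∑ β, reflectSign α β = if α = 0 then 8 else 0 := by
  have h1 : ∀ a : ZMod 2, ∑ b : ZMod 2, (-1 : ℝ) ^ (a.val * b.val) = if a = 0 then 2 else 0 := by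
    intro a
    rw [show (Finset.univ : Finset (ZMod 2)) = {0, 1} from rfl, Finset.sum_pair zero_ne_one]
    obtain rfl | rfl : a = 0 ∨ a = 1 := by revert a; decide
    · norm_num
    · simp [ZMod.val_one]
  have h2 := Finset.prod_univ_sum (fun _ : Fin 3 => (Finset.univ : Finset (ZMod 2)))
    (fun i b => (-1 : ℝ) ^ ((α i).val * b.val))
  rw [Fintype.piFinset_univ] at h2
  unfold reflectSign
  rw [← h2]
  simp_rw [h1]
  split_ifs with h
  · subst h
    simp
    norm_num
  · obtain ⟨i, hi⟩ := Function.ne_iff.1 h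
    exact Finset.prod_eq_zero (Finset.mem_univ i) (if_neg hi)

lemma sum_reflectSign_mul {α δ : Fin 3 → ZMod 2} :
    ∑ β, reflectSign δ β * reflectSign α β = if α = δ then 8 else 0 := by
  simp_rw [← reflectSign_add, sum_reflectSign]
  simp_rw [CharTwo.add_eq_zero, eq_comm]

/-- Comparison of isotypical components. -/
lemma sum_eq_zero_of_characters {ι : Type*} [Fintype ι] {c : ι → ℝ} {a : ι → Fin 3 → ZMod 2}
    (h : ∀ β, ∑ i, reflectSign (a i) β * c i = 0) (δ : Fin 3 → ZMod 2) :
    ∑ i, (if a i = δ then c i else 0) = 0 := by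
  have h1 : ∑ β, reflectSign δ β * ∑ i, reflectSign (a i) β * c i = 0 :=
    Finset.sum_eq_zero fun β _ => by rw [h, mul_zero]
  simp_rw [Finset.mul_sum, ← mul_assoc] at h1
  rw [Finset.sum_comm] at h1
  simp_rw [← Finset.sum_mul, sum_reflectSign_mul] at h1
  have h2 : ∀ i, (if a i = δ then (8 : ℝ) else 0) * c i = 8 * (if a i = δ then c i else 0) := by
    intro i; split_ifs <;> simp
  simp_rw [h2, ← Finset.mul_sum] at h1
  linarith

/-! ### Reflections -/

lemma reflect_apply (β : Fin 3 → ZMod 2) (x : E3) (i : Fin 3) :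
    reflect β x i = reflectSign (basicType i) β * x i := by
  rw [reflectSign_basicType]
  rfl

lemma reflect_reflect (β : Fin 3 → ZMod 2) (x : E3) : reflect β (reflect β x) = x := by
  ext i
  rw [reflect_apply, reflect_apply, ← mul_assoc, reflectSign_mul_self, one_mul]

lemma reflect_sub (β : Fin 3 → ZMod 2) (x y : E3) :
    reflect β (x - y) = reflect β x - reflect β y := by
  ext i
  simp only [reflect_apply, PiLp.sub_apply]
  ring

lemma norm_reflect (β : Fin 3 → ZMod 2) (x : E3) : ‖reflect β x‖ = ‖x‖ := by
  rw [EuclideanSpace.norm_eq, EuclideanSpace.norm_eq]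
  congr 1
  refine Finset.sum_congr rfl fun i _ => ?_
  rw [reflect_apply, norm_mul, mul_pow, ← norm_pow, sq, reflectSign_mul_self, norm_one, one_mul]

/-- A reflection as a linear isometry. -/
def reflectIso (β : Fin 3 → ZMod 2) : E3 ≃ₗᵢ[ℝ] E3 where
  toFun := reflect β
  invFun := reflect β
  left_inv := reflect_reflect β
  right_inv := reflect_reflect β
  map_add' x y := by
    ext i
    simp only [reflect_apply, PiLp.add_apply]
    ring
  map_smul' c x := by
    ext i
    simp only [reflect_apply, PiLp.smul_apply, RingHom.id_apply, smul_eq_mul]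
    ring
  norm_map' := norm_reflect β

lemma measurePreserving_reflect (β : Fin 3 → ZMod 2) :
    MeasurePreserving (reflect β) (volume : Measure E3) volume :=
  (reflectIso β).measurePreserving

lemma integral_reflect (β : Fin 3 → ZMod 2) (f : E3 → ℝ) :
    ∫ x, f (reflect β x) = ∫ x, f x :=
  (measurePreserving_reflect β).integral_comp
    (reflectIso β).toHomeomorph.measurableEmbedding f

lemma reflect_basisVec (β : Fin 3 → ZMod 2) (j : Fin 3) :
    reflect β (EuclideanSpace.single j 1) =
      reflectSign (basicType j) β • (EuclideanSpace.single j 1 : E3) := by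
  ext i
  rw [reflect_apply]
  by_cases h : i = j
  · subst h; simp
  · simp [h]

lemma heatKernel_reflect (β : Fin 3 → ZMod 2) (t : ℝ) (x : E3) :
    heatKernel t (reflect β x) = heatKernel t x := by
  unfold heatKernel
  rw [norm_reflect]

lemma kron_mul_reflectSign (β : Fin 3 → ZMod 2) (j k : Fin 3) :
    kron j k * (reflectSign (basicType j) β * reflectSign (basicType k) β) = kron j k := by
  unfold kron
  split_ifs with h
  · rw [h, reflectSign_mul_self, one_mul]
  · simp

lemma reflectSign_three (β : Fin 3 → ZMod 2) (j k l : Fin 3) :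
    reflectSign (basicType j + basicType k + basicType l) β = reflectSign (basicType j) β *
      reflectSign (basicType k) β * reflectSign (basicType l) β := by
  rw [reflectSign_add, reflectSign_add]

/-- A Kronecker term is nonzero only when its two indices agree, and then their two signs cancel; so
all terms have the parity of x_j x_k x_l. -/
lemma gaussD3_reflect (β : Fin 3 → ZMod 2) (j k l : Fin 3) (t : ℝ) (x : E3) :
    gaussD3 j k l t (reflect β x) =
      reflectSign (basicType j + basicType k + basicType l) β * gaussD3 j k l t x := by
  unfold gaussD3
  rw [heatKernel_reflect, reflectSign_three, reflect_apply, reflect_apply, reflect_apply]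
  have h1 := kron_mul_reflectSign β j k
  have h2 := kron_mul_reflectSign β j l
  have h3 := kron_mul_reflectSign β k l
  generalize reflectSign (basicType j) β = a at *
  generalize reflectSign (basicType k) β = b at *
  generalize reflectSign (basicType l) β = c at *
  linear_combination (-(c * x l) / (4 * t ^ 2) * heatKernel t x) * h1 +
    (-(b * x k) / (4 * t ^ 2) * heatKernel t x) * h2 +
    (-(a * x j) / (4 * t ^ 2) * heatKernel t x) * h3

lemma oseenKernel_reflect (β : Fin 3 → ZMod 2) (j k l : Fin 3) {t : ℝ} (ht : 0 < t) (x : E3) :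
    oseenKernel j k l t (reflect β x) =
      reflectSign (basicType j + basicType k + basicType l) β * oseenKernel j k l t x := by
  rw [oseenKernel_eq j k l ht, oseenKernel_eq j k l ht]
  simp_rw [gaussD3_reflect]
  rw [integral_const_mul, partialDeriv_heatKernel, partialDeriv_heatKernel, heatKernel_reflect,
    reflectSign_three, reflect_apply]
  have h3 := kron_mul_reflectSign β k l
  generalize reflectSign (basicType j) β = a at *
  generalize reflectSign (basicType k) β = b at *
  generalize reflectSign (basicType l) β = c at *
  generalize ∫ σ in Set.Ioi (0 : ℝ), gaussD3 j k l (σ + t) x = I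
  linear_combination (a * x j / (2 * t) * heatKernel t x) * h3

/-! ### Symmetries of functions -/

lemma HasSymmetry.congr {f g : E3 → ℝ} {α : Fin 3 → ZMod 2} (hf : HasSymmetry f α)
    (h : f =ᵐ[volume] g) : HasSymmetry g α := by
  intro β
  filter_upwards [hf β, h, (measurePreserving_reflect β).quasiMeasurePreserving.ae h]
    with x h1 h2 h3
  rw [← h2, ← h3, h1]

lemma HasSymmetry.mul {f g : E3 → ℝ} {α α' : Fin 3 → ZMod 2} (hf : HasSymmetry f α)
    (hg : HasSymmetry g α') : HasSymmetry (fun x => f x * g x) (α + α') := by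
  intro β
  filter_upwards [hf β, hg β] with x h1 h2
  rw [h1, h2, reflectSign_add]
  ring

lemma HasSymmetry.sub {f g : E3 → ℝ} {α : Fin 3 → ZMod 2} (hf : HasSymmetry f α)
    (hg : HasSymmetry g α) : HasSymmetry (fun x => f x - g x) α := by
  intro β
  filter_upwards [hf β, hg β] with x h1 h2
  rw [h1, h2]
  ring

lemma HasSymmetry.sum {ι : Type*} {s : Finset ι} {f : ι → E3 → ℝ} {α : Fin 3 → ZMod 2}
    (hf : ∀ i ∈ s, HasSymmetry (f i) α) : HasSymmetry (fun x => ∑ i ∈ s, f i x) α := by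
  intro β
  have : ∀ᵐ x : E3, ∀ i ∈ s, f i (reflect β x) = reflectSign α β * f i x :=
    (ae_ball_iff s.countable_toSet).2 fun i hi => hf i hi β
  filter_upwards [this] with x hx
  rw [Finset.mul_sum]
  exact Finset.sum_congr rfl hx

lemma HasSymmetryType.congr {v w : E3 → E3} {α : Fin 3 → Fin 3 → ZMod 2}
    (hv : HasSymmetryType v α) (h : v =ᵐ[volume] w) : HasSymmetryType w α := fun l =>
  (hv l).congr (by filter_upwards [h] with x hx; rw [hx])

/-- Components of a different symmetry cancel. -/
lemma ae_sum_eq_zero_of_hasSymmetry {ι : Type*} [Fintype ι] {f : ι → E3 → ℝ}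
    {a : ι → Fin 3 → ZMod 2} (hf : ∀ i, HasSymmetry (f i) (a i)) {α δ : Fin 3 → ZMod 2}
    (h : HasSymmetry (fun x => ∑ i, f i x) α) (hδ : δ ≠ α) :
    ∀ᵐ x, ∑ i, (if a i = δ then f i x else 0) = 0 := by
  have h1 : ∀ᵐ x, ∀ β, ∀ i, f i (reflect β x) = reflectSign (a i) β * f i x :=
    ae_all_iff.2 fun β => ae_all_iff.2 fun i => hf i β
  have h2 : ∀ᵐ x, ∀ β, ∑ i, f i (reflect β x) = reflectSign α β * ∑ i, f i x :=
    ae_all_iff.2 fun β => h β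
  filter_upwards [h1, h2] with x hx1 hx2
  -- The extra index carries minus the whole sum with the character α; since δ ≠ α it does not enter
  -- the δ-component.
  have h3 := sum_eq_zero_of_characters (ι := Option ι)
    (c := fun o => o.elim (-∑ i, f i x) (fun i => f i x)) (a := fun o => o.elim α a)
    (fun β => by
      have h4 := hx2 β
      simp_rw [hx1] at h4
      simp [Fintype.sum_option, h4]) δ
  simp only [Fintype.sum_option, Option.elim_none, hδ.symm, if_false, zero_add,
    Option.elim_some] at h3
  exact (Finset.sum_congr rfl fun i _ => by by_cases hi : a i = δ <;> simp [hi]).trans h3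

lemma integral_reflect_kernel {K : E3 → ℝ} {κ α β : Fin 3 → ZMod 2} {f : E3 → ℝ}
    (hK : ∀ x, K (reflect β x) = reflectSign κ β * K x) (hf : HasSymmetry f α) (x : E3) :
    ∫ y, K (reflect β x - y) * f y = reflectSign (κ + α) β * ∫ y, K (x - y) * f y := by
  rw [← integral_reflect β, ← integral_const_mul]
  refine integral_congr_ae ?_
  filter_upwards [hf β] with y hy
  rw [← reflect_sub, hK, hy, reflectSign_add]
  ring

lemma HasSymmetry.heat {f : E3 → ℝ} {α : Fin 3 → ZMod 2} (hf : HasSymmetry f α) (t : ℝ) :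
    HasSymmetry (heat t f) α := by
  intro β
  refine Eventually.of_forall fun x => ?_
  have := integral_reflect_kernel (K := heatKernel t) (κ := 0) (β := β)
    (fun x => by rw [heatKernel_reflect, reflectSign_zero, one_mul]) hf x
  rwa [zero_add] at this

lemma HasSymmetry.duhamel {j k l : Fin 3} {f : ℝ → E3 → ℝ} {α : Fin 3 → ZMod 2} {t : ℝ}
    (hf : ∀ s ∈ Set.Ioo 0 t, HasSymmetry (f s) α) :
    HasSymmetry (fun x => ∫ s in Set.Ioo 0 t, ∫ y, oseenKernel j k l (t - s) (x - y) * f s y)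
      (basicType j + basicType k + basicType l + α) := by
  intro β
  refine Eventually.of_forall fun x => ?_
  simp only
  rw [← integral_const_mul]
  refine setIntegral_congr_fun measurableSet_Ioo fun s hs => ?_
  exact integral_reflect_kernel (fun x => oseenKernel_reflect β j k l (by linarith [hs.2]) x)
    (hf s hs) x

/-! ### Symmetries and the divergence -/

/-- Composition of a test function with a reflection. -/
def reflectTest (β : Fin 3 → ZMod 2) (φ : 𝓢(E3, ℝ)) : 𝓢(E3, ℝ) :=
  SchwartzMap.compCLMOfContinuousLinearEquiv ℝ (reflectIso β).toContinuousLinearEquiv φ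

lemma coe_reflectTest (β : Fin 3 → ZMod 2) (φ : 𝓢(E3, ℝ)) :
    (reflectTest β φ : E3 → ℝ) = fun x => φ (reflect β x) := rfl

lemma partialDeriv_reflectTest (β : Fin 3 → ZMod 2) (φ : 𝓢(E3, ℝ)) (l : Fin 3) (x : E3) :
    partialDeriv l (reflectTest β φ) x =
      reflectSign (basicType l) β * partialDeriv l φ (reflect β x) := by
  unfold partialDeriv
  have h : fderiv ℝ (reflectTest β φ) x =
      (fderiv ℝ φ (reflect β x)).comp ((reflectIso β).toContinuousLinearEquiv : E3 →L[ℝ] E3) :=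
    (reflectIso β).toContinuousLinearEquiv.comp_right_fderiv
  rw [h]
  change fderiv ℝ φ (reflect β x) (reflect β (EuclideanSpace.single l 1)) = _
  rw [reflect_basisVec, map_smul, smul_eq_mul]

lemma integrable_mul_partialDeriv {f : E3 → ℝ} (hf : Integrable (fun y => f y * wt y)) (l : Fin 3)
    (φ : 𝓢(E3, ℝ)) : Integrable (fun y => f y * partialDeriv l φ y) := by
  obtain ⟨C, -, hC⟩ := schwartz_decay_wt (pd l φ)
  rw [← coe_pd]
  refine (hf.abs.const_mul C).mono' ((WtIntegrable.aestronglyMeasurable hf).mul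
    (pd l φ).continuous.aestronglyMeasurable) (Eventually.of_forall fun y => ?_)
  rw [Real.norm_eq_abs, abs_mul, abs_mul, abs_of_pos (wt_pos y)]
  calc _ ≤ |f y| * (C * wt y) := by gcongr; exact hC y
    _ = _ := by ring

lemma IsSolenoidal.sum_integral {v : E3 → E3} (hv : WeightedL2 v) (h : IsSolenoidal v)
    (φ : 𝓢(E3, ℝ)) : ∑ l, ∫ x, v x l * partialDeriv l φ x = 0 := by
  rw [← integral_finsetSum _ fun l _ => integrable_mul_partialDeriv (hv.integrable_apply_wt l) l φ]
  exact h φ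

/-- The distribution ∂_l v_l has symmetry α_l + e_l. If this character occurs for l = r only, the
r-th summand of the divergence vanishes by itself. -/
lemma IsSolenoidal.integral_partialDeriv_eq_zero {v : E3 → E3} (hv : WeightedL2 v)
    (h : IsSolenoidal v) {α : Fin 3 → Fin 3 → ZMod 2} (hα : HasSymmetryType v α) {r : Fin 3}
    (hr : ∀ l, l ≠ r → α l + basicType l ≠ α r + basicType r) (φ : 𝓢(E3, ℝ)) :
    ∫ x, v x r * partialDeriv r φ x = 0 := by
  have h1 := sum_eq_zero_of_characters (c := fun l => ∫ x, v x l * partialDeriv l φ x)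
    (a := fun l => α l + basicType l) (fun β => ?_) (α r + basicType r)
  · rw [Finset.sum_eq_single r] at h1
    · simpa using h1
    · exact fun l _ hl => if_neg (hr l hl)
    · simp
  -- Testing the divergence with the reflected function multiplies the l-th summand by the sign of
  -- its character.
  · rw [← h.sum_integral hv (reflectTest β φ)]
    refine Finset.sum_congr rfl fun l _ => ?_
    rw [← integral_reflect β (fun x => v x l * partialDeriv l (reflectTest β φ) x),
      ← integral_const_mul]
    refine integral_congr_ae ?_
    filter_upwards [hα l β] with x hx
    rw [hx, partialDeriv_reflectTest, reflect_reflect, reflectSign_add]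
    ring

/-! ### Functions with a vanishing derivative -/

/-- Translation of a test function. -/
def translateTest (c : E3) (φ : 𝓢(E3, ℝ)) : 𝓢(E3, ℝ) := reflTrans c (reflTrans 0 φ)

lemma partialDeriv_translateTest (c : E3) (φ : 𝓢(E3, ℝ)) (r : Fin 3) (x : E3) :
    partialDeriv r (translateTest c φ) x = partialDeriv r φ (x - c) := by
  unfold translateTest
  have h : ∀ (a : E3) (ψ : 𝓢(E3, ℝ)) (y : E3),
      partialDeriv r (reflTrans a ψ) y = -partialDeriv r ψ (a - y) :=
    fun a ψ y => partialDeriv_comp_sub r ψ a y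
  rw [h, h, neg_neg, zero_sub, neg_sub]

lemma locallyIntegrable_of_wt {f : E3 → ℝ} (hf : Integrable (fun y => f y * wt y)) :
    LocallyIntegrable f := by
  have h := (locallyIntegrableOn_univ.2 hf.locallyIntegrable).mul_continuousOn
    (continuous_wt.inv₀ fun y => (wt_pos y).ne').continuousOn isOpen_univ.isLocallyClosed
  rw [locallyIntegrableOn_univ] at h
  refine h.congr (Eventually.of_forall fun y => ?_)
  have := (wt_pos y).ne'
  simp only [Pi.inv_apply]
  field_simp

/-- The derivative in the translation parameter is minus the pairing of f with ∂_r of a translated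
test function, hence zero. -/
lemma integral_translateTest_eq {f : E3 → ℝ} (hf : Integrable (fun y => f y * wt y)) {r : Fin 3}
    (h0 : ∀ φ : 𝓢(E3, ℝ), ∫ y, f y * partialDeriv r φ y = 0) (φ : 𝓢(E3, ℝ)) (h : ℝ) :
    ∫ y, f y * φ (y - EuclideanSpace.single r h) = ∫ y, f y * φ y := by
  set e : E3 := EuclideanSpace.single r 1 with he
  obtain ⟨C, hC0, hC⟩ := schwartz_decay_wt φ
  obtain ⟨C', hC0', hC'⟩ := schwartz_decay_wt (pd r φ)
  rw [coe_pd] at hC'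
  have hm : AEStronglyMeasurable f := WtIntegrable.aestronglyMeasurable hf
  have hb : ∀ {K : E3 → ℝ} {D : ℝ}, (∀ x, |K x| ≤ D * wt x) → ∀ s₀ s : ℝ, |s - s₀| < 1 → ∀ y,
      ‖f y * K (y - s • e)‖ ≤ D * (4 * (1 + (|s₀| + 1) ^ 2) ^ 2) * |f y * wt y| := by
    intro K D hK s₀ s hs y
    have hD : 0 ≤ D := nonneg_of_mul_nonneg_left ((abs_nonneg _).trans (hK 0)) (wt_pos 0)
    have hse : ‖s • e‖ ≤ |s₀| + 1 := by
      rw [norm_smul, he, PiLp.norm_single, norm_one, mul_one, Real.norm_eq_abs]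
      have := abs_sub_abs_le_abs_sub s s₀
      linarith
    rw [Real.norm_eq_abs, abs_mul, abs_mul, abs_of_pos (wt_pos y)]
    calc |f y| * |K (y - s • e)| ≤ |f y| * (D * wt (y - s • e)) := by gcongr; exact hK _
      _ ≤ |f y| * (D * (4 * (1 + (|s₀| + 1) ^ 2) ^ 2 * wt y)) := by
          gcongr
          refine (wt_sub_le y (s • e)).trans ?_
          have := wt_nonneg y
          gcongr
      _ = _ := by ring
  have hd : ∀ s₀ : ℝ, HasDerivAt (fun s : ℝ => ∫ y, f y * φ (y - s • e)) 0 s₀ := by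
    intro s₀
    have key := (hasDerivAt_integral_of_dominated_loc_of_deriv_le (μ := (volume : Measure E3))
      (F := fun s y => f y * φ (y - s • e)) (F' := fun s y => f y * -partialDeriv r φ (y - s • e))
      (bound := fun y => C' * (4 * (1 + (|s₀| + 1) ^ 2) ^ 2) * |f y * wt y|)
      (Metric.ball_mem_nhds s₀ one_pos) ?_ ?_ ?_ ?_ ?_ ?_).2
    · have hz : ∫ y, f y * -partialDeriv r φ (y - s₀ • e) = 0 := by
        simp_rw [← partialDeriv_translateTest, mul_neg]
        rw [integral_neg, h0, neg_zero]
      rwa [hz] at key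
    · exact Eventually.of_forall fun s =>
        hm.mul (φ.continuous.comp (by fun_prop)).aestronglyMeasurable
    · exact (hf.abs.const_mul _).mono' (hm.mul (φ.continuous.comp (by fun_prop)).aestronglyMeasurable)
        (Eventually.of_forall fun y => hb hC s₀ s₀ (by simp) y)
    · rw [← coe_pd]
      exact hm.mul ((pd r φ).continuous.comp (by fun_prop)).neg.aestronglyMeasurable
    · refine Eventually.of_forall fun y s hs => ?_
      rw [mul_neg, norm_neg]
      exact hb hC' s₀ s hs y
    · exact hf.abs.const_mul _
    · refine Eventually.of_forall fun y s _ => HasDerivAt.const_mul _ ?_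
      have h1 : HasDerivAt (fun s : ℝ => y - s • e) (-e) s := by
        simpa using ((hasDerivAt_id s).smul_const e).const_sub y
      have h2 := (φ.differentiable (y - s • e)).hasFDerivAt.comp_hasDerivAt s h1
      rw [map_neg] at h2
      exact h2
  have hc := is_const_of_deriv_eq_zero (fun s => (hd s).differentiableAt)
    (fun s => (hd s).deriv) h 0
  have hse : h • e = EuclideanSpace.single r h := by
    rw [he]
    ext i
    simp
  simpa [hse] using hc

theorem independentOf_of_integral_partialDeriv {f : E3 → ℝ}
    (hf : Integrable (fun y => f y * wt y)) {r : Fin 3}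
    (h0 : ∀ φ : 𝓢(E3, ℝ), ∫ y, f y * partialDeriv r φ y = 0) : IndependentOf f r := by
  intro h
  set c : E3 := EuclideanSpace.single r h with hc
  have hfl := locallyIntegrable_of_wt hf
  have hf' : Integrable (fun y => f (y + c) * wt y) := by
    have h1 := hf.comp_add_right c
    refine (h1.abs.const_mul (4 * (1 + ‖c‖ ^ 2) ^ 2)).mono'
      ((hfl.aestronglyMeasurable.comp_measurePreserving
        (measurePreserving_add_right volume c)).mul continuous_wt.aestronglyMeasurable)
      (Eventually.of_forall fun y => ?_)
    have h2 := wt_sub_le (y + c) c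
    rw [add_sub_cancel_right] at h2
    rw [Real.norm_eq_abs, abs_mul, abs_mul, abs_of_pos (wt_pos y), abs_of_pos (wt_pos (y + c))]
    calc _ ≤ |f (y + c)| * (4 * (1 + ‖c‖ ^ 2) ^ 2 * wt (y + c)) := by gcongr
      _ = _ := by ring
  refine ae_eq_of_integral_contDiff_smul_eq (locallyIntegrable_of_wt hf') hfl fun g hg hgc => ?_
  have key := integral_translateTest_eq hf h0 (hgc.toSchwartzMap hg) h
  rw [← integral_add_right_eq_self _ c] at key
  simp only [smul_eq_mul]
  simp_rw [mul_comm (g _)]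
  simpa [← hc] using key

/-! ### Fields with a constant component -/

/-- For each σ this is the divergence of v tested with y ↦ ∂_r ∂_l G_{σ+a}(x - y); Fubini moves the
time integral outside. -/
lemma sum_integral_gaussD3_eq_zero {v : E3 → E3} (hv : WeightedL2 v) (hs : IsSolenoidal v)
    (r l : Fin 3) {a : ℝ} (ha : 0 < a) (x : E3) :
    ∑ k, ∫ y, (∫ σ in Set.Ioi (0 : ℝ), gaussD3 k r l (σ + a) (x - y)) * v y k = 0 := by
  have hle : ∀ k z, ∫ σ in Set.Ioi (0 : ℝ), |gaussD3 k r l (σ + a) z| ≤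
      2112 * ((1 + a⁻¹) ^ 2 * wt z) := fun k z => by
    have h := (integrableOn_gaussD3 k r l (s := 0) (a := a) (by linarith) z).2
    rw [zero_add] at h
    exact h.trans (by gcongr; exact inv_add_sq_le_wt ha z)
  have hint : ∀ k, Integrable (fun p : ℝ × E3 => gaussD3 k r l (p.1 + a) (x - p.2) * v p.2 k)
      ((volume.restrict (Set.Ioi 0)).prod volume) := by
    intro k
    have hm : AEStronglyMeasurable (fun p : ℝ × E3 => gaussD3 k r l (p.1 + a) (x - p.2) * v p.2 k)
        ((volume.restrict (Set.Ioi 0)).prod volume) :=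
      ((measurable_gaussD3 k r l).comp (g := fun p : ℝ × E3 => gaussD3 k r l p.1 p.2)
        (f := fun p : ℝ × E3 => (p.1 + a, x - p.2))
        (by fun_prop)).aestronglyMeasurable.mul
        (aestronglyMeasurable_coord hv.aestronglyMeasurable k).comp_snd
    rw [integrable_prod_iff' hm]
    have hsec : ∀ y, IntegrableOn (fun σ => gaussD3 k r l (σ + a) (x - y)) (Set.Ioi 0) := fun y =>
      (integrableOn_gaussD3 k r l (s := 0) (a := a) (by linarith) (x - y)).1
    refine ⟨Eventually.of_forall fun y => (hsec y).mul_const (v y k), ?_⟩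
    refine ((hv.integrable_apply_wt k).abs.const_mul
      (4 * (2112 * (1 + a⁻¹) ^ 2) * (1 + ‖x‖ ^ 2) ^ 2)).mono'
      hm.norm.prod_swap.integral_prod_right' (Eventually.of_forall fun y => ?_)
    rw [Real.norm_of_nonneg (integral_nonneg fun _ => norm_nonneg _)]
    simp only [norm_mul, Real.norm_eq_abs]
    rw [integral_mul_const, abs_mul, abs_of_pos (wt_pos y)]
    have h1 := abs_kernel_le (K := fun z => ∫ σ in Set.Ioi (0 : ℝ), |gaussD3 k r l (σ + a) z|)
      (C := 2112 * (1 + a⁻¹) ^ 2) (fun z => by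
        rw [abs_of_nonneg (integral_nonneg fun _ => abs_nonneg _), mul_assoc]
        exact hle k z) x y
    calc _ ≤ ((4 * (2112 * (1 + a⁻¹) ^ 2) * (1 + ‖x‖ ^ 2) ^ 2) * wt y) * |v y k| := by
          gcongr
          exact (le_abs_self _).trans h1
      _ = _ := by ring
  have hswap : ∀ k, ∫ y, (∫ σ in Set.Ioi (0 : ℝ), gaussD3 k r l (σ + a) (x - y)) * v y k =
      ∫ σ in Set.Ioi (0 : ℝ), ∫ y, gaussD3 k r l (σ + a) (x - y) * v y k := by
    intro k
    simp_rw [← integral_mul_const]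
    exact (integral_integral_swap (f := fun (σ : ℝ) y =>
      gaussD3 k r l (σ + a) (x - y) * v y k) (hint k)).symm
  simp_rw [hswap]
  rw [← integral_finsetSum _ fun k _ => (hint k).integral_prod_left]
  refine integral_eq_zero_of_ae ?_
  filter_upwards [ae_restrict_mem measurableSet_Ioi] with σ hσ
  have hpos : 0 < σ + a := add_pos hσ ha
  have h := hs.sum_integral hv (reflTrans x (pd r (pd l (gauss (σ + a)))))
  have he : ∀ k y, partialDeriv k (reflTrans x (pd r (pd l (gauss (σ + a))))) y =
      -gaussD3 k r l (σ + a) (x - y) := by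
    intro k y
    rw [← pd3_gauss k r l hpos]
    unfold pd3
    rw [coe_pd]
    exact partialDeriv_comp_sub k (pd r (pd l (gauss (σ + a)))) x y
  simp_rw [he, mul_neg, integral_neg, Finset.sum_neg_distrib, neg_eq_zero] at h
  simp_rw [mul_comm (gaussD3 _ _ _ _ _)]
  exact h

lemma sum_ite_xor (r : Fin 3) (f : Fin 3 → Fin 3 → ℝ) :
    ∑ j, ∑ k, (if ¬(j = r ↔ k = r) then f j k else 0) =
      ∑ k, (if k = r then 0 else f r k + f k r) := by
  fin_cases r <;> simp [Fin.sum_univ_three] <;> ring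

/-- If a divergence free field has a constant component `v_r`, then the mixed part of the bilinear
term is `v_r ∂_r v`. -/
theorem sum_oseenKernel_mixed {v : E3 → E3} (hv : WeightedL2 v) (hs : IsSolenoidal v) {r l : Fin 3}
    (hlr : l ≠ r) {c : ℝ} (hc : ∀ᵐ y, v y r = c) {a : ℝ} (ha : 0 < a) (x : E3) :
    ∑ j, ∑ k, ∫ y, oseenKernel j k l a (x - y) *
      (if ¬(j = r ↔ k = r) then v y j * v y k else 0) =
      c * ∫ y, partialDeriv r (heatKernel a) (x - y) * v y l := by
  have h1 : ∀ j k, ∫ y, oseenKernel j k l a (x - y) *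
      (if ¬(j = r ↔ k = r) then v y j * v y k else 0) =
      if ¬(j = r ↔ k = r) then ∫ y, oseenKernel j k l a (x - y) * (v y j * v y k) else 0 := by
    intro j k
    split_ifs <;> simp
  simp_rw [h1]
  rw [sum_ite_xor]
  set H : Fin 3 → E3 → ℝ := fun k z => ∫ σ in Set.Ioi (0 : ℝ), gaussD3 k r l (σ + a) z with hH
  set D : E3 → ℝ := partialDeriv r (heatKernel a) with hD
  have hO1 : ∀ k z, oseenKernel r k l a z = kron k l * D z + H k z := by
    intro k z
    rw [oseenKernel_eq r k l ha]
    simp only [hH, gaussD3_swap k r l]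
    rfl
  have hO2 : ∀ k z, oseenKernel k r l a z = H k z := by
    intro k z
    rw [oseenKernel_eq k r l ha]
    simp [kron, hlr.symm, hH]
  have hHint : ∀ k, Integrable (fun y => H k (x - y) * v y k) := by
    intro k
    have := integrable_kernel_mul (continuous_oseenKernel k r l ha)
      (abs_oseenKernel_le_wt k r l ha) (hv.integrable_apply_wt k) x
    simpa only [hO2] using this
  have hDint : ∀ k, Integrable (fun y => D (x - y) * v y k) := fun k =>
    integrable_kernel_mul (by rw [← coe_gauss ha, ← coe_pd]; exact SchwartzMap.continuous _)
      (abs_partialDeriv_heatKernel_le_wt r ha) (hv.integrable_apply_wt k) x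
  -- The entries (r,k) and (k,r) share the nonlocal kernel `H k`; only (r,k) has a local part, at k
  -- = l. The missing k = r term is the integral of a mean-zero kernel against a constant, so the
  -- sum of the `H k` terms is complete and the divergence condition annihilates it.
  have hterm : ∀ k, (if k = r then 0 else (∫ y, oseenKernel r k l a (x - y) * (v y r * v y k)) +
      ∫ y, oseenKernel k r l a (x - y) * (v y k * v y r)) =
      c * (kron k l * ∫ y, D (x - y) * v y k) + 2 * c * ∫ y, H k (x - y) * v y k := by
    intro k
    split_ifs with hk
    · subst hk
      have h2 : ∫ y, H k (x - y) * v y k = 0 := by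
        rw [integral_congr_ae (g := fun y => oseenKernel k k l a (x - y) * c)
          (by filter_upwards [hc] with y hy; rw [hy, hO2]), integral_mul_const,
          integral_oseenKernel_sub k k l ha, zero_mul]
      rw [h2]
      simp [kron, hlr.symm]
    · have h3 : ∫ y, oseenKernel r k l a (x - y) * (v y r * v y k) =
          c * (kron k l * ∫ y, D (x - y) * v y k) + c * ∫ y, H k (x - y) * v y k := by
        rw [← mul_add, ← integral_const_mul, ← integral_add ((hDint k).const_mul _) (hHint k),
          ← integral_const_mul]
        refine integral_congr_ae ?_
        filter_upwards [hc] with y hy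
        rw [hy, hO1]
        ring
      have h4 : ∫ y, oseenKernel k r l a (x - y) * (v y k * v y r) =
          c * ∫ y, H k (x - y) * v y k := by
        rw [← integral_const_mul]
        refine integral_congr_ae ?_
        filter_upwards [hc] with y hy
        rw [hy, hO2]
        ring
      rw [h3, h4]
      ring
  simp_rw [hterm]
  rw [Finset.sum_add_distrib, ← Finset.mul_sum, ← Finset.mul_sum,
    sum_integral_gaussD3_eq_zero hv hs r l ha x, mul_zero, add_zero, Finset.sum_eq_single l]
  · simp [kron]
  · intro k _ hk
    simp [kron, hk]
  · simp

/-! ### The terms of the Duhamel integral -/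

/-- The summand of `B(u, u)_l` that comes from `u_j u_k`. -/
def duhamelTerm (u : ℝ → E3 → E3) (j k l : Fin 3) (t : ℝ) (x : E3) : ℝ :=
  ∫ s in Set.Ioo 0 t, ∫ y, oseenKernel j k l (t - s) (x - y) * (u s y j * u s y k)

lemma duhamel_apply (u : ℝ → E3 → E3) (t : ℝ) (x : E3) (l : Fin 3) :
    duhamel u u t x l = ∑ j, ∑ k, duhamelTerm u j k l t x := rfl

lemma duhamelTerm_eq_zero_of_const {u : ℝ → E3 → E3} {j k : Fin 3}
    (h : ∀ᵐ s ∂(volume.restrict (Set.Ioi (0 : ℝ))), IsConstant fun y => u s y j * u s y k)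
    (l : Fin 3) (t : ℝ) (x : E3) : duhamelTerm u j k l t x = 0 := by
  unfold duhamelTerm
  refine integral_eq_zero_of_ae ?_
  filter_upwards [ae_restrict_of_ae_restrict_of_subset Set.Ioo_subset_Ioi_self h,
    ae_restrict_mem measurableSet_Ioo] with s hs hst
  obtain ⟨c, hc⟩ := hs
  rw [integral_congr_ae (g := fun y => oseenKernel j k l (t - s) (x - y) * c)
    (by filter_upwards [hc] with y hy; rw [hy]), integral_mul_const,
    integral_oseenKernel_sub j k l (by linarith [hst.2]), zero_mul]
  rfl

/-- Kernel parity e_j + e_k + e_l plus product parity α_j + α_k, regrouped so that only the sum of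
γ_j = α_j + e_j and γ_k matters; equal ones cancel in characteristic 2. -/
lemma hasSymmetry_duhamelTerm {u : ℝ → E3 → E3} {α : Fin 3 → Fin 3 → ZMod 2} {t : ℝ}
    (h : ∀ s, 0 < s → HasSymmetryType (u s) α) (j k l : Fin 3) :
    HasSymmetry (duhamelTerm u j k l t)
      (basicType l + ((α j + basicType j) + (α k + basicType k))) := by
  have := HasSymmetry.duhamel (j := j) (k := k) (l := l) (t := t)
    (f := fun s y => u s y j * u s y k) (fun s hs => (h s hs.1 j).mul (h s hs.1 k))
  have he : basicType l + ((α j + basicType j) + (α k + basicType k)) =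
      basicType j + basicType k + basicType l + (α j + α k) := by abel
  rwa [he]

lemma sum_prod_eq {M : Type*} [AddCommMonoid M] (f : Fin 3 → Fin 3 → M) :
    ∑ i : Fin 3 × Fin 3, f i.1 i.2 = ∑ j, ∑ k, f j k := Fintype.sum_prod_type _

section Symmetric

variable {u₀ : E3 → E3} {u : ℝ → E3 → E3} {α : Fin 3 → Fin 3 → ZMod 2}

/-- The integral equation shows that B(u,u)_l inherits the symmetry α_l from u₀ and u. Every
isotypical component of the Duhamel sum belonging to another character must therefore vanish. -/
lemma IsMildSolution.ae_sum_group_eq_zero (hu : IsMildSolution u₀ u)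
    (hα : ∀ t, 0 ≤ t → HasSymmetryType (u t) α) {l : Fin 3} {δ : Fin 3 → ZMod 2}
    (hδ : δ ≠ α l + basicType l) {t : ℝ} (ht : 0 < t) :
    ∀ᵐ x, ∑ j, ∑ k, (if (α j + basicType j) + (α k + basicType k) = δ then
      duhamelTerm u j k l t x else 0) = 0 := by
  have h1 := ae_sum_eq_zero_of_hasSymmetry (ι := Fin 3 × Fin 3)
    (f := fun i => duhamelTerm u i.1 i.2 l t)
    (fun i => hasSymmetry_duhamelTerm (fun s hs => hα s hs.le) i.1 i.2 l)
    (α := α l) (δ := basicType l + δ) ?_ ?_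
  · filter_upwards [h1] with x hx
    rw [← sum_prod_eq]
    refine Eq.trans (Finset.sum_congr rfl fun i _ => ?_) hx
    simp only [add_right_inj]
  · have h2 : HasSymmetry (fun x => heat t (fun y => u₀ y l) x - u t x l) (α l) :=
      ((((hα 0 le_rfl).congr hu.initial) l).heat t).sub (hα t ht.le l)
    refine h2.congr ?_
    filter_upwards [hu.integral_equation t ht] with x hx
    rw [sum_prod_eq (fun j k => duhamelTerm u j k l t x), ← duhamel_apply, hx]
    simp [heatVec]
  · intro h
    apply hδ
    rw [← h, add_right_comm, CharTwo.add_self_eq_zero, zero_add]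

lemma IsMildSolution.weightedL2 (hu : IsMildSolution u₀ u) {t : ℝ} (ht : 0 ≤ t) :
    WeightedL2 (u t) := by
  rcases ht.eq_or_lt with rfl | ht
  · refine ⟨hu.data_weightedL2.1.congr hu.initial.symm, hu.data_weightedL2.2.congr ?_⟩
    filter_upwards [hu.initial] with x hx
    rw [hx]
  · exact hu.inPathSpace.weightedL2 t ht

lemma IsMildSolution.isSolenoidal (hu : IsMildSolution u₀ u) {t : ℝ} (ht : 0 ≤ t) :
    IsSolenoidal (u t) := by
  rcases ht.eq_or_lt with rfl | ht
  · intro φ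
    refine Eq.trans (integral_congr_ae ?_) (hu.data_solenoidal φ)
    filter_upwards [hu.initial] with x hx
    rw [hx]
  · exact hu.solenoidal t ht

/-- Isolation of the r-th character gives ∂_r u_r = 0, so u_r does not depend on x_r; the dimension
hypothesis is used with both indices equal to r. -/
lemma IsMildSolution.isConstant_apply (hu : IsMildSolution u₀ u)
    (hα : ∀ t, 0 ≤ t → HasSymmetryType (u t) α)
    (hdim : ∀ t : ℝ, 0 ≤ t → NotTwoAndHalfDimensional (u t)) {r : Fin 3}
    (hr : ∀ l, l ≠ r → α l + basicType l ≠ α r + basicType r) {t : ℝ} (ht : 0 ≤ t) :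
    IsConstant (fun x => u t x r) := by
  by_cases h0 : ∀ᵐ x : E3, u t x r = 0
  · exact ⟨0, h0⟩
  · exact hdim t ht r h0 r (independentOf_of_integral_partialDeriv
      ((hu.weightedL2 ht).integrable_apply_wt r)
      ((hu.isSolenoidal ht).integral_partialDeriv_eq_zero (hu.weightedL2 ht) (hα t ht) hr))

lemma IsConstant.mul {f g : E3 → ℝ} (hf : IsConstant f) (hg : IsConstant g) :
    IsConstant (fun x => f x * g x) := by
  obtain ⟨c, hc⟩ := hf
  obtain ⟨d, hd⟩ := hg
  exact ⟨c * d, by filter_upwards [hc, hd] with x h1 h2; rw [h1, h2]⟩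

lemma isBeltramiType_of_isConstant (hs : IsSolenoidal u₀)
    (h : ∀ l, IsConstant fun x => u₀ x l) : IsBeltramiType u₀ := by
  choose c hc using h
  refine isBeltramiType_of_const hs (c := WithLp.toLp 2 c) ?_
  filter_upwards [ae_all_iff.2 hc] with x hx
  ext i
  exact hx i

/-- A nontrivial character takes a value other than 1, by the orthogonality sum, and a nonzero
constant cannot change under a reflection. -/
lemma eq_zero_of_hasSymmetry_of_const {f : E3 → ℝ} {c : ℝ} {a : Fin 3 → ZMod 2}
    (hf : HasSymmetry f a) (hc : ∀ᵐ x, f x = c) (ha : a ≠ 0) : c = 0 := by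
  obtain ⟨β, hβ⟩ : ∃ β, reflectSign a β ≠ 1 := by
    by_contra! h
    have h1 := sum_reflectSign a
    simp only [h, if_neg ha, Finset.sum_const, nsmul_eq_mul, mul_one] at h1
    simp at h1
  obtain ⟨x, h1, h2, h3⟩ := ((hf β).and (hc.and
    ((measurePreserving_reflect β).quasiMeasurePreserving.ae hc))).exists
  rw [h2, h3] at h1
  by_contra h0
  exact hβ (mul_right_cancel₀ h0 (by rw [← h1, one_mul]))

lemma basicType_ne_zero (r : Fin 3) : basicType r ≠ 0 := fun h => by
  have := congrFun h r
  simp [basicType] at this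

lemma trichotomy {X : Type*} (γ : Fin 3 → X) :
    (∃ g, ∀ l, γ l = g) ∨ (∃ r g, γ r ≠ g ∧ ∀ l, l ≠ r → γ l = g) ∨ ∀ r l, l ≠ r → γ l ≠ γ r := by
  by_cases h1 : γ 0 = γ 1
  · by_cases h2 : γ 0 = γ 2
    · refine Or.inl ⟨γ 0, fun l => ?_⟩
      fin_cases l <;> simp [← h1, ← h2]
    · refine Or.inr (Or.inl ⟨2, γ 0, fun h => h2 h.symm, fun l hl => ?_⟩)
      fin_cases l
      · rfl
      · exact h1.symm
      · exact absurd rfl hl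
  · by_cases h2 : γ 0 = γ 2
    · refine Or.inr (Or.inl ⟨1, γ 0, fun h => h1 h.symm, fun l hl => ?_⟩)
      fin_cases l
      · rfl
      · exact absurd rfl hl
      · exact h2.symm
    · by_cases h3 : γ 1 = γ 2
      · refine Or.inr (Or.inl ⟨0, γ 1, h1, fun l hl => ?_⟩)
        fin_cases l
        · exact absurd rfl hl
        · rfl
        · exact h3.symm
      · refine Or.inr (Or.inr fun r l hl => ?_)
        fin_cases r <;> fin_cases l <;> first
          | exact absurd rfl hl | assumption | exact Ne.symm ‹_›

/-- The mixed part of the nonlinear term forces a field with a constant component `u_r ≠ 0` to be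
constant. -/
lemma IsMildSolution.ae_isConstant_of_mixed (hu : IsMildSolution u₀ u)
    (hdim : ∀ t : ℝ, 0 ≤ t → NotTwoAndHalfDimensional (u t)) {r : Fin 3} {c : ℝ → ℝ}
    (hc : ∀ t, 0 ≤ t → ∀ᵐ x, u t x r = c t)
    (hmix : ∀ l, l ≠ r → ∀ t, 0 < t → ∀ᵐ x, ∑ j, ∑ k, (if ¬(j = r ↔ k = r) then
      duhamelTerm u j k l t x else 0) = 0) :
    ∀ᵐ s ∂(volume.restrict (Set.Ioi (0 : ℝ))), c s ≠ 0 → ∀ l, IsConstant fun y => u s y l := by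
  have h1 : ∀ l, l ≠ r → ∀ᵐ s ∂(volume.restrict (Set.Ioi (0 : ℝ))), c s ≠ 0 →
      IsConstant fun y => u s y l := by
    intro l hl
    have h2 := ae_exists_seq_kernel_eq_zero l
      (P := fun j k s y => if ¬(j = r ↔ k = r) then u s y j * u s y k else 0) ?_ ?_
    · filter_upwards [h2, ae_restrict_mem measurableSet_Ioi] with s hs hs0 hcs
      obtain ⟨a, ha, ha1, ha0, hz⟩ := hs
      have hs0' : 0 ≤ s := le_of_lt hs0
      -- The mixed group equals c(s) times the heat-regularized ∂_r u_l. Hence ∂_r u_l = 0, and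
      -- since u_r = c(s) ≠ 0 the dimension hypothesis makes u_l constant.
      have hw := hu.weightedL2 hs0'
      have h3 : ∀ n x, ∫ y, partialDeriv r (heatKernel (a n)) (x - y) * u s y l = 0 := by
        intro n x
        have h4 := hz n x
        rw [sum_oseenKernel_mixed hw (hu.isSolenoidal hs0') hl (hc s hs0') (ha n) x] at h4
        exact (mul_eq_zero.1 h4).resolve_left hcs
      refine hdim s hs0' r (fun h0 => hcs ?_) l (independentOf_of_integral_partialDeriv
        (hw.integrable_apply_wt l) (integral_partialDeriv_eq_zero_of_heatKernel r
          (hw.integrable_apply_wt l) ha ha1 ha0 h3))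
      obtain ⟨x, hx1, hx2⟩ := (h0.and (hc s hs0')).exists
      rw [← hx2, hx1]
    · intro T hT j k
      by_cases h : ¬(j = r ↔ k = r)
      · simp only [if_pos h]
        exact hu.inPathSpace.integrable_mul_wt j k hT
      · simp only [if_neg h, zero_mul]
        exact integrable_zero _ _ _
    · intro t ht
      filter_upwards [hmix l hl t ht] with x hx
      refine Eq.trans (Finset.sum_congr rfl fun j _ => Finset.sum_congr rfl fun k _ => ?_) hx
      by_cases h : ¬(j = r ↔ k = r)
      · simp only [if_pos h]
        rfl
      · simp only [if_neg h, mul_zero, integral_zero]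
  have h2 : ∀ᵐ s ∂(volume.restrict (Set.Ioi (0 : ℝ))), ∀ l, l ≠ r → c s ≠ 0 →
      IsConstant fun y => u s y l := by
    rw [ae_all_iff]
    intro l
    by_cases hl : l = r
    · exact Eventually.of_forall fun s h => absurd hl h
    · filter_upwards [h1 l hl] with s hs _ using hs
  filter_upwards [h2, ae_restrict_mem measurableSet_Ioi] with s hs hs0 hcs l
  by_cases hl : l = r
  · exact hl ▸ ⟨c s, hc s (le_of_lt hs0)⟩
  · exact hs l hl hcs

/-- The case in which `u_r` is singled out by the symmetry type. -/
lemma IsMildSolution.basic_or_beltrami_of_exceptional (hu : IsMildSolution u₀ u)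
    (hα : ∀ t, 0 ≤ t → HasSymmetryType (u t) α)
    (hdim : ∀ t : ℝ, 0 ≤ t → NotTwoAndHalfDimensional (u t)) {r : Fin 3} {g : Fin 3 → ZMod 2}
    (hrg : α r + basicType r ≠ g) (hg : ∀ l, l ≠ r → α l + basicType l = g) :
    HasSymmetryType u₀ basicType ∨ IsBeltramiType u₀ := by
  have hconst : ∀ t, 0 ≤ t → IsConstant (fun x => u t x r) := fun t ht =>
    hu.isConstant_apply hα hdim (fun l hl => by rw [hg l hl]; exact hrg.symm) ht
  choose! c hc using hconst
  set ρ := α r + basicType r with hρ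
  have hsame : ∀ j k, (j = r ↔ k = r) →
      (α j + basicType j) + (α k + basicType k) = 0 := by
    intro j k hjk
    by_cases hj : j = r
    · rw [hj, hjk.1 hj, CharTwo.add_self_eq_zero]
    · rw [hg j hj, hg k fun hk => hj (hjk.2 hk), CharTwo.add_self_eq_zero]
  have hdiff : ∀ j k, ¬(j = r ↔ k = r) →
      (α j + basicType j) + (α k + basicType k) = ρ + g := by
    intro j k hjk
    by_cases hj : j = r
    · rw [hj, hg k fun hk => hjk ⟨fun _ => hk, fun _ => hj⟩]
    · have hk : k = r := by
        by_contra hk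
        exact hjk ⟨fun h => absurd h hj, fun h => absurd h hk⟩
      rw [hk, hg j hj, add_comm]
  have hρg : ρ + g ≠ 0 := fun h => hrg (CharTwo.add_eq_zero.1 h)
  have hgroup0 : ∀ l, α l + basicType l ≠ 0 → ∀ t, 0 < t → ∀ᵐ x, ∑ j, ∑ k,
      (if (j = r ↔ k = r) then duhamelTerm u j k l t x else 0) = 0 := by
    intro l hl t ht
    filter_upwards [hu.ae_sum_group_eq_zero hα hl.symm ht] with x hx
    refine Eq.trans (Finset.sum_congr rfl fun j _ => Finset.sum_congr rfl fun k _ => ?_) hx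
    by_cases h : (j = r ↔ k = r)
    · rw [if_pos h, if_pos (hsame j k h)]
    · rw [if_neg h, if_neg (by rw [hdiff j k h]; exact hρg)]
  have hgroup1 : ∀ l, α l + basicType l ≠ ρ + g → ∀ t, 0 < t → ∀ᵐ x, ∑ j, ∑ k,
      (if ¬(j = r ↔ k = r) then duhamelTerm u j k l t x else 0) = 0 := by
    intro l hl t ht
    filter_upwards [hu.ae_sum_group_eq_zero hα hl.symm ht] with x hx
    refine Eq.trans (Finset.sum_congr rfl fun j _ => Finset.sum_congr rfl fun k _ => ?_) hx
    by_cases h : (j = r ↔ k = r)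
    · rw [if_neg (not_not.2 h), if_neg (by rw [hsame j k h]; exact hρg.symm)]
    · rw [if_pos h, if_pos (hdiff j k h)]
  have hsplit : ∀ l t x, ∑ j, ∑ k, duhamelTerm u j k l t x =
      ∑ j, ∑ k, (if (j = r ↔ k = r) then duhamelTerm u j k l t x else 0) +
      ∑ j, ∑ k, (if ¬(j = r ↔ k = r) then duhamelTerm u j k l t x else 0) := by
    intro l t x
    rw [← Finset.sum_add_distrib]
    refine Finset.sum_congr rfl fun j _ => ?_
    rw [← Finset.sum_add_distrib]
    refine Finset.sum_congr rfl fun k _ => ?_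
    by_cases h : (j = r ↔ k = r) <;> simp [h]
  by_cases hg0 : g = 0
  · subst hg0
    rw [add_zero] at *
    by_cases hc0 : c 0 = 0
    -- Here u_r vanishes initially and thus has every symmetry, while g = 0 means α_l = e_l for the
    -- other components.
    · left
      intro l
      by_cases hl : l = r
      · subst hl
        intro β
        have h0 : ∀ᵐ x, u₀ x l = 0 := by
          filter_upwards [hu.initial, hc 0 le_rfl] with x h1 h2
          rw [← h1, h2, hc0]
        filter_upwards [h0, (measurePreserving_reflect β).quasiMeasurePreserving.ae h0]
          with x h1 h2
        rw [h1, h2, mul_zero]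
      · have h1 := ((hα 0 le_rfl).congr hu.initial) l
        rwa [CharTwo.add_eq_zero.1 (hg l hl)] at h1
    · right
      have hae := hu.ae_isConstant_of_mixed hdim hc
        (fun l hl => hgroup1 l (by rw [hg l hl]; exact hρg.symm))
      -- At almost every time either u_r = 0 or the whole field is constant, so every mixed product
      -- is constant and drops out.
      have hmixed : ∀ j k, ¬(j = r ↔ k = r) → ∀ l t x, duhamelTerm u j k l t x = 0 := by
        intro j k hjk
        refine duhamelTerm_eq_zero_of_const ?_
        filter_upwards [hae, ae_restrict_mem measurableSet_Ioi] with s hs hs0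
        by_cases hcs : c s = 0
        · refine ⟨0, ?_⟩
          filter_upwards [hc s (le_of_lt hs0)] with y hy
          rw [hcs] at hy
          by_cases hj : j = r
          · rw [hj, hy, zero_mul]
          · have hk : k = r := by
              by_contra hk
              exact hjk ⟨fun h => absurd h hj, fun h => absurd h hk⟩
            rw [hk, hy, mul_zero]
        · exact (hs hcs j).mul (hs hcs k)
      -- Component r loses the group δ = 0 since γ_r ≠ 0, and the mixed group by the preceding step.
      -- So u_r follows the heat flow of a constant, c never vanishes, and u is constant at almost
      -- every time.
      have hct : ∀ t, 0 < t → c t = c 0 := by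
        intro t ht
        have hu0 : ∀ᵐ x, u₀ x r = c 0 := by
          filter_upwards [hu.initial, hc 0 le_rfl] with x h1 h2
          rw [← h1, h2]
        obtain ⟨x, h1, h2, h3⟩ := ((hu.integral_equation t ht).and
          ((hc t ht.le).and (hgroup0 r hρg t ht))).exists
        have h4 : duhamel u u t x r = 0 := by
          rw [duhamel_apply, hsplit, h3, zero_add]
          refine Finset.sum_eq_zero fun j _ => Finset.sum_eq_zero fun k _ => ?_
          split_ifs with h
          · rfl
          · exact hmixed j k h r t x
        have h5 : heat t (fun y => u₀ y r) x = c 0 := by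
          unfold heat
          rw [integral_congr_ae (g := fun y => heatKernel t (x - y) * c 0)
            (by filter_upwards [hu0] with y hy; rw [hy]), integral_mul_const,
            integral_sub_left_eq_self (heatKernel t) volume x, integral_heatKernel ht, one_mul]
        refine h2.symm.trans ?_
        simp only [h1, PiLp.sub_apply, h4, sub_zero]
        exact h5
      refine hu.isBeltramiType fun l t ht => Eventually.of_forall fun x => ?_
      rw [duhamel_apply]
      refine Finset.sum_eq_zero fun j _ => Finset.sum_eq_zero fun k _ => ?_
      refine duhamelTerm_eq_zero_of_const ?_ l t x
      filter_upwards [hae, ae_restrict_mem measurableSet_Ioi] with s hs hs0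
      have hcs : c s ≠ 0 := by rw [hct s hs0]; exact hc0
      exact (hs hcs j).mul (hs hcs k)
  · right
    by_cases hρ0 : ρ = 0
    -- Now γ_r = 0, so the constant u_r has symmetry e_r ≠ 0 and must vanish; this removes all mixed
    -- terms. For l = r the integral equation itself gives B(u,u)_r = 0.
    · have hc0 : ∀ t, 0 ≤ t → c t = 0 := fun t ht =>
        eq_zero_of_hasSymmetry_of_const (hα t ht r) (hc t ht)
          (by rw [CharTwo.add_eq_zero.1 hρ0]; exact basicType_ne_zero r)
      have hmixed : ∀ j k, ¬(j = r ↔ k = r) → ∀ l t x, duhamelTerm u j k l t x = 0 := by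
        intro j k hjk
        refine duhamelTerm_eq_zero_of_const ?_
        filter_upwards [ae_restrict_mem measurableSet_Ioi] with s hs0
        refine ⟨0, ?_⟩
        filter_upwards [hc s (le_of_lt hs0)] with y hy
        rw [hc0 s (le_of_lt hs0)] at hy
        by_cases hj : j = r
        · rw [hj, hy, zero_mul]
        · have hk : k = r := by
            by_contra hk
            exact hjk ⟨fun h => absurd h hj, fun h => absurd h hk⟩
          rw [hk, hy, mul_zero]
      refine hu.isBeltramiType fun l t ht => ?_
      simp only [duhamel_apply]
      by_cases hl : l = r
      · subst hl
        have hu0 : ∀ᵐ x, u₀ x l = 0 := by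
          filter_upwards [hu.initial, hc 0 le_rfl] with x h1 h2
          rw [← h1, h2, hc0 0 le_rfl]
        filter_upwards [hu.integral_equation t ht, hc t ht.le] with x h1 h2
        have h5 : heat t (fun y => u₀ y l) x = 0 := by
          unfold heat
          refine integral_eq_zero_of_ae ?_
          filter_upwards [hu0] with y hy
          rw [hy, mul_zero]
          rfl
        rw [h1, hc0 t ht.le, PiLp.sub_apply] at h2
        change heat t (fun y => u₀ y l) x - duhamel u u t x l = 0 at h2
        rw [← duhamel_apply]
        linarith
      · filter_upwards [hgroup0 l (by rw [hg l hl]; exact hg0) t ht] with x hx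
        rw [hsplit, hx, zero_add]
        refine Finset.sum_eq_zero fun j _ => Finset.sum_eq_zero fun k _ => ?_
        split_ifs with h
        · rfl
        · exact hmixed j k h l t x
    -- With both γ_r and g nonzero, no γ_l equals 0 or γ_r + g, so both groups cancel in every
    -- component.
    · refine hu.isBeltramiType fun l t ht => ?_
      simp only [duhamel_apply]
      have h0 : α l + basicType l ≠ 0 := by
        by_cases hl : l = r
        · rw [hl]; exact hρ0
        · rw [hg l hl]; exact hg0
      have h1 : α l + basicType l ≠ ρ + g := by
        by_cases hl : l = r
        · rw [hl]
          exact fun h => hg0 (left_eq_add.1 h)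
        · rw [hg l hl]
          exact fun h => hρ0 (right_eq_add.1 h)
      filter_upwards [hgroup0 l h0 t ht, hgroup1 l h1 t ht] with x hx0 hx1
      rw [hsplit, hx0, hx1, add_zero]

/-- A mild solution whose symmetry type is preserved has a datum of basic symmetry type or of
Beltrami type. -/
theorem IsMildSolution.basic_or_beltrami (hu : IsMildSolution u₀ u)
    (hα : ∀ t, 0 ≤ t → HasSymmetryType (u t) α)
    (hdim : ∀ t : ℝ, 0 ≤ t → NotTwoAndHalfDimensional (u t)) :
    HasSymmetryType u₀ basicType ∨ IsBeltramiType u₀ := by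
  rcases trichotomy fun l => α l + basicType l with ⟨g, hg⟩ | ⟨r, g, hrg, hg⟩ | hne
  · by_cases hg0 : g = 0
    · left
      intro l
      have h1 := ((hα 0 le_rfl).congr hu.initial) l
      rwa [CharTwo.add_eq_zero.1 ((hg l).trans hg0)] at h1
    · right
      refine hu.isBeltramiType fun l t ht => ?_
      simp only [duhamel_apply]
      filter_upwards [hu.ae_sum_group_eq_zero hα (l := l) (δ := 0)
        (by rw [hg l]; exact fun h => hg0 h.symm) ht] with x hx
      refine Eq.trans (Finset.sum_congr rfl fun j _ => Finset.sum_congr rfl fun k _ => ?_) hx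
      rw [if_pos (by rw [hg j, hg k, CharTwo.add_self_eq_zero])]
  · exact hu.basic_or_beltrami_of_exceptional hα hdim hrg hg
  · refine Or.inr (isBeltramiType_of_isConstant hu.data_solenoidal fun l => ?_)
    obtain ⟨c, hc⟩ := hu.isConstant_apply hα hdim (hne l) le_rfl
    refine ⟨c, ?_⟩
    filter_upwards [hc, hu.initial] with x h1 h2
    rw [← h2, h1]

end Symmetric

/-! ### Persistence of the symmetry -/

lemma ae_eq_of_integral_test {f g : E3 → ℝ} (hf : Integrable (fun y => f y * wt y))
    (hg : Integrable (fun y => g y * wt y)) (h : ∀ φ : 𝓢(E3, ℝ), ∫ x, f x * φ x = ∫ x, g x * φ x) :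
    f =ᵐ[volume] g := by
  refine ae_eq_of_integral_contDiff_smul_eq (locallyIntegrable_of_wt hf)
    (locallyIntegrable_of_wt hg) fun φ hφ hφc => ?_
  simp only [smul_eq_mul]
  simp_rw [mul_comm (φ _)]
  exact h (hφc.toSchwartzMap hφ)

lemma wt_reflect (β : Fin 3 → ZMod 2) (x : E3) : wt (reflect β x) = wt x := by
  unfold wt
  rw [norm_reflect]

/-- Reflections act on test functions, so parity passes to limits of pairings; weighted
integrability turns equality of distributions into equality a.e. -/
lemma HasSymmetry.of_tendsto {p : ℕ → E3 → ℝ} {f : E3 → ℝ} {a : Fin 3 → ZMod 2}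
    (hf : Integrable (fun y => f y * wt y)) (hp : ∀ n, HasSymmetry (p n) a)
    (h : ∀ φ : 𝓢(E3, ℝ), Tendsto (fun n => ∫ x, p n x * φ x) atTop (𝓝 (∫ x, f x * φ x))) :
    HasSymmetry f a := by
  intro β
  refine ae_eq_of_integral_test ?_ ?_ fun φ => ?_
  · have h1 := (measurePreserving_reflect β).integrable_comp_of_integrable hf
    refine h1.congr (Eventually.of_forall fun x => ?_)
    simp only [Function.comp_apply, wt_reflect]
  · simp_rw [mul_assoc]
    exact hf.const_mul _
  · have h1 : ∫ x, f (reflect β x) * φ x = ∫ x, f x * reflectTest β φ x := by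
      rw [← integral_reflect β (fun x => f x * reflectTest β φ x), coe_reflectTest]
      simp_rw [reflect_reflect]
    have h2 : ∀ n, ∫ x, p n x * reflectTest β φ x = reflectSign a β * ∫ x, p n x * φ x := by
      intro n
      rw [← integral_reflect β, coe_reflectTest, ← integral_const_mul]
      refine integral_congr_ae ?_
      filter_upwards [hp n β] with x hx
      rw [hx, reflect_reflect, mul_assoc]
    have h3 := h (reflectTest β φ)
    simp_rw [h2] at h3
    rw [h1]
    simp_rw [mul_assoc]
    rw [integral_const_mul]
    exact tendsto_nhds_unique h3 ((h φ).const_mul _)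

lemma hasSymmetryType_heatVec {u₀ : E3 → E3} {α : Fin 3 → Fin 3 → ZMod 2}
    (h : HasSymmetryType u₀ α) (t : ℝ) : HasSymmetryType (heatVec t u₀) α :=
  fun l => (h l).heat t

/-- For the basic type all γ_j vanish, so every Duhamel term of the l-th component again has
symmetry e_l. -/
lemma hasSymmetryType_picard {u₀ : E3 → E3} (h : HasSymmetryType u₀ basicType) (n : ℕ) (t : ℝ) :
    HasSymmetryType (picard u₀ n t) basicType := by
  induction n generalizing t with
  | zero => exact hasSymmetryType_heatVec h t
  | succ n ih =>
    intro l
    refine (hasSymmetryType_heatVec h t l).sub ?_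
    change HasSymmetry (fun x => ∑ j, ∑ k, duhamelTerm (picard u₀ n) j k l t x) (basicType l)
    refine HasSymmetry.sum fun j _ => HasSymmetry.sum fun k _ => ?_
    have := hasSymmetry_duhamelTerm (t := t) (fun s _ => ih s) j k l
    rwa [CharTwo.add_self_eq_zero, CharTwo.add_self_eq_zero, add_zero, add_zero] at this

/-! ### Solutions with Beltrami data -/

lemma lerayDeriv_reflTrans (j k l : Fin 3) (x : E3) (φ : 𝓢(E3, ℝ)) (y : E3) :
    lerayDeriv j k l (reflTrans x φ) y = -lerayDeriv j k l φ (x - y) := by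
  have h : ∀ i (f : E3 → ℝ), partialDeriv i (fun z => f (x - z)) = fun z => -partialDeriv i f (x - z) :=
    fun i f => funext fun z => partialDeriv_comp_sub i f x z
  have hn : ∀ i (f : E3 → ℝ), partialDeriv i (fun z => -f z) = fun z => -partialDeriv i f z := by
    intro i f
    funext z
    simp only [partialDeriv]
    rw [fderiv_fun_neg]
    rfl
  have hc : (reflTrans x φ : E3 → ℝ) = fun z => φ (x - z) := rfl
  unfold lerayDeriv invNegLaplacian
  rw [hc]
  simp only [h, hn, neg_neg]
  rw [← integral_sub_left_eq_self _ volume x]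
  simp only [sub_sub_cancel, mul_neg, integral_neg]
  have : ∀ z, ‖y - (x - z)‖ = ‖x - y - z‖ := fun z => by
    rw [← norm_neg, show -(y - (x - z)) = x - y - z by abel]
  simp_rw [this]
  split_ifs <;> ring

lemma duhamel_congr {v w : ℝ → E3 → E3} {t : ℝ} (h : ∀ s, 0 < s → v s =ᵐ[volume] w s) (x : E3) :
    duhamel v v t x = duhamel w w t x := by
  ext l
  rw [duhamel_apply, duhamel_apply]
  refine Finset.sum_congr rfl fun j _ => Finset.sum_congr rfl fun k _ => ?_
  refine setIntegral_congr_fun measurableSet_Ioo fun s hs => integral_congr_ae ?_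
  filter_upwards [h s hs.1] with y hy
  rw [hy]

lemma IsBeltramiType.duhamel_heatVec {u₀ : E3 → E3} (h : IsBeltramiType u₀)
    (hp : InPathSpace fun t => heatVec t u₀) {t : ℝ} (ht : 0 < t) :
    ∀ᵐ x, duhamel (fun t => heatVec t u₀) (fun t => heatVec t u₀) t x = 0 := by
  filter_upwards [hp.duhamel_integrable t ht] with x hx
  ext l
  rw [duhamel_apply]
  unfold duhamelTerm
  have hi : ∀ j k, Integrable (fun s => ∫ y, oseenKernel j k l (t - s) (x - y) *
      (heatVec s u₀ y j * heatVec s u₀ y k)) (volume.restrict (Set.Ioo 0 t)) :=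
    fun j k => (hx j k l).integral_prod_left
  simp_rw [← integral_finsetSum _ fun k _ => hi _ k]
  rw [← integral_finsetSum _ fun j _ => integrable_finsetSum _ fun k _ => hi j k]
  refine integral_eq_zero_of_ae ?_
  filter_upwards [ae_restrict_mem measurableSet_Ioo] with s hs
  have hts : 0 < t - s := by linarith [hs.2]
  -- The test function y ↦ G_{t-s}(x - y) turns the vanishing distribution at time s into the
  -- integrand of the Duhamel integral at x.
  have h1 := h.2 s hs.1 l (reflTrans x (gauss (t - s)))
  unfold lerayBilinear at h1
  have h2 : ∀ j k y, lerayDeriv j k l (fun z => reflTrans x (gauss (t - s)) z) y =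
      -oseenKernel j k l (t - s) (x - y) := by
    intro j k y
    rw [lerayDeriv_reflTrans, coe_gauss hts]
    rfl
  simp_rw [h2, mul_neg, integral_neg, Finset.sum_neg_distrib, neg_neg] at h1
  simp_rw [mul_comm (oseenKernel _ _ _ _ _)]
  exact h1

/-- The Duhamel integral of the heat flow vanishes, so by induction all iterates coincide with it; u
is the limit of this constant sequence. -/
lemma IsMildSolution.ae_eq_heatVec {u₀ : E3 → E3} {u : ℝ → E3 → E3} (hu : IsMildSolution u₀ u)
    (h : IsBeltramiType u₀) {t : ℝ} (ht : 0 < t) : u t =ᵐ[volume] heatVec t u₀ := by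
  have hp : ∀ n t, 0 < t → picard u₀ n t =ᵐ[volume] heatVec t u₀ := by
    intro n
    induction n with
    | zero => exact fun t _ => Eventually.of_forall fun x => rfl
    | succ n ih =>
      intro t ht
      filter_upwards [h.duhamel_heatVec (hu.picard_inPathSpace 0) ht] with x hx
      change heatVec t u₀ x - duhamel (picard u₀ n) (picard u₀ n) t x = heatVec t u₀ x
      rw [duhamel_congr ih, hx, sub_zero]
  have hl : ∀ l, ∀ᵐ x, u t x l = heatVec t u₀ x l := by
    intro l
    refine ae_eq_of_integral_test ((hu.weightedL2 ht.le).integrable_apply_wt l)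
      (((hu.picard_inPathSpace 0).weightedL2 t ht).integrable_apply_wt l) fun φ => ?_
    have h1 := hu.picard_tendsto t ht l φ
    have h2 : ∀ n, ∫ x, picard u₀ n t x l * φ x = ∫ x, heatVec t u₀ x l * φ x := fun n =>
      integral_congr_ae (by filter_upwards [hp n t ht] with x hx; rw [hx])
    simp_rw [h2] at h1
    exact tendsto_nhds_unique h1 tendsto_const_nhds
  filter_upwards [ae_all_iff.2 hl] with x hx
  ext l
  exact hx l

end NavierStokes

end

theorem mainTheorem1 (u₀ : NavierStokes.E3 → NavierStokes.E3)
    (u : ℝ → NavierStokes.E3 → NavierStokes.E3)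
    (hu : NavierStokes.IsMildSolution u₀ u)
    (hsym : ∃ α : Fin 3 → Fin 3 → ZMod 2, NavierStokes.HasSymmetryType u₀ α)
    (hdim : ∀ t : ℝ, 0 ≤ t → NavierStokes.NotTwoAndHalfDimensional (u t)) :
    (∃ α : Fin 3 → Fin 3 → ZMod 2, ∀ t : ℝ, 0 ≤ t → NavierStokes.HasSymmetryType (u t) α) ↔
      (NavierStokes.HasSymmetryType u₀ NavierStokes.basicType ∨
        NavierStokes.IsBeltramiType u₀) := by
  constructor
  · rintro ⟨α, hα⟩
    exact hu.basic_or_beltrami hα hdim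
  · rintro (h | h)
    · refine ⟨NavierStokes.basicType, fun t ht => ?_⟩
      rcases ht.eq_or_lt with rfl | ht
      · exact h.congr hu.initial.symm
      · exact fun l => NavierStokes.HasSymmetry.of_tendsto
          ((hu.weightedL2 ht.le).integrable_apply_wt l)
          (fun n => NavierStokes.hasSymmetryType_picard h n t l) (hu.picard_tendsto t ht l)
    · obtain ⟨α, hα⟩ := hsym
      refine ⟨α, fun t ht => ?_⟩
      rcases ht.eq_or_lt with rfl | ht
      · exact hα.congr hu.initial.symm
      · exact (NavierStokes.hasSymmetryType_heatVec hα t).congr (hu.ae_eq_heatVec h ht).symm
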